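/- An (a,b)-module is a free $\mathbb C[[b]]$-module of finite rank with a $\mathbb C$-linear $b$-adically continuous map $a$ such that $ab-ba=b^2$; over a reduced complex space $X$, a sheaf of $\mathcal O_X$-(a,b)-modules is a locally free sheaf of finite type of $\mathcal O_X[[b]]$-modules with such an $\mathcal O_X$-linear action of $a$. For $\mu\in\,]0,1]\cap\mathbb Q$ let $\Xi_\mu^{(N)}=\bigoplus_{j=0}^N\mathbb C[[b]]\,e_{\mu,j}$ with $a e_{\mu,0}=\mu b e_{\mu,0}$, $a e_{\mu,j}=\mu b e_{\mu,j}+b e_{\mu,j-1}$ for $j\ge 1$. A holomorphic family of rank $k$ $[\mu]$-primitive themes over $X$ is a sheaf of $\mathcal O_X$-(a,b)-modules which is locally isomorphic to the subsheaf $\mathbb E_\varphi$ generated by the $a^\nu\varphi$, where $\varphi$ is a holomorphic map to $\Xi_\mu^{(k-1)}$ such that $\mathbb E_\varphi$ is free with basis $\varphi,\dots,a^{k-1}\varphi$ and has at each point $x$ the fibre generated by the $a^\nu\varphi(x)$ in $\Xi_\mu^{(k-1)}$, of rank $k$. It has fundamental invariants $\lambda_1,p_1,\dots,p_{k-1}$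 if each fibre has a filtration by $a$-stable submodules with successive quotients $\mathbb C[[b]]e_j$, $a e_j=\lambda_j b e_j$, $\lambda_{j+1}=\lambda_j+p_j-1$. Such a family $\mathbb E$ is universal near $x_0\in X$ if, for every holomorphic family $\mathbb H$ with the same invariants over a reduced complex space $Y$ and every $y_0\in Y$ with $H(y_0)\simeq E(x_0)$, there is a holomorphic map $f$ from a neighbourhood of $y_0$ to $X$ with $f(y_0)=x_0$ and $f^*\mathbb E\simeq\mathbb H$ near $y_0$, and the germ of $f$ at $y_0$ is unique. A theme of rank $k$ is invariant if it has an $(a,b)$-linear endomorphism of rank $k-1$. Let $\lambda_1>3$ be rational, $p_1=3$, $p_2=p_3=2$. For $\sigma=(\alpha,\beta,\gamma,\delta,\varepsilon,\theta)\in\mathbb C^6$ with $\alpha\gamma\theta\ne0$ let $E(\sigma)$ be the (a,b)-module with $\mathbb C[[b]]$-basis $e_1,\dots,e_4$ and $$(a-(\lambda_1+4)b)e_4=(1+\alpha b^2)e_3,\qquad (a-(\lambda_1+3)b)e_3=(1+\beta b+\gamma b^2)e_2,$$ $$(a-(\lambda_1+2)b)e_2=(1+\delta b+\varepsilon b^2+\theta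 b^3)e_1,\qquad (a-\lambda_1 b)e_1=0.$$ These form a holomorphic family (the canonical family) of rank 4 $[\lambda_1]$-primitive themes with fundamental invariants $\lambda_1,3,2,2$, and: 1. If $3\alpha\ne5\gamma$, then $E(\sigma)$ is not invariant, and its canonical form is not unique: up to isomorphism $E(\sigma)$ does not depend on $\varepsilon$. 2. If $3\alpha=5\gamma$, then $E(\sigma)$ is invariant, but there is no holomorphic family $\mathbb E$ of themes with these invariants over a reduced complex space $X$, and no $x_0\in X$ with $E(x_0)\simeq E(\sigma)$, such that $\mathbb E$ is universal near $x_0$. 3. If $\sigma_0=(\alpha_0,\beta_0,\gamma_0,\delta_0,\varepsilon_0,\theta_0)$ satisfies $3\alpha_0\ne5\gamma_0$, then $\sigma_0$ has an open neighbourhood in the hyperplane $\{\varepsilon=\varepsilon_0\}$ such that the restriction of the canonical family to it is universal near each of its points, and such that distinct points of it give non-isomorphic themes. -/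

import Mathlib

open scoped PowerSeries Topology

noncomputable section

namespace Themes

/-! ### Reduced complex spaces -/

/-- `A ⊆ ℂⁿ` is locally analytic: near each of its points it is the common zero set of finitely
many holomorphic functions. -/
def IsLocallyAnalytic {n : ℕ} (A : Set (Fin n → ℂ)) : Prop :=
  ∀ z ∈ A, ∃ W : Set (Fin n → ℂ), IsOpen W ∧ z ∈ W ∧
    ∃ (r : ℕ) (g : Fin r → (Fin n → ℂ) → ℂ), (∀ i, DifferentiableOn ℂ (g i) W) ∧
      A ∩ W = {w | w ∈ W ∧ ∀ i, g i w = 0}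

/-- A local chart of a reduced complex space: an open set together with a homeomorphism onto a
locally analytic subset of some `ℂⁿ` (`toFun` is irrelevant outside `dom`). -/
structure LocalModel (X : Type) [TopologicalSpace X] where
  dom : Set X
  isOpen_dom : IsOpen dom
  dim : ℕ
  toFun : X → (Fin dim → ℂ)
  isEmbedding : Topology.IsEmbedding (dom.domRestrict toFun)
  analytic : IsLocallyAnalytic (toFun '' dom)

/-- A reduced complex space. Since the space is reduced, the structure sheaf is a sheaf of
functions: it is given by an atlas of local models whose changes of charts are locally induced by
holomorphic maps of the ambient affine spaces. -/
structure ReducedComplexSpace where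
  carrier : Type
  [top : TopologicalSpace carrier]
  [t2 : T2Space carrier]
  atlas : Set (LocalModel carrier)
  cover : ∀ x : carrier, ∃ c ∈ atlas, x ∈ c.dom
  compat : ∀ c ∈ atlas, ∀ c' ∈ atlas, ∀ x ∈ c.dom ∩ c'.dom,
    ∃ F : (Fin c.dim → ℂ) → (Fin c'.dim → ℂ),
      AnalyticAt ℂ F (c.toFun x) ∧ ∀ᶠ y in 𝓝 x, c'.toFun y = F (c.toFun y)

instance : CoeSort ReducedComplexSpace Type := ⟨ReducedComplexSpace.carrier⟩

instance (X : ReducedComplexSpace) : TopologicalSpace X := X.top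

instance (X : ReducedComplexSpace) : T2Space X := X.t2

/-- `f` is holomorphic near `x`: in a chart it is locally the restriction of a holomorphic
function of the ambient affine space. -/
def HolAt {X : ReducedComplexSpace} (f : X → ℂ) (x : X) : Prop :=
  ∃ c ∈ X.atlas, x ∈ c.dom ∧ ∃ F : (Fin c.dim → ℂ) → ℂ,
    AnalyticAt ℂ F (c.toFun x) ∧ ∀ᶠ y in 𝓝 x, f y = F (c.toFun y)

/-- `f` is a holomorphic function on the open set `U`. -/
def HolOn {X : ReducedComplexSpace} (f : X → ℂ) (U : Set X) : Prop :=
  ∀ x ∈ U, HolAt f x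

/-- `S` is a section of `𝒪_X[[b]]` on the open set `U`: all its coefficients are holomorphic
on `U`. The variable of the power series is `b`. -/
def SeriesHolOn {X : ReducedComplexSpace} (S : X → ℂ⟦X⟧) (U : Set X) : Prop :=
  ∀ n : ℕ, HolOn (fun x => PowerSeries.coeff n (S x)) U

/-- `f` is a holomorphic map on the open set `U` of `Y`, with values in `X`. -/
def HolMapOn {Y X : ReducedComplexSpace} (f : Y → X) (U : Set Y) : Prop :=
  ∀ y ∈ U, ContinuousAt f y ∧
    ∀ c ∈ X.atlas, f y ∈ c.dom → ∀ i, HolAt (fun y' => c.toFun (f y') i) y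

/-- The inclusion in `ℂⁿ` of a locally analytic subset, as a chart. -/
def LocalModel.inclusion {n : ℕ} (A : Set (Fin n → ℂ)) (hA : IsLocallyAnalytic A) :
    LocalModel A where
  dom := Set.univ
  isOpen_dom := isOpen_univ
  dim := n
  toFun := Subtype.val
  isEmbedding := Topology.IsEmbedding.subtypeVal.comp Topology.IsEmbedding.subtypeVal
  analytic := by simpa using hA

/-- A locally analytic subset of `ℂⁿ` with its reduced complex structure. -/
def ReducedComplexSpace.ofSet {n : ℕ} (A : Set (Fin n → ℂ)) (hA : IsLocallyAnalytic A) :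
    ReducedComplexSpace where
  carrier := A
  atlas := {LocalModel.inclusion A hA}
  cover := fun x => ⟨LocalModel.inclusion A hA, rfl, Set.mem_univ x⟩
  compat := by
    rintro c rfl c' rfl x -
    exact ⟨id, analyticAt_id, Filter.Eventually.of_forall fun _ => rfl⟩

theorem holAt_ofSet {n : ℕ} {A : Set (Fin n → ℂ)} (hA : IsLocallyAnalytic A)
    {F : (Fin n → ℂ) → ℂ} (hF : ∀ z, AnalyticAt ℂ F z) (x : ReducedComplexSpace.ofSet A hA) :
    HolAt (X := ReducedComplexSpace.ofSet A hA) (fun y : A => F y.1) x :=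
  ⟨LocalModel.inclusion A hA, rfl, Set.mem_univ _, F, hF _,
    Filter.Eventually.of_forall fun _ => rfl⟩

theorem holAt_const {X : ReducedComplexSpace} (z : ℂ) (x : X) : HolAt (fun _ : X => z) x := by
  obtain ⟨c, hc, hx⟩ := X.cover x
  exact ⟨c, hc, hx, fun _ => z, analyticAt_const, Filter.Eventually.of_forall fun _ => rfl⟩

/-! ### (a,b)-modules -/

/-- An (a,b)-module: a free `ℂ[[b]]`-module of finite rank with an additive map `a` such that
`a S = S a + b² S'` for `S ∈ ℂ[[b]]`. For constant `S` this is the `ℂ`-linearity of `a`, for `S = b`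
it is `a b - b a = b²`; for a `ℂ`-linear `a`, the latter implies the general
case, by `b`-adic continuity. -/
structure ABModule where
  carrier : Type
  [grp : AddCommGroup carrier]
  [mod : Module ℂ⟦X⟧ carrier]
  [free : Module.Free ℂ⟦X⟧ carrier]
  [fin : Module.Finite ℂ⟦X⟧ carrier]
  a : carrier →+ carrier
  a_smul : ∀ (S : ℂ⟦X⟧) (v : carrier),
    a (S • v) = S • a v + (PowerSeries.X ^ 2 * PowerSeries.derivative ℂ S) • v

instance : CoeSort ABModule Type := ⟨ABModule.carrier⟩

instance (E : ABModule) : AddCommGroup E := E.grp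

instance (E : ABModule) : Module ℂ⟦X⟧ E := E.mod

instance (E : ABModule) : Module.Free ℂ⟦X⟧ E := E.free

instance (E : ABModule) : Module.Finite ℂ⟦X⟧ E := E.fin

/-- Isomorphism of (a,b)-modules. -/
def Isomorphic (E F : ABModule) : Prop :=
  ∃ u : E ≃ₗ[ℂ⟦X⟧] F, ∀ v, u (E.a v) = F.a (u v)

/-- The (a,b)-module `⊕ ℂ[[b]] e_j` with `a e_j = ∑ i, M i j • e_i`. -/
def ABModule.ofMatrix {k : ℕ} (M : Matrix (Fin k) (Fin k) ℂ⟦X⟧) : ABModule where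
  carrier := Fin k → ℂ⟦X⟧
  a :=
    { toFun := fun v => M.mulVec v + fun i => PowerSeries.X ^ 2 * PowerSeries.derivative ℂ (v i)
      map_zero' := by ext1 i; simp
      map_add' := fun v w => by
        ext1 i
        simp only [Matrix.mulVec_add, Pi.add_apply, map_add]
        ring }
  a_smul := fun S v => by
    ext1 i
    simp only [AddMonoidHom.coe_mk, ZeroHom.coe_mk, Matrix.mulVec_smul, Pi.add_apply,
      Pi.smul_apply, smul_eq_mul, Derivation.leibniz]
    ring

/-- `Ξ_μ^{(N)} = ⊕_{j ≤ N} ℂ[[b]] e_{μ,j}`, with `a e_{μ,0} = μ b e_{μ,0}` and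
`a e_{μ,j} = μ b e_{μ,j} + b e_{μ,j-1}`; here `e_{μ,j}` stands for `s^{μ-1} (log s)^j / j!`. -/
def Xi (μ : ℚ) (N : ℕ) : ABModule :=
  ABModule.ofMatrix (k := N + 1) (Matrix.of fun i j =>
    if i = j then (PowerSeries.C (μ : ℂ)) * PowerSeries.X
    else if (i : ℕ) + 1 = j then PowerSeries.X else 0)

/-- The coefficient of `e_{μ,j}` in an element of `Ξ_μ^{(N)}`. -/
def Xi.coord (μ : ℚ) (N : ℕ) (v : Xi μ N) (j : Fin (N + 1)) : ℂ⟦X⟧ :=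
  (show Fin (N + 1) → ℂ⟦X⟧ from v) j

/-- An (a,b)-module (theme) of rank `k` is invariant when it has an endomorphism of rank `k - 1`. -/
def IsInvariant (E : ABModule) : Prop :=
  ∃ u : E →ₗ[ℂ⟦X⟧] E, (∀ v, u (E.a v) = E.a (u v)) ∧
    Module.finrank ℂ⟦X⟧ (LinearMap.range u) + 1 = Module.finrank ℂ⟦X⟧ E

/-! ### Families of (a,b)-modules -/

/-- On the open set `V`, the section `s` of a family of `ℂ[[b]]`-modules is a combination of the
`w i` with coefficients in `𝒪(V)[[b]]`. -/
def HolCombOn {Y : ReducedComplexSpace} {M : Y → Type} [∀ y, AddCommGroup (M y)]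
    [∀ y, Module ℂ⟦X⟧ (M y)] {k : ℕ} (V : Set Y) (w : ∀ y, Fin k → M y) (s : ∀ y, M y) : Prop :=
  ∃ S : Fin k → Y → ℂ⟦X⟧, (∀ i, SeriesHolOn (S i) V) ∧ ∀ y ∈ V, s y = ∑ i, S i y • w y i

/-- A frame, on an open set, of a collection of (a,b)-modules. -/
structure LocalFrame {X : ReducedComplexSpace} (E : X → ABModule) where
  dom : Set X
  isOpen_dom : IsOpen dom
  rank : ℕ
  vec : ∀ x, Fin rank → E x
  linearIndependent : ∀ x ∈ dom, LinearIndependent ℂ⟦X⟧ (vec x)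
  span_eq_top : ∀ x ∈ dom, Submodule.span ℂ⟦X⟧ (Set.range (vec x)) = ⊤

/-- A sheaf of `𝒪_X`-(a,b)-modules: a locally free sheaf of finite type of `𝒪_X[[b]]`-modules
with an action of `a`. As for vector bundles, it is given by its fibres and by an atlas of
local frames with holomorphic changes of frames; the sections are the combinations of
the frames with coefficients in `𝒪_X[[b]]`. -/
structure ABFamily (X : ReducedComplexSpace) where
  fiber : X → ABModule
  atlas : Set (LocalFrame fiber)
  cover : ∀ x, ∃ e ∈ atlas, x ∈ e.dom
  compat : ∀ e ∈ atlas, ∀ e' ∈ atlas, ∀ j,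
    HolCombOn (M := fun x => fiber x) (e.dom ∩ e'.dom) e.vec (fun x => e'.vec x j)
  a_hol : ∀ e ∈ atlas, ∀ j,
    HolCombOn (M := fun x => fiber x) e.dom e.vec (fun x => (fiber x).a (e.vec x j))

/-- `f^* E` and `H` are isomorphic, as sheaves of `𝒪_U`-(a,b)-modules, on the open set `U`. The fibre
of `f^* E` at `y` is `E (f y)` and the frames of `f^* E` are the pull-backs of those of `E`. -/
def PullbackIsoOn {Y X : ReducedComplexSpace} (f : Y → X) (U : Set Y) (E : ABFamily X)
    (H : ABFamily Y) : Prop :=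
  ∃ θ : ∀ y, E.fiber (f y) →ₗ[ℂ⟦X⟧] H.fiber y,
    (∀ y ∈ U, Function.Bijective (θ y) ∧
      ∀ v, θ y ((E.fiber (f y)).a v) = (H.fiber y).a (θ y v)) ∧
    ∀ e ∈ E.atlas, ∀ h ∈ H.atlas, ∀ j,
      HolCombOn (M := fun y => H.fiber y) (U ∩ f ⁻¹' e.dom ∩ h.dom) h.vec
        (fun y => θ y (e.vec (f y) j))

/-! ### Holomorphic families of primitive themes -/

/-- The sections `φ, a φ, …, a^{k-1} φ`. -/
def iterates {Y : ReducedComplexSpace} {μ : ℚ} {N : ℕ} (k : ℕ) (φ : Y → Xi μ N) (y : Y)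
    (i : Fin k) : Xi μ N :=
  (Xi μ N).a^[i] (φ y)

/-- `φ : U → Ξ_μ^{(N)}` is a `k`-thematic holomorphic map: `𝔼_φ`, generated by the `a^ν φ`, is free
with basis `φ, a φ, …, a^{k-1} φ`, and its fibre at `y` is the submodule of rank `k` of
`Ξ_μ^{(N)}` generated by the `a^ν φ(y)`. -/
def IsThematicOn {Y : ReducedComplexSpace} {μ : ℚ} {N : ℕ} (k : ℕ) (U : Set Y)
    (φ : Y → Xi μ N) : Prop :=
  (∀ j, SeriesHolOn (fun y => Xi.coord μ N (φ y) j) U) ∧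
  (∀ y ∈ U, LinearIndependent ℂ⟦X⟧ (iterates k φ y)) ∧
  HolCombOn (M := fun _ => Xi μ N) U (iterates k φ) (fun y => (Xi μ N).a^[k] (φ y))

/-- `H` is isomorphic on `U` to the sheaf `𝔼_φ` of a `k`-thematic map `φ`. -/
def IsoThematicOn {Y : ReducedComplexSpace} {μ : ℚ} {N : ℕ} (k : ℕ) (U : Set Y) (H : ABFamily Y)
    (φ : Y → Xi μ N) : Prop :=
  ∃ θ : ∀ y, H.fiber y →ₗ[ℂ⟦X⟧] Xi μ N,
    (∀ y ∈ U, Function.Injective (θ y) ∧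
      (∀ v, θ y ((H.fiber y).a v) = (Xi μ N).a (θ y v)) ∧
      LinearMap.range (θ y) = Submodule.span ℂ⟦X⟧ (Set.range (iterates k φ y))) ∧
    ∀ h ∈ H.atlas, ∀ j,
      HolCombOn (M := fun _ => Xi μ N) (U ∩ h.dom) (iterates k φ) (fun y => θ y (h.vec y j))

/-- `λ_{j+1} = λ_1 + (p_1 - 1) + … + (p_j - 1)`, the index `j` starting at `0`. -/
def exponent {r : ℕ} (lam1 : ℚ) (p : Fin r → ℕ) (j : Fin (r + 1)) : ℚ :=
  lam1 + ∑ i : Fin r, if (i : ℕ) < j then (p i : ℚ) - 1 else 0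

/-- The theme `E` has rank `r + 1` and fundamental invariants `λ_1, p_1, …, p_r`: for some basis
`e_1, …, e_{r+1}` and `F_j` spanned by `e_1, …, e_j`, the `F_j` are stable by `a`, and `F_j / F_{j-1}`
is generated by `e_j` with `a e_j = λ_j b e_j`. -/
def HasInvariants {r : ℕ} (lam1 : ℚ) (p : Fin r → ℕ) (E : ABModule) : Prop :=
  ∃ e : Module.Basis (Fin (r + 1)) ℂ⟦X⟧ E, ∀ j,
    E.a (e j) - (PowerSeries.C (exponent lam1 p j : ℂ) * PowerSeries.X) • e j ∈
      Submodule.span ℂ⟦X⟧ (e '' {i | i < j})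

/-- The representative in `]0, 1]` of a rational number modulo `ℤ`. -/
def residue (q : ℚ) : ℚ := q - ⌈q⌉ + 1

/-- `H` is a holomorphic family of `[λ_1]`-primitive themes of rank `r + 1` with fundamental
invariants `λ_1, p_1, …, p_r`. -/
def IsThemeFamily {r : ℕ} {Y : ReducedComplexSpace} (lam1 : ℚ) (p : Fin r → ℕ) (H : ABFamily Y) :
    Prop :=
  (∀ y, HasInvariants lam1 p (H.fiber y)) ∧
  ∀ y, ∃ U : Set Y, IsOpen U ∧ y ∈ U ∧ ∃ φ : Y → Xi (residue lam1) r,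
    IsThematicOn (r + 1) U φ ∧ IsoThematicOn (r + 1) U H φ

/-- The germ at `y₀` of `f` is a holomorphic map to `(X, x₀)` with `f^* E ≅ H` near `y₀`. -/
def Classifies {X Y : ReducedComplexSpace} (E : ABFamily X) (x₀ : X) (H : ABFamily Y) (y₀ : Y)
    (f : Y → X) : Prop :=
  f y₀ = x₀ ∧ ∃ U : Set Y, IsOpen U ∧ y₀ ∈ U ∧ HolMapOn f U ∧ PullbackIsoOn f U E H

/-- `E` is a holomorphic family of `[λ_1]`-primitive themes with fundamental invariants
`λ_1, p_1, …, p_r` which is universal near `x₀`: every such family `H`, over any reduced complex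
space, with `H(y₀) ≅ E(x₀)`, is near `y₀` the pull-back of `E` by a holomorphic map, whose germ
at `y₀` is unique. -/
def IsUniversalNear {r : ℕ} {X : ReducedComplexSpace} (lam1 : ℚ) (p : Fin r → ℕ) (E : ABFamily X)
    (x₀ : X) : Prop :=
  IsThemeFamily lam1 p E ∧
  ∀ (Y : ReducedComplexSpace) (H : ABFamily Y) (y₀ : Y), IsThemeFamily lam1 p H →
    Isomorphic (H.fiber y₀) (E.fiber x₀) →
      (∃ f : Y → X, Classifies E x₀ H y₀ f) ∧
      ∀ f f' : Y → X, Classifies E x₀ H y₀ f → Classifies E x₀ H y₀ f' → f =ᶠ[𝓝 y₀] f'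

/-! ### The canonical family with `p_1 = 3`, `p_2 = p_3 = 2` -/

theorem ABModule.ofMatrix_a_basisFun {k : ℕ} (M : Matrix (Fin k) (Fin k) ℂ⟦X⟧) (j : Fin k) :
    (ABModule.ofMatrix M).a (Pi.basisFun ℂ⟦X⟧ (Fin k) j) =
      ∑ i, M i j • Pi.basisFun ℂ⟦X⟧ (Fin k) i := by
  change M.mulVec (Pi.basisFun ℂ⟦X⟧ (Fin k) j) +
    (fun i => PowerSeries.X ^ 2 * PowerSeries.derivative ℂ (Pi.basisFun ℂ⟦X⟧ (Fin k) j i)) = _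
  ext1 i
  by_cases h : i = j
  · subst h; simp [Finset.sum_apply, Pi.single_apply]
  · simp [Finset.sum_apply, Pi.single_apply, h]

/-- The standard frame of the family of the `ABModule.ofMatrix (M x)`. -/
def LocalFrame.standard {X : ReducedComplexSpace} {k : ℕ}
    (M : X → Matrix (Fin k) (Fin k) ℂ⟦X⟧) : LocalFrame fun x => ABModule.ofMatrix (M x) where
  dom := Set.univ
  isOpen_dom := isOpen_univ
  rank := k
  vec := fun _ j => Pi.basisFun ℂ⟦X⟧ (Fin k) j
  linearIndependent := fun _ _ => (Pi.basisFun ℂ⟦X⟧ (Fin k)).linearIndependent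
  span_eq_top := fun _ _ => (Pi.basisFun ℂ⟦X⟧ (Fin k)).span_eq

/-- The family of the `ABModule.ofMatrix (M x)`, for `M` holomorphic, with its global frame. -/
def ABFamily.ofMatrix (X : ReducedComplexSpace) {k : ℕ} (M : X → Matrix (Fin k) (Fin k) ℂ⟦X⟧)
    (hM : ∀ i j, SeriesHolOn (fun x => M x i j) Set.univ) : ABFamily X where
  fiber := fun x => ABModule.ofMatrix (M x)
  atlas := {LocalFrame.standard M}
  cover := fun x => ⟨LocalFrame.standard M, rfl, Set.mem_univ x⟩
  compat := by
    rintro e rfl e' rfl (j : Fin k)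
    refine ⟨fun (i : Fin k) _ => if i = j then 1 else 0, fun i n x _ => holAt_const _ x,
      fun x _ => ?_⟩
    change (Pi.basisFun ℂ⟦X⟧ (Fin k) j : Fin k → ℂ⟦X⟧) =
      ∑ i : Fin k, (if i = j then (1 : ℂ⟦X⟧) else 0) • Pi.basisFun ℂ⟦X⟧ (Fin k) i
    simp
  a_hol := by
    rintro e rfl (j : Fin k)
    exact ⟨fun (i : Fin k) x => M x i j, fun i => hM i j,
      fun x _ => ABModule.ofMatrix_a_basisFun (M x) j⟩

/-- The matrix of `a` in the basis `e_1, e_2, e_3, e_4`: with `σ = (α, β, γ, δ, ε, θ)`,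
`a e_1 = λ_1 b e_1`, `(a - (λ_1 + 2) b) e_2 = (1 + δ b + ε b² + θ b³) e_1`,
`(a - (λ_1 + 3) b) e_3 = (1 + β b + γ b²) e_2` and `(a - (λ_1 + 4) b) e_4 = (1 + α b²) e_3`. -/
def canonicalMatrix (lam1 : ℚ) (σ : Fin 6 → ℂ) : Matrix (Fin 4) (Fin 4) ℂ⟦X⟧ :=
  let b : ℂ⟦X⟧ := PowerSeries.X
  let c : ℂ → ℂ⟦X⟧ := fun z => PowerSeries.C z
  !![c lam1 * b, 1 + c (σ 3) * b + c (σ 4) * b ^ 2 + c (σ 5) * b ^ 3, 0, 0;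
     0, c (lam1 + 2) * b, 1 + c (σ 1) * b + c (σ 2) * b ^ 2, 0;
     0, 0, c (lam1 + 3) * b, 1 + c (σ 0) * b ^ 2;
     0, 0, 0, c (lam1 + 4) * b]

/-- The theme `E(σ)`. -/
def canonicalTheme (lam1 : ℚ) (σ : Fin 6 → ℂ) : ABModule :=
  ABModule.ofMatrix (canonicalMatrix lam1 σ)

theorem seriesHolOn_canonicalMatrix (lam1 : ℚ) (A : Set (Fin 6 → ℂ)) (hA : IsLocallyAnalytic A)
    (i j : Fin 4) : SeriesHolOn (X := ReducedComplexSpace.ofSet A hA)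
      (fun σ : A => canonicalMatrix lam1 σ.1 i j) Set.univ := by
  intro n x _
  refine holAt_ofSet hA (F := fun σ => PowerSeries.coeff n (canonicalMatrix lam1 σ i j))
    (fun z => ?_) x
  have key : ∀ (l m : ℕ) (i : Fin 6),
      AnalyticAt ℂ (fun σ : Fin 6 → ℂ => PowerSeries.coeff l
        (PowerSeries.C (σ i) * PowerSeries.X ^ m)) z := fun l m i => by
    simp only [PowerSeries.coeff_C_mul]
    exact (ContinuousLinearMap.proj (R := ℂ) (φ := fun _ : Fin 6 => ℂ) i).analyticAt z
      |>.mul analyticAt_const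
  have key' := fun i => key n 1 i
  simp only [pow_one] at key'
  fin_cases i <;> fin_cases j <;> first
    | exact analyticAt_const
    | exact analyticAt_const.add (key n 2 0)
    | (simp only [canonicalMatrix, map_add]
       exact (analyticAt_const.add (key' 1)).add (key n 2 2))
    | (simp only [canonicalMatrix, map_add]
       exact ((analyticAt_const.add (key' 3)).add (key n 2 4)).add (key n 3 5))

/-- The canonical family, restricted to a locally analytic set `A` of parameters. -/
def canonicalFamily (lam1 : ℚ) (A : Set (Fin 6 → ℂ)) (hA : IsLocallyAnalytic A) :
    ABFamily (ReducedComplexSpace.ofSet A hA) :=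
  ABFamily.ofMatrix _ (fun σ : A => canonicalMatrix lam1 σ.1)
    (seriesHolOn_canonicalMatrix lam1 A hA)

/-- The parameter space of the canonical family: `α γ θ ≠ 0`. -/
def paramSpace : Set (Fin 6 → ℂ) := {σ | σ 0 * σ 2 * σ 5 ≠ 0}

theorem isLocallyAnalytic_of_isOpen {n : ℕ} {W : Set (Fin n → ℂ)} (hW : IsOpen W) :
    IsLocallyAnalytic W :=
  fun _ hz => ⟨W, hW, hz, 0, fun i => i.elim0, fun i => i.elim0, by ext w; simp⟩

theorem isOpen_paramSpace : IsOpen paramSpace :=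
  isOpen_ne_fun (by fun_prop) continuous_const

/-- The part of the hyperplane `ε = ε₀` which lies in `W`. -/
def slice (W : Set (Fin 6 → ℂ)) (ε₀ : ℂ) : Set (Fin 6 → ℂ) := {σ | σ ∈ W ∧ σ 4 = ε₀}

theorem isLocallyAnalytic_slice {W : Set (Fin 6 → ℂ)} (hW : IsOpen W) (ε₀ : ℂ) :
    IsLocallyAnalytic (slice W ε₀) :=
  fun z hz => ⟨W, hW, hz.1, 1, fun _ σ => σ 4 - ε₀, fun _ => by fun_prop, by
    ext w
    simp only [slice, Set.mem_inter_iff, Set.mem_ofPred_eq, sub_eq_zero, forall_const]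
    tauto⟩

end Themes

end

/-! A change of basis between two themes in triangular form is a matrix `G`. Comparing exponents
forces `G` to be upper triangular with a single constant `g` on the diagonal, and its six other
entries satisfy equations `T + eulerOp d k = 0`, where `d` is a difference of exponents. The
operator `eulerOp d` sends `b^n` to `(n - d) b^(n+1)`: its kernel is spanned by `b^d`, and its image
consists of the series without coefficients in degrees `0` and `d + 1`. Each equation thus costs two
scalar conditions and leaves one free constant, and the whole classification becomes linear algebra
on finitely many coefficients.

For canonical forms all parameters except `ε` are invariants. If `x`, `y` are the coefficients of
`b` in the entries `g₃₄`, `g₂₃`, what remains is `γ x = α y` together with `2 g (ε' - ε) = 3 x - 5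
y`. Since `(x, y)` is proportional to `(α, γ)`, the parameter `ε` can be moved at will when `3α ≠
5γ` and is an invariant when `3α = 5γ`. For endomorphisms with `g = 0` the same relations force `x =
y = 0` off the hyperplane, so that the rank is at most 2, while on the hyperplane they leave a
nilpotent endomorphism of rank 3. The carriers are `exists_intertwiner`, `Intertwines.invariants`
and `Intertwines.canonical_relations`.

Universality: the equations are solved over any `ℂ`-algebra, in particular over the algebra
`holRing` of holomorphic functions on an open set. `IsThemeFamily.exists_normal_form` gives a local
triangular basis of a family inside `Ξ`, and `exists_intertwiner_canonical` brings it to canonical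
form with a prescribed `ε`; this yields the classifying map. It is unique because the parameters of
a slice are invariants of the fibre.

No universal family on the hyperplane (`not_isUniversalNear`): a classifying map `f` of the
canonical family would, by uniqueness, be unchanged under `ε ↦ ε + s (3α - 5γ)`. Hence `f` is
locally constant in `ε` off the hyperplane, and by the identity theorem and continuity also constant
in `ε` through the given point of the hyperplane. But there distinct values of `ε` give
non-isomorphic themes. -/

noncomputable section

namespace Themes

/-! ### Intertwining matrices and the equations on their entries. -/

section Gauge

variable {R : Type*} [CommRing R]

/-- The action `v ↦ M v + b² v'` of `a` on column vectors. -/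
def abAct {k : ℕ} (M : Matrix (Fin k) (Fin k) R⟦X⟧) (v : Fin k → R⟦X⟧) : Fin k → R⟦X⟧ :=
  M.mulVec v + fun i => PowerSeries.X ^ 2 * PowerSeries.derivative R (v i)

theorem abAct_add {k : ℕ} (M : Matrix (Fin k) (Fin k) R⟦X⟧) (v w : Fin k → R⟦X⟧) :
    abAct M (v + w) = abAct M v + abAct M w := by
  ext1 i
  simp only [abAct, Matrix.mulVec_add, Pi.add_apply, map_add]
  ring

theorem abAct_smul {k : ℕ} (M : Matrix (Fin k) (Fin k) R⟦X⟧) (S : R⟦X⟧) (v : Fin k → R⟦X⟧) :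
    abAct M (S • v) = S • abAct M v + (PowerSeries.X ^ 2 * PowerSeries.derivative R S) • v := by
  ext1 i
  simp only [abAct, Matrix.mulVec_smul, Pi.add_apply, Pi.smul_apply, smul_eq_mul,
    Derivation.leibniz]
  ring

/-- `G` intertwines the action of `a` with matrix `N` and the one with matrix `M`. -/
def Intertwines {k : ℕ} (M N G : Matrix (Fin k) (Fin k) R⟦X⟧) : Prop :=
  M * G + G.map (fun S => PowerSeries.X ^ 2 * PowerSeries.derivative R S) = G * N

theorem Intertwines.abAct_mulVec {k : ℕ} {M N G : Matrix (Fin k) (Fin k) R⟦X⟧}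
    (h : Intertwines M N G) (v : Fin k → R⟦X⟧) :
    abAct M (G.mulVec v) = G.mulVec (abAct N v) := by
  unfold abAct
  rw [Matrix.mulVec_add, Matrix.mulVec_mulVec, Matrix.mulVec_mulVec, ← h, Matrix.add_mulVec,
    add_assoc]
  congr 1
  ext1 i
  simp only [Matrix.mulVec, dotProduct, Pi.add_apply, Matrix.map_apply, map_sum,
    Derivation.leibniz, Finset.mul_sum, ← Finset.sum_add_distrib, smul_eq_mul]
  exact Finset.sum_congr rfl fun j _ => by ring

/-- On basis vectors the derivative term vanishes, so testing there gives back the matrix identity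
column by column. -/
theorem intertwines_iff {k : ℕ} {M N G : Matrix (Fin k) (Fin k) R⟦X⟧} :
    Intertwines M N G ↔ ∀ v, abAct M (G.mulVec v) = G.mulVec (abAct N v) := by
  refine ⟨fun h => h.abAct_mulVec, fun h => ?_⟩
  ext1 i j
  have := congrFun (h (Pi.single j 1)) i
  have hd : (fun i => PowerSeries.X ^ 2 *
      PowerSeries.derivative R ((Pi.single j 1 : Fin k → R⟦X⟧) i)) = 0 := by
    ext1 i
    by_cases h : i = j
    · subst h; simp
    · simp [h]
  simp only [abAct, hd, Matrix.mulVec_single_one, add_zero] at this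
  exact this

/-- The matrix of `a` in a basis with `a e₁ = l b e₁`, `(a - (l + 2) b) e₂ = S₁ e₁`,
`(a - (l + 3) b) e₃ = S₂ e₂`, `(a - (l + 4) b) e₄ = S₃ e₃`. -/
def themeMatrix (l : R) (S₁ S₂ S₃ : R⟦X⟧) : Matrix (Fin 4) (Fin 4) R⟦X⟧ :=
  let b : R⟦X⟧ := PowerSeries.X
  !![PowerSeries.C l * b, S₁, 0, 0;
     0, PowerSeries.C (l + 2) * b, S₂, 0;
     0, 0, PowerSeries.C (l + 3) * b, S₃;
     0, 0, 0, PowerSeries.C (l + 4) * b]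

/-- The operator `b (b d/db - d)`. -/
def eulerOp (d : ℕ) (g : R⟦X⟧) : R⟦X⟧ :=
  PowerSeries.X ^ 2 * PowerSeries.derivative R g - (d : R⟦X⟧) * PowerSeries.X * g

theorem coeff_zero_eulerOp (d : ℕ) (g : R⟦X⟧) : PowerSeries.coeff 0 (eulerOp d g) = 0 := by
  simp [eulerOp]

/-- The source of all the resonances: the factor `n - d` vanishes exactly at `n = d`. -/
theorem coeff_succ_eulerOp (d n : ℕ) (g : R⟦X⟧) :
    PowerSeries.coeff (n + 1) (eulerOp d g) = ((n : R) - d) * PowerSeries.coeff n g := by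
  have h : (d : R⟦X⟧) * PowerSeries.X * g = PowerSeries.C (d : R) * (PowerSeries.X * g) := by
    simp [mul_assoc]
  rw [eulerOp, h, map_sub, PowerSeries.coeff_C_mul, PowerSeries.coeff_succ_X_mul, pow_two,
    mul_assoc, PowerSeries.coeff_succ_X_mul]
  cases n with
  | zero => simp
  | succ n =>
    rw [PowerSeries.coeff_succ_X_mul, PowerSeries.coeff_derivative]
    push_cast
    ring

/-- Degrees `0` and `d + 1` are the only obstructions, and the coefficient of `b^d` in the solution
stays free. Later equations are made solvable by a good choice of this constant. -/
theorem exists_eulerOp_eq [Algebra ℂ R] (d : ℕ) (T : R⟦X⟧) (c : R)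
    (h0 : PowerSeries.coeff 0 T = 0) (hd : PowerSeries.coeff (d + 1) T = 0) :
    ∃ g, T + eulerOp d g = 0 ∧ PowerSeries.coeff d g = c := by
  refine ⟨PowerSeries.mk fun n => if n = d then c else
    algebraMap ℂ R (1 / ((d : ℂ) - n)) * PowerSeries.coeff (n + 1) T, ?_, by simp⟩
  ext n
  cases n with
  | zero => simp [h0, coeff_zero_eulerOp, -PowerSeries.coeff_zero_eq_constantCoeff]
  | succ n =>
    rw [map_add, coeff_succ_eulerOp, PowerSeries.coeff_mk]
    split_ifs with h
    · subst h; simp [hd]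
    · have h' : (d : ℂ) - n ≠ 0 := sub_ne_zero.2 (by exact_mod_cast Ne.symm h)
      have h2 : ((n : R) - d) * algebraMap ℂ R (1 / ((d : ℂ) - n)) = -1 := by
        have : (n : R) - d = algebraMap ℂ R ((n : ℂ) - d) := by simp
        rw [this, ← map_mul]
        have : ((n : ℂ) - d) * (1 / ((d : ℂ) - n)) = -1 := by field_simp; ring
        rw [this]; simp
      rw [← mul_assoc, h2]; simp

/-- The general upper triangular matrix with constant diagonal. -/
def upperMatrix (g : R) (g₁₂ g₁₃ g₁₄ g₂₃ g₂₄ g₃₄ : R⟦X⟧) : Matrix (Fin 4) (Fin 4) R⟦X⟧ :=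
  !![PowerSeries.C g, g₁₂, g₁₃, g₁₄;
     0, PowerSeries.C g, g₂₃, g₂₄;
     0, 0, PowerSeries.C g, g₃₄;
     0, 0, 0, PowerSeries.C g]

/-- The diagonal and lower entries of the identity hold automatically. The index of `eulerOp` in
each equation is the difference of the exponents `l, l + 2, l + 3, l + 4` of the two basis vectors
concerned. -/
theorem intertwines_upperMatrix_iff {l g : R} {S₁ S₂ S₃ T₁ T₂ T₃ : R⟦X⟧}
    {g₁₂ g₁₃ g₁₄ g₂₃ g₂₄ g₃₄ : R⟦X⟧} :
    Intertwines (themeMatrix l S₁ S₂ S₃) (themeMatrix l T₁ T₂ T₃)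
      (upperMatrix g g₁₂ g₁₃ g₁₄ g₂₃ g₂₄ g₃₄) ↔
    (PowerSeries.C g * (S₁ - T₁) + eulerOp 2 g₁₂ = 0 ∧
      PowerSeries.C g * (S₂ - T₂) + eulerOp 1 g₂₃ = 0 ∧
      PowerSeries.C g * (S₃ - T₃) + eulerOp 1 g₃₄ = 0 ∧
      S₁ * g₂₃ - g₁₂ * T₂ + eulerOp 3 g₁₃ = 0 ∧
      S₂ * g₃₄ - g₂₃ * T₃ + eulerOp 2 g₂₄ = 0 ∧
      S₁ * g₂₄ - g₁₃ * T₃ + eulerOp 4 g₁₄ = 0) := by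
  constructor
  · intro h
    have e := fun i j => congrFun (congrFun h i) j
    have e12 := e 0 1
    have e23 := e 1 2
    have e34 := e 2 3
    have e13 := e 0 2
    have e24 := e 1 3
    have e14 := e 0 3
    simp [themeMatrix, upperMatrix, Matrix.mul_apply, Fin.sum_univ_four] at e12 e23 e34 e13 e24 e14
    simp only [eulerOp]
    push_cast
    have h2 : (PowerSeries.C (2 : R)) = 2 := map_ofNat _ 2
    have h3 : (PowerSeries.C (3 : R)) = 3 := map_ofNat _ 3
    have h4 : (PowerSeries.C (4 : R)) = 4 := map_ofNat _ 4
    rw [h2] at e12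
    rw [h2, h3] at e23
    rw [h3, h4] at e34
    rw [h3] at e13
    rw [h2, h4] at e24
    rw [h4] at e14
    refine ⟨?_, ?_, ?_, ?_, ?_, ?_⟩
    · linear_combination e12
    · linear_combination e23
    · linear_combination e34
    · linear_combination e13
    · linear_combination e24
    · linear_combination e14
  · rintro ⟨e12, e23, e34, e13, e24, e14⟩
    simp only [eulerOp] at e12 e23 e34 e13 e24 e14
    push_cast at e12 e23 e34 e13 e24 e14
    have h2 : (PowerSeries.C (2 : R)) = 2 := map_ofNat _ 2
    have h3 : (PowerSeries.C (3 : R)) = 3 := map_ofNat _ 3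
    have h4 : (PowerSeries.C (4 : R)) = 4 := map_ofNat _ 4
    ext1 i j
    fin_cases i <;> fin_cases j <;>
      simp [themeMatrix, upperMatrix, Matrix.mul_apply, Fin.sum_univ_four, h2, h3, h4] <;>
      first
      | ring1
      | linear_combination e12
      | linear_combination e23
      | linear_combination e34
      | linear_combination e13
      | linear_combination e24
      | linear_combination e14

end Gauge

/-! ### Solving the equations over a `ℂ`-algebra. -/

section Gauge

variable {R : Type*} [CommRing R]

theorem eulerOp_add (d : ℕ) (g g' : R⟦X⟧) : eulerOp d (g + g') = eulerOp d g + eulerOp d g' := by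
  simp only [eulerOp, map_add]; ring

theorem eulerOp_monomial (d : ℕ) (c : R) :
    eulerOp d (PowerSeries.C c * PowerSeries.X ^ d) = 0 := by
  ext n
  cases n with
  | zero => simpa using coeff_zero_eulerOp d _
  | succ n =>
    rw [coeff_succ_eulerOp, PowerSeries.coeff_C_mul, PowerSeries.coeff_X_pow]
    split_ifs with h
    · simp [h]
    · simp

theorem natCast_mul_cancel [Algebra ℂ R] {n : ℕ} (hn : n ≠ 0) {x y : R}
    (h : (n : R) * x = n * y) : x = y := by
  have hu : IsUnit (n : R) := by
    have : (n : R) = algebraMap ℂ R n := by simp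
    rw [this]
    exact (IsUnit.mk0 (n : ℂ) (by exact_mod_cast hn)).map _
  exact hu.mul_left_cancel h

theorem coeff_zero_mul_ps (S T : R⟦X⟧) : PowerSeries.coeff 0 (S * T) =
    PowerSeries.coeff 0 S * PowerSeries.coeff 0 T := by
  simp

theorem coeff_one_mul_ps (S T : R⟦X⟧) : PowerSeries.coeff 1 (S * T) =
    PowerSeries.coeff 0 S * PowerSeries.coeff 1 T +
    PowerSeries.coeff 1 S * PowerSeries.coeff 0 T := by
  rw [PowerSeries.coeff_mul]
  simp [Finset.Nat.antidiagonal_succ]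

/-- An intertwiner exists as soon as the low order compatibility conditions are satisfied. -/
theorem exists_intertwiner [Algebra ℂ R] {l g h : R} {S₁ S₂ S₃ T₁ T₂ T₃ g₂₃ g₃₄ : R⟦X⟧}
    (hS₁ : PowerSeries.coeff 0 S₁ = 1) (hS₂ : PowerSeries.coeff 0 S₂ = 1)
    (hT₁ : PowerSeries.coeff 0 T₁ = 1) (hT₂ : PowerSeries.coeff 0 T₂ = 1)
    (hT₃ : PowerSeries.coeff 0 T₃ = 1)
    (u₂ : IsUnit (PowerSeries.coeff 2 T₂)) (u₃ : IsUnit (PowerSeries.coeff 2 T₃))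
    (e₂₃ : PowerSeries.C g * (S₂ - T₂) + eulerOp 1 g₂₃ = 0)
    (e₃₄ : PowerSeries.C g * (S₃ - T₃) + eulerOp 1 g₃₄ = 0)
    (hθ : g * (PowerSeries.coeff 3 S₁ - PowerSeries.coeff 3 T₁) = 0)
    (h₀ : PowerSeries.coeff 0 g₃₄ = PowerSeries.coeff 0 g₂₃)
    (h₁ : g * (PowerSeries.coeff 1 S₁ - PowerSeries.coeff 1 T₁) = 2 * PowerSeries.coeff 0 g₂₃)
    (h₂ : PowerSeries.coeff 3 (S₂ * g₃₄ - g₂₃ * T₃) = 0)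
    (h₃ : PowerSeries.coeff 1 (S₂ * g₃₄ - g₂₃ * T₃) = 2 * h)
    (h₄ : (PowerSeries.coeff 1 S₁ - PowerSeries.coeff 1 T₂) * PowerSeries.coeff 0 g₂₃ +
      PowerSeries.coeff 1 g₂₃ - g * (PowerSeries.coeff 2 S₁ - PowerSeries.coeff 2 T₁) = 3 * h) :
    ∃ g₁₂ g₁₃ g₁₄ g₂₄, Intertwines (themeMatrix l S₁ S₂ S₃) (themeMatrix l T₁ T₂ T₃)
      (upperMatrix g g₁₂ g₁₃ g₁₄ g₂₃ g₂₄ g₃₄) := by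
  obtain ⟨v₂, hv₂⟩ := u₂
  obtain ⟨v₃, hv₃⟩ := u₃
  obtain ⟨f, hf, -⟩ := exists_eulerOp_eq 2 (PowerSeries.C g * (S₁ - T₁)) 0
    (by rw [PowerSeries.coeff_C_mul, map_sub, hS₁, hT₁]; simp)
    (by rw [PowerSeries.coeff_C_mul, map_sub]; exact hθ)
  -- The free multiple of `b²` in `g₁₂` is spent on the obstruction of the (1,3) equation in degree
  -- 4, where it enters with the invertible factor `coeff 2 T₂`.
  set w : R := ↑v₂⁻¹ * PowerSeries.coeff 4 (S₁ * g₂₃ - f * T₂) with hw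
  set g₁₂ : R⟦X⟧ := f + PowerSeries.C w * PowerSeries.X ^ 2 with hg₁₂
  have e₁₂ : PowerSeries.C g * (S₁ - T₁) + eulerOp 2 g₁₂ = 0 := by
    rw [hg₁₂, eulerOp_add, eulerOp_monomial, add_zero, hf]
  have c₁₂ : ∀ n, g * (PowerSeries.coeff (n + 1) S₁ - PowerSeries.coeff (n + 1) T₁) +
      ((n : R) - (2 : ℕ)) * PowerSeries.coeff n g₁₂ = 0 := fun n => by
    have := congrArg (PowerSeries.coeff (n + 1)) e₁₂
    rwa [map_add, PowerSeries.coeff_C_mul, map_sub, coeff_succ_eulerOp, map_zero] at this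
  -- This makes the constant term of the (1,3) equation vanish.
  have c0 : PowerSeries.coeff 0 g₁₂ = PowerSeries.coeff 0 g₂₃ := by
    refine natCast_mul_cancel (n := 2) two_ne_zero ?_
    have := c₁₂ 0
    push_cast at this ⊢
    linear_combination h₁ - this
  have c1 : PowerSeries.coeff 1 g₁₂ =
      g * (PowerSeries.coeff 2 S₁ - PowerSeries.coeff 2 T₁) := by
    have := c₁₂ 1
    push_cast at this
    linear_combination -this
  obtain ⟨k, hk, -⟩ := exists_eulerOp_eq 3 (S₁ * g₂₃ - g₁₂ * T₂) 0
    (by rw [map_sub, coeff_zero_mul_ps, coeff_zero_mul_ps, hS₁, hT₂, c0]; ring)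
    (by
      have : g₁₂ * T₂ = f * T₂ + PowerSeries.C w * (PowerSeries.X ^ 2 * T₂) := by
        rw [hg₁₂]; ring
      rw [this, ← sub_sub, map_sub, PowerSeries.coeff_C_mul,
        PowerSeries.coeff_X_pow_mul T₂ 2 2, ← hv₂, hw, mul_right_comm, Units.inv_mul,
        one_mul, sub_self])
  obtain ⟨g₂₄, e₂₄, -⟩ := exists_eulerOp_eq 2 (S₂ * g₃₄ - g₂₃ * T₃) 0
    (by rw [map_sub, coeff_zero_mul_ps, coeff_zero_mul_ps, hS₂, hT₃, h₀]; ring) h₂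
  -- Likewise the free multiple of `b³` in `g₁₃` removes the obstruction of the (1,4) equation in
  -- degree 5, with the invertible factor `coeff 2 T₃`.
  set p : R := ↑v₃⁻¹ * PowerSeries.coeff 5 (S₁ * g₂₄ - k * T₃) with hp
  set g₁₃ : R⟦X⟧ := k + PowerSeries.C p * PowerSeries.X ^ 3 with hg₁₃
  have e₁₃ : S₁ * g₂₃ - g₁₂ * T₂ + eulerOp 3 g₁₃ = 0 := by
    rw [hg₁₃, eulerOp_add, eulerOp_monomial, add_zero, hk]
  -- Both `g₁₃` and `g₂₄` start with `h`, which is the condition in degree 0 for the (1,4) equation.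
  have d₁₃ : PowerSeries.coeff 0 g₁₃ = h := by
    refine natCast_mul_cancel (n := 3) three_ne_zero ?_
    have := congrArg (PowerSeries.coeff (0 + 1)) e₁₃
    rw [map_add, map_sub, coeff_succ_eulerOp, map_zero, zero_add, coeff_one_mul_ps,
      coeff_one_mul_ps, hS₁, hT₂, c0, c1] at this
    push_cast at this ⊢
    linear_combination h₄ - this
  have d₂₄ : PowerSeries.coeff 0 g₂₄ = h := by
    refine natCast_mul_cancel (n := 2) two_ne_zero ?_
    have := congrArg (PowerSeries.coeff (0 + 1)) e₂₄
    rw [map_add, coeff_succ_eulerOp, map_zero, zero_add, h₃] at this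
    push_cast at this ⊢
    linear_combination - this
  obtain ⟨g₁₄, e₁₄, -⟩ := exists_eulerOp_eq 4 (S₁ * g₂₄ - g₁₃ * T₃) 0
    (by rw [map_sub, coeff_zero_mul_ps, coeff_zero_mul_ps, hS₁, hT₃, d₁₃, d₂₄]; ring)
    (by
      have : g₁₃ * T₃ = k * T₃ + PowerSeries.C p * (PowerSeries.X ^ 3 * T₃) := by
        rw [hg₁₃]; ring
      rw [this, ← sub_sub, map_sub, PowerSeries.coeff_C_mul,
        PowerSeries.coeff_X_pow_mul T₃ 3 2, ← hv₃, hp, mul_right_comm, Units.inv_mul,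
        one_mul, sub_self])
  exact ⟨g₁₂, g₁₃, g₁₄, g₂₄, intertwines_upperMatrix_iff.2 ⟨e₁₂, e₂₃, e₃₄, e₁₃, e₂₄, e₁₄⟩⟩

theorem isUnit_upperMatrix {g : R} (hg : IsUnit g) (g₁₂ g₁₃ g₁₄ g₂₃ g₂₄ g₃₄ : R⟦X⟧) :
    IsUnit (upperMatrix g g₁₂ g₁₃ g₁₄ g₂₃ g₂₄ g₃₄) := by
  rw [Matrix.isUnit_iff_isUnit_det, Matrix.det_of_isUpperTriangular]
  · refine IsUnit.prod_univ_iff.2 fun i => ?_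
    fin_cases i <;> exact hg.map PowerSeries.C
  · intro i j hij
    fin_cases i <;> fin_cases j <;> first | rfl | (exfalso; revert hij; decide)

/-- Meant for `f` an evaluation at a point: an intertwiner over holomorphic functions specializes to
one in every fibre. -/
theorem Intertwines.map {A : Type*} [CommRing A] (f : R →+* A) {k : ℕ}
    {M N G : Matrix (Fin k) (Fin k) R⟦X⟧} (h : Intertwines M N G) :
    Intertwines (M.map (PowerSeries.map f)) (N.map (PowerSeries.map f))
      (G.map (PowerSeries.map f)) := by
  have key : ∀ S : R⟦X⟧, PowerSeries.map f (PowerSeries.derivative R S) =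
      PowerSeries.derivative A (PowerSeries.map f S) := fun S => by
    ext n; simp [PowerSeries.coeff_derivative]
  have := congrArg (fun M => M.map (PowerSeries.map f)) h
  simp only [Matrix.map_mul, Matrix.map_add (PowerSeries.map f) (map_add _)] at this
  rw [Intertwines, ← this]
  congr 1
  ext1 i j
  simp [Matrix.map_apply, key]

end Gauge

/-! ### The shape of intertwiners over `ℂ`. -/

section Field

/-- Below the diagonal the difference of exponents has the opposite sign, so `b^n` is multiplied by
`n + d`, which is never zero: there is no resonance. -/
theorem eq_zero_of_eulerOp_neg {d : ℕ} (hd : d ≠ 0) {g : ℂ⟦X⟧}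
    (h : PowerSeries.X ^ 2 * PowerSeries.derivative ℂ g + (d : ℂ⟦X⟧) * PowerSeries.X * g = 0) :
    g = 0 := by
  have h' : PowerSeries.X * (PowerSeries.X * PowerSeries.derivative ℂ g +
      PowerSeries.C (d : ℂ) * g) = 0 := by
    simp only [map_natCast]
    linear_combination h
  have h2 := (mul_eq_zero.1 h').resolve_left PowerSeries.X_ne_zero
  ext n
  have := congrArg (PowerSeries.coeff n) h2
  rw [map_add, PowerSeries.coeff_C_mul] at this
  have hn : ((n : ℂ) + d) ≠ 0 := by
    have : n + d ≠ 0 := by omega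
    exact_mod_cast this
  have key : ((n : ℂ) + d) * PowerSeries.coeff n g = 0 := by
    cases n with
    | zero => simpa using this
    | succ n =>
      rw [PowerSeries.coeff_succ_X_mul, PowerSeries.coeff_derivative] at this
      rw [map_zero] at this
      push_cast
      linear_combination this
  simpa [hn] using key

theorem eq_C_of_derivative_eq_zero {g : ℂ⟦X⟧} (h : PowerSeries.derivative ℂ g = 0) :
    g = PowerSeries.C (PowerSeries.coeff 0 g) :=
  PowerSeries.derivative.ext (by simpa using h) (by simp)

/-- An intertwiner between theme matrices over `ℂ` is upper triangular with constant diagonal. -/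
theorem Intertwines.eq_upperMatrix {l : ℂ} {S₁ S₂ S₃ T₁ T₂ T₃ : ℂ⟦X⟧}
    (hS₁ : PowerSeries.coeff 0 S₁ = 1) (hS₂ : PowerSeries.coeff 0 S₂ = 1)
    (hS₃ : PowerSeries.coeff 0 S₃ = 1)
    (hT₁ : PowerSeries.coeff 0 T₁ = 1) (hT₂ : PowerSeries.coeff 0 T₂ = 1)
    (hT₃ : PowerSeries.coeff 0 T₃ = 1) {G : Matrix (Fin 4) (Fin 4) ℂ⟦X⟧}
    (h : Intertwines (themeMatrix l S₁ S₂ S₃) (themeMatrix l T₁ T₂ T₃) G) :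
    ∃ g g₁₂ g₁₃ g₁₄ g₂₃ g₂₄ g₃₄, G = upperMatrix g g₁₂ g₁₃ g₁₄ g₂₃ g₂₄ g₃₄ := by
  have e := fun i j => congrFun (congrFun h i) j
  have h2 : (PowerSeries.C (2 : ℂ)) = 2 := map_ofNat _ 2
  have h3 : (PowerSeries.C (3 : ℂ)) = 3 := map_ofNat _ 3
  have h4 : (PowerSeries.C (4 : ℂ)) = 4 := map_ofNat _ 4
  simp only [themeMatrix, Matrix.add_apply, Matrix.mul_apply, Fin.sum_univ_four,
    Matrix.map_apply, map_add, h2, h3, h4] at e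
  -- The equation of an entry involves only its neighbours below and to the left, so the elimination
  -- starts from the lower left corner.
  have z30 : G 3 0 = 0 := by
    have := e 3 0
    simp at this
    refine eq_zero_of_eulerOp_neg (d := 4) (by norm_num) ?_
    push_cast
    linear_combination this
  have z20 : G 2 0 = 0 := by
    have := e 2 0
    simp [z30] at this
    refine eq_zero_of_eulerOp_neg (d := 3) (by norm_num) ?_
    push_cast
    linear_combination this
  have z31 : G 3 1 = 0 := by
    have := e 3 1
    simp [z30] at this
    refine eq_zero_of_eulerOp_neg (d := 2) (by norm_num) ?_
    push_cast
    linear_combination this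
  have z10 : G 1 0 = 0 := by
    have := e 1 0
    simp [z20] at this
    refine eq_zero_of_eulerOp_neg (d := 2) (by norm_num) ?_
    push_cast
    linear_combination this
  have z21 : G 2 1 = 0 := by
    have := e 2 1
    simp [z20, z31] at this
    refine eq_zero_of_eulerOp_neg (d := 1) (by norm_num) ?_
    push_cast
    linear_combination this
  have z32 : G 3 2 = 0 := by
    have := e 3 2
    simp [z31] at this
    refine eq_zero_of_eulerOp_neg (d := 1) (by norm_num) ?_
    push_cast
    linear_combination this
  have hX : (PowerSeries.X : ℂ⟦X⟧) ^ 2 ≠ 0 := pow_ne_zero _ PowerSeries.X_ne_zero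
  have dg : ∀ i, PowerSeries.derivative ℂ (G i i) = 0 := by
    intro i
    refine (mul_eq_zero.1 ?_).resolve_left hX
    have := e i i
    fin_cases i
    · change PowerSeries.X ^ 2 * PowerSeries.derivative ℂ (G 0 0) = 0
      simp [z10] at this
      linear_combination this
    · change PowerSeries.X ^ 2 * PowerSeries.derivative ℂ (G 1 1) = 0
      simp [z10, z21] at this
      linear_combination this
    · change PowerSeries.X ^ 2 * PowerSeries.derivative ℂ (G 2 2) = 0
      simp [z21, z32] at this
      linear_combination this
    · change PowerSeries.X ^ 2 * PowerSeries.derivative ℂ (G 3 3) = 0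
      simp [z32] at this
      linear_combination this
  -- The superdiagonal series have constant term 1, so the constant term of each superdiagonal
  -- equation identifies two consecutive diagonal constants.
  have c01 : PowerSeries.coeff 0 (G 0 0) = PowerSeries.coeff 0 (G 1 1) := by
    have := congrArg (PowerSeries.coeff 0) (e 0 1)
    simp at this hS₁ hT₁ ⊢
    rw [hS₁, hT₁] at this
    linear_combination -this
  have c12 : PowerSeries.coeff 0 (G 1 1) = PowerSeries.coeff 0 (G 2 2) := by
    have := congrArg (PowerSeries.coeff 0) (e 1 2)
    simp at this hS₂ hT₂ ⊢
    rw [hS₂, hT₂] at this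
    linear_combination -this
  have c23 : PowerSeries.coeff 0 (G 2 2) = PowerSeries.coeff 0 (G 3 3) := by
    have := congrArg (PowerSeries.coeff 0) (e 2 3)
    simp at this hS₃ hT₃ ⊢
    rw [hS₃, hT₃] at this
    linear_combination -this
  refine ⟨PowerSeries.coeff 0 (G 0 0), G 0 1, G 0 2, G 0 3, G 1 2, G 1 3, G 2 3, ?_⟩
  have d0 := eq_C_of_derivative_eq_zero (dg 0)
  have d1 := eq_C_of_derivative_eq_zero (dg 1)
  have d2 := eq_C_of_derivative_eq_zero (dg 2)
  have d3 := eq_C_of_derivative_eq_zero (dg 3)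
  rw [← c01] at d1
  rw [← c12, ← c01] at d2
  rw [← c23, ← c12, ← c01] at d3
  ext1 i j
  fin_cases i <;> fin_cases j <;>
    first
    | rfl
    | exact z10
    | exact z20
    | exact z30
    | exact z21
    | exact z31
    | exact z32
    | exact d0
    | exact d1
    | exact d2
    | exact d3

end Field

/-! ### Reduction to canonical form, and the shift of `ε`. -/

section Canonical

variable {R : Type*} [CommRing R]

/-- `1 + δ b + ε b² + θ b³`. -/
def cubicSeries (δ ε θ : R) : R⟦X⟧ :=
  1 + PowerSeries.C δ * PowerSeries.X + PowerSeries.C ε * PowerSeries.X ^ 2 +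
    PowerSeries.C θ * PowerSeries.X ^ 3

theorem coeff_cubicSeries (δ ε θ : R) : PowerSeries.coeff 0 (cubicSeries δ ε θ) = 1 ∧
    PowerSeries.coeff 1 (cubicSeries δ ε θ) = δ ∧ PowerSeries.coeff 2 (cubicSeries δ ε θ) = ε ∧
    PowerSeries.coeff 3 (cubicSeries δ ε θ) = θ := by
  simp only [cubicSeries, map_add, PowerSeries.coeff_C_mul, PowerSeries.coeff_X_pow,
    PowerSeries.coeff_X, PowerSeries.coeff_one]
  simp

theorem cubicSeries_map {A : Type*} [CommRing A] (f : R →+* A) (δ ε θ : R) :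
    PowerSeries.map f (cubicSeries δ ε θ) = cubicSeries (f δ) (f ε) (f θ) := by
  simp [cubicSeries]

theorem themeMatrix_map {A : Type*} [CommRing A] (f : R →+* A) (l : R) (S₁ S₂ S₃ : R⟦X⟧) :
    (themeMatrix l S₁ S₂ S₃).map (PowerSeries.map f) = themeMatrix (f l) (PowerSeries.map f S₁)
      (PowerSeries.map f S₂) (PowerSeries.map f S₃) := by
  have h2 : f 2 = 2 := map_ofNat f 2
  have h3 : f 3 = 3 := map_ofNat f 3
  have h4 : f 4 = 4 := map_ofNat f 4
  ext1 i j
  fin_cases i <;> fin_cases j <;> simp [themeMatrix, h2, h3, h4]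

theorem canonicalMatrix_eq (lam1 : ℚ) (σ : Fin 6 → ℂ) :
    canonicalMatrix lam1 σ = themeMatrix (lam1 : ℂ) (cubicSeries (σ 3) (σ 4) (σ 5))
      (cubicSeries (σ 1) (σ 2) 0) (cubicSeries 0 (σ 0) 0) := by
  simp [canonicalMatrix, themeMatrix, cubicSeries]

theorem coeff_succ_mul_C_mul_X (S : R⟦X⟧) (x : R) (n : ℕ) :
    PowerSeries.coeff (n + 1) (S * (PowerSeries.C x * PowerSeries.X)) =
      x * PowerSeries.coeff n S := by
  have : S * (PowerSeries.C x * PowerSeries.X) = PowerSeries.C x * (S * PowerSeries.X) := by ring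
  rw [this, PowerSeries.coeff_C_mul, PowerSeries.coeff_succ_mul_X]

theorem eulerOp_one_C_mul_X (x : R) : eulerOp 1 (PowerSeries.C x * PowerSeries.X) = 0 := by
  simpa using eulerOp_monomial 1 x

/-- Off the hyperplane `3α = 5γ`, every theme has a canonical form with a prescribed value
of the parameter `ε`. -/
theorem exists_intertwiner_canonical [Algebra ℂ R] (l e : R) {S₁ S₂ S₃ : R⟦X⟧}
    (hS₁ : PowerSeries.coeff 0 S₁ = 1) (hS₂ : PowerSeries.coeff 0 S₂ = 1)
    (hS₃ : PowerSeries.coeff 0 S₃ = 1)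
    (u₂ : IsUnit (PowerSeries.coeff 2 S₂)) (u₃ : IsUnit (PowerSeries.coeff 2 S₃))
    (u : IsUnit (3 * PowerSeries.coeff 2 S₃ - 5 * PowerSeries.coeff 2 S₂)) :
    ∃ g₁₂ g₁₃ g₁₄ g₂₃ g₂₄ g₃₄, Intertwines (themeMatrix l S₁ S₂ S₃)
      (themeMatrix l
        (cubicSeries (PowerSeries.coeff 1 S₁ - 2 * PowerSeries.coeff 1 S₃) e
          (PowerSeries.coeff 3 S₁))
        (cubicSeries (PowerSeries.coeff 1 S₂ - PowerSeries.coeff 1 S₃) (PowerSeries.coeff 2 S₂) 0)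
        (cubicSeries 0 (PowerSeries.coeff 2 S₃) 0))
      (upperMatrix 1 g₁₂ g₁₃ g₁₄ g₂₃ g₂₄ g₃₄) := by
  obtain ⟨a0, a1, a2, a3⟩ := coeff_cubicSeries
    (PowerSeries.coeff 1 S₁ - 2 * PowerSeries.coeff 1 S₃) e (PowerSeries.coeff 3 S₁)
  obtain ⟨b0, b1, b2, b3⟩ := coeff_cubicSeries
    (PowerSeries.coeff 1 S₂ - PowerSeries.coeff 1 S₃) (PowerSeries.coeff 2 S₂) (0 : R)
  obtain ⟨c0, c1, c2, c3⟩ := coeff_cubicSeries (0 : R) (PowerSeries.coeff 2 S₃) 0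
  set T₁ := cubicSeries (PowerSeries.coeff 1 S₁ - 2 * PowerSeries.coeff 1 S₃) e
    (PowerSeries.coeff 3 S₁)
  set T₂ := cubicSeries (PowerSeries.coeff 1 S₂ - PowerSeries.coeff 1 S₃)
    (PowerSeries.coeff 2 S₂) (0 : R)
  set T₃ := cubicSeries (0 : R) (PowerSeries.coeff 2 S₃) 0
  -- Particular solutions of the (3,4) and (2,3) equations, without term in `b`. The shift by `coeff
  -- 1 S₃` in `T₂` gives them the same constant term, and the shift by `2 * coeff 1 S₃` in `T₁`
  -- passes it on to `g₁₂`.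
  obtain ⟨p, hp, -⟩ := exists_eulerOp_eq 1 (S₃ - T₃) 0
    (by rw [map_sub, hS₃, c0, sub_self]) (by rw [map_sub, c2, sub_self])
  obtain ⟨q, hq, hq1⟩ := exists_eulerOp_eq 1 (S₂ - T₂) 0
    (by rw [map_sub, hS₂, b0, sub_self]) (by rw [map_sub, b2, sub_self])
  have p0 : PowerSeries.coeff 0 p = PowerSeries.coeff 1 S₃ := by
    have := congrArg (PowerSeries.coeff (0 + 1)) hp
    rw [map_add, map_sub, coeff_succ_eulerOp, map_zero, zero_add, c1] at this
    push_cast at this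
    linear_combination -this
  have q0 : PowerSeries.coeff 0 q = PowerSeries.coeff 1 S₃ := by
    have := congrArg (PowerSeries.coeff (0 + 1)) hq
    rw [map_add, map_sub, coeff_succ_eulerOp, map_zero, zero_add, b1] at this
    push_cast at this
    linear_combination -this
  obtain ⟨D, hD⟩ := u
  set k₁ := PowerSeries.coeff 3 (S₂ * p - q * T₃) with hk₁
  set k₂ := PowerSeries.coeff 1 (S₂ * p - q * T₃) with hk₂
  set k₃ := (PowerSeries.coeff 1 S₁ - PowerSeries.coeff 1 T₂) * PowerSeries.coeff 0 q -
    (PowerSeries.coeff 2 S₁ - e) with hk₃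
  -- Adding `x b` and `y b` to the particular solutions leaves two conditions: `γ x - α y = -k₁`
  -- (resonance of the (2,4) equation) and `3 x - 5 y = 2 k₃ - 3 k₂` (equality of the constant terms
  -- of `g₁₃` and `g₂₄`). Cramer's rule gives `x` and `y`, up to sign with determinant `3α - 5γ`.
  set x := ↑D⁻¹ * (PowerSeries.coeff 2 S₃ * (2 * k₃ - 3 * k₂) + 5 * k₁) with hx
  set y := ↑D⁻¹ * (3 * k₁ + PowerSeries.coeff 2 S₂ * (2 * k₃ - 3 * k₂)) with hy
  have hDD : (3 * PowerSeries.coeff 2 S₃ - 5 * PowerSeries.coeff 2 S₂) * (↑D⁻¹ : R) = 1 := by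
    rw [← hD, Units.mul_inv]
  set g₃₄ := p + PowerSeries.C x * PowerSeries.X with hg₃₄
  set g₂₃ := q + PowerSeries.C y * PowerSeries.X with hg₂₃
  have expand : S₂ * g₃₄ - g₂₃ * T₃ = (S₂ * p - q * T₃) +
      (S₂ * (PowerSeries.C x * PowerSeries.X) - T₃ * (PowerSeries.C y * PowerSeries.X)) := by
    rw [hg₃₄, hg₂₃]; ring
  have g₃₄0 : PowerSeries.coeff 0 g₃₄ = PowerSeries.coeff 1 S₃ := by simp [hg₃₄, ← p0]
  have g₂₃0 : PowerSeries.coeff 0 g₂₃ = PowerSeries.coeff 1 S₃ := by simp [hg₂₃, ← q0]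
  have g₂₃1 : PowerSeries.coeff 1 g₂₃ = y := by simp [hg₂₃, hq1]
  have two : (2 : R) * algebraMap ℂ R (1 / 2) = 1 := by
    have : (2 : R) = algebraMap ℂ R 2 := (map_ofNat _ 2).symm
    rw [this, ← map_mul]; simp
  obtain ⟨g₁₂, g₁₃, g₁₄, g₂₄, hG⟩ := exists_intertwiner (l := l) (g := 1)
    (h := algebraMap ℂ R (1 / 2) * (k₂ + x - y)) (g₂₃ := g₂₃) (g₃₄ := g₃₄)
    hS₁ hS₂ a0 b0 c0 (by rwa [b2]) (by rwa [c2])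
    (by rw [hg₂₃, eulerOp_add, eulerOp_one_C_mul_X, map_one, one_mul, add_zero, hq])
    (by rw [hg₃₄, eulerOp_add, eulerOp_one_C_mul_X, map_one, one_mul, add_zero, hp])
    (by rw [a3]; ring)
    (by rw [g₃₄0, g₂₃0])
    (by rw [a1, g₂₃0]; ring)
    (by
      rw [expand, map_add, ← hk₁, map_sub, coeff_succ_mul_C_mul_X S₂ x 2,
        coeff_succ_mul_C_mul_X T₃ y 2, c2, hx, hy]
      linear_combination (-k₁) * hDD)
    (by
      rw [expand, map_add, ← hk₂, map_sub, coeff_succ_mul_C_mul_X S₂ x 0,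
        coeff_succ_mul_C_mul_X T₃ y 0, c0, hS₂]
      linear_combination (-(k₂ + x - y)) * two)
    (by
      rw [g₂₃1, a2]
      refine natCast_mul_cancel (n := 2) two_ne_zero ?_
      have h1 : 3 * x - 5 * y = 2 * k₃ - 3 * k₂ := by
        rw [hx, hy]; linear_combination (2 * k₃ - 3 * k₂) * hDD
      rw [g₂₃0]
      rw [q0] at hk₃
      push_cast
      linear_combination (-3 * (k₂ + x - y)) * two - h1 - 2 * hk₃)
  exact ⟨_, _, _, _, _, _, hG⟩

/-- The canonical forms which only differ by the parameter `ε` are isomorphic if the difference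
of these parameters is a multiple of `3α - 5γ`. -/
theorem exists_intertwiner_canonical_shift [Algebra ℂ R] (l α β γ δ ε θ s : R) (hα : IsUnit α)
    (hγ : IsUnit γ) :
    ∃ g₁₂ g₁₃ g₁₄ g₂₃ g₂₄ g₃₄, Intertwines
      (themeMatrix l (cubicSeries δ ε θ) (cubicSeries β γ 0) (cubicSeries 0 α 0))
      (themeMatrix l (cubicSeries δ (ε + s * (3 * α - 5 * γ)) θ) (cubicSeries β γ 0)
        (cubicSeries 0 α 0))
      (upperMatrix 1 g₁₂ g₁₃ g₁₄ g₂₃ g₂₄ g₃₄) := by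
  obtain ⟨a0, a1, a2, a3⟩ := coeff_cubicSeries δ ε θ
  obtain ⟨d0, d1, d2, d3⟩ := coeff_cubicSeries δ (ε + s * (3 * α - 5 * γ)) θ
  obtain ⟨b0, b1, b2, b3⟩ := coeff_cubicSeries β γ 0
  obtain ⟨c0, c1, c2, c3⟩ := coeff_cubicSeries 0 α 0
  set S₂ := cubicSeries β γ 0
  set S₃ := cubicSeries 0 α 0
  have expand : S₂ * (PowerSeries.C (2 * s * α) * PowerSeries.X) -
      (PowerSeries.C (2 * s * γ) * PowerSeries.X) * S₃ =
      S₂ * (PowerSeries.C (2 * s * α) * PowerSeries.X) -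
      S₃ * (PowerSeries.C (2 * s * γ) * PowerSeries.X) := by ring
  -- The pair `(x, y) = 2 s (α, γ)` satisfies `γ x = α y`. Then `h = (x - y) / 2`, and the shift of
  -- `ε` is `3 h - y = s (3α - 5γ)`.
  obtain ⟨g₁₂, g₁₃, g₁₄, g₂₄, hG⟩ := exists_intertwiner (l := l) (g := 1)
    (h := s * (α - γ)) (g₂₃ := PowerSeries.C (2 * s * γ) * PowerSeries.X)
    (g₃₄ := PowerSeries.C (2 * s * α) * PowerSeries.X)
    a0 b0 d0 b0 c0 (by rwa [b2]) (by rwa [c2])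
    (by rw [eulerOp_one_C_mul_X, sub_self, mul_zero, add_zero])
    (by rw [eulerOp_one_C_mul_X, sub_self, mul_zero, add_zero])
    (by rw [a3, d3]; ring) (by simp) (by rw [a1, d1]; simp)
    (by
      rw [expand, map_sub, coeff_succ_mul_C_mul_X _ _ 2, coeff_succ_mul_C_mul_X _ _ 2, b2,
        c2]
      ring)
    (by
      rw [expand, map_sub, coeff_succ_mul_C_mul_X _ _ 0, coeff_succ_mul_C_mul_X _ _ 0, b0,
        c0]
      ring)
    (by
      rw [a2, d2]
      simp
      ring)
  exact ⟨_, _, _, _, _, _, hG⟩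

end Canonical

/-! ### Invariants of a theme, and relations between canonical forms. -/

section Field

/-- The coefficients of an invertible intertwiner between two theme matrices: invariants. -/
theorem Intertwines.invariants {l g : ℂ} (hg : g ≠ 0) {S₁ S₂ S₃ T₁ T₂ T₃ : ℂ⟦X⟧}
    (hS₁ : PowerSeries.coeff 0 S₁ = 1) (hS₂ : PowerSeries.coeff 0 S₂ = 1)
    (hT₂ : PowerSeries.coeff 0 T₂ = 1) (hT₃ : PowerSeries.coeff 0 T₃ = 1)
    {g₁₂ g₁₃ g₁₄ g₂₃ g₂₄ g₃₄ : ℂ⟦X⟧}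
    (h : Intertwines (themeMatrix l S₁ S₂ S₃) (themeMatrix l T₁ T₂ T₃)
      (upperMatrix g g₁₂ g₁₃ g₁₄ g₂₃ g₂₄ g₃₄)) :
    PowerSeries.coeff 2 S₃ = PowerSeries.coeff 2 T₃ ∧
    PowerSeries.coeff 2 S₂ = PowerSeries.coeff 2 T₂ ∧
    PowerSeries.coeff 3 S₁ = PowerSeries.coeff 3 T₁ ∧
    PowerSeries.coeff 1 S₂ - PowerSeries.coeff 1 S₃ =
      PowerSeries.coeff 1 T₂ - PowerSeries.coeff 1 T₃ ∧
    PowerSeries.coeff 1 S₁ - 2 * PowerSeries.coeff 1 S₃ =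
      PowerSeries.coeff 1 T₁ - 2 * PowerSeries.coeff 1 T₃ := by
  obtain ⟨e₁₂, e₂₃, e₃₄, e₁₃, e₂₄, e₁₄⟩ := intertwines_upperMatrix_iff.1 h
  have c : ∀ {d : ℕ} {S T k : ℂ⟦X⟧}, PowerSeries.C g * (S - T) + eulerOp d k = 0 → ∀ n,
      g * (PowerSeries.coeff (n + 1) S - PowerSeries.coeff (n + 1) T) +
        ((n : ℂ) - d) * PowerSeries.coeff n k = 0 := fun {d S T k} h n => by
    have := congrArg (PowerSeries.coeff (n + 1)) h
    rwa [map_add, PowerSeries.coeff_C_mul, map_sub, coeff_succ_eulerOp, map_zero] at this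
  -- The constant terms of the (1,3) and (2,4) equations say that `g₁₂`, `g₂₃`, `g₃₄` have the same
  -- constant term; it is eliminated between `q₁`, `q₂`, `q₃`.
  have z₁₃ := congrArg (PowerSeries.coeff 0) e₁₃
  have z₂₄ := congrArg (PowerSeries.coeff 0) e₂₄
  rw [map_add, map_sub, coeff_zero_eulerOp, coeff_zero_mul_ps, coeff_zero_mul_ps, map_zero]
    at z₁₃ z₂₄
  rw [hS₁, hT₂] at z₁₃
  rw [hS₂, hT₃] at z₂₄
  -- At the resonant index the unknown drops out, so the corresponding coefficients of the two
  -- themes agree.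
  have r₁ := c e₁₂ 2
  have r₂ := c e₂₃ 1
  have r₃ := c e₃₄ 1
  have q₁ := c e₁₂ 0
  have q₂ := c e₂₃ 0
  have q₃ := c e₃₄ 0
  push_cast at r₁ r₂ r₃ q₁ q₂ q₃
  refine ⟨?_, ?_, ?_, ?_, ?_⟩ <;> apply mul_left_cancel₀ hg
  · linear_combination r₃
  · linear_combination r₂
  · linear_combination r₁
  · linear_combination q₂ - q₃ - z₂₄
  · linear_combination q₁ - 2 * q₃ - 2 * z₂₄ - 2 * z₁₃

theorem coeff_eq_zero_of_eulerOp {d n : ℕ} (hn : n ≠ d) {k : ℂ⟦X⟧} (h : eulerOp d k = 0) :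
    PowerSeries.coeff n k = 0 := by
  have := congrArg (PowerSeries.coeff (n + 1)) h
  rw [coeff_succ_eulerOp, map_zero] at this
  exact (mul_eq_zero.1 this).resolve_left (sub_ne_zero.2 (by exact_mod_cast hn))

theorem eq_monomial_of_eulerOp {d : ℕ} {k : ℂ⟦X⟧} (h : eulerOp d k = 0) :
    k = PowerSeries.C (PowerSeries.coeff d k) * PowerSeries.X ^ d := by
  ext n
  rw [PowerSeries.coeff_C_mul, PowerSeries.coeff_X_pow]
  split_ifs with hn
  · rw [hn, mul_one]
  · rw [mul_zero, coeff_eq_zero_of_eulerOp hn h]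

/-- The relations between the first coefficients of an intertwiner of canonical forms with the same
`α, β, γ, δ, θ`. -/
theorem Intertwines.canonical_relations {l g α β γ δ ε ε' θ : ℂ}
    {g₁₂ g₁₃ g₁₄ g₂₃ g₂₄ g₃₄ : ℂ⟦X⟧}
    (h : Intertwines
      (themeMatrix l (cubicSeries δ ε θ) (cubicSeries β γ 0) (cubicSeries 0 α 0))
      (themeMatrix l (cubicSeries δ ε' θ) (cubicSeries β γ 0) (cubicSeries 0 α 0))
      (upperMatrix g g₁₂ g₁₃ g₁₄ g₂₃ g₂₄ g₃₄)) :
    ∃ x y h w : ℂ, g₃₄ = PowerSeries.C x * PowerSeries.X ∧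
      g₂₃ = PowerSeries.C y * PowerSeries.X ∧ x - y = 2 * h ∧
      y - g * (ε - ε') = 3 * h ∧ γ * x = α * y ∧
      (g = 0 → g₁₂ = PowerSeries.C w * PowerSeries.X ^ 2 ∧ θ * y = γ * w) := by
  obtain ⟨e₁₂, e₂₃, e₃₄, e₁₃, e₂₄, e₁₄⟩ := intertwines_upperMatrix_iff.1 h
  rw [sub_self, mul_zero, zero_add] at e₂₃ e₃₄
  have h₂₃ := eq_monomial_of_eulerOp e₂₃
  have h₃₄ := eq_monomial_of_eulerOp e₃₄
  set y := PowerSeries.coeff 1 g₂₃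
  set x := PowerSeries.coeff 1 g₃₄
  rw [pow_one] at h₂₃ h₃₄
  obtain ⟨a0, a1, a2, a3⟩ := coeff_cubicSeries δ ε θ
  obtain ⟨d0, d1, d2, d3⟩ := coeff_cubicSeries δ ε' θ
  obtain ⟨b0, b1, b2, b3⟩ := coeff_cubicSeries β γ 0
  obtain ⟨c0, c1, c2, c3⟩ := coeff_cubicSeries 0 α 0
  set S₁ := cubicSeries δ ε θ
  set T₁ := cubicSeries δ ε' θ
  set S₂ := cubicSeries β γ 0
  set S₃ := cubicSeries 0 α 0
  have c₁₂ : ∀ n, g * (PowerSeries.coeff (n + 1) S₁ - PowerSeries.coeff (n + 1) T₁) +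
      ((n : ℂ) - (2 : ℕ)) * PowerSeries.coeff n g₁₂ = 0 := fun n => by
    have := congrArg (PowerSeries.coeff (n + 1)) e₁₂
    rwa [map_add, PowerSeries.coeff_C_mul, map_sub, coeff_succ_eulerOp, map_zero] at this
  have p0 := c₁₂ 0
  have p1 := c₁₂ 1
  push_cast at p0 p1
  rw [a1, d1] at p0
  rw [a2, d2] at p1
  have p0' : PowerSeries.coeff 0 g₁₂ = 0 := by linear_combination -1 / 2 * p0
  have e₂₄' : S₂ * (PowerSeries.C x * PowerSeries.X) - S₃ * (PowerSeries.C y * PowerSeries.X) +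
      eulerOp 2 g₂₄ = 0 := by rw [← h₂₃, ← h₃₄, ← e₂₄]; ring
  have e₁₃' : S₁ * (PowerSeries.C y * PowerSeries.X) - g₁₂ * S₂ + eulerOp 3 g₁₃ = 0 := by
    rw [← h₂₃, ← e₁₃]
  -- Degree 1 gives `i1` and `i3`. In `i2` and `i4` the degree is resonant, so `g₂₄` and `g₁₃`
  -- disappear. Finally `i5` identifies the constant terms of `g₁₃` and `g₂₄`.
  have i1 := congrArg (PowerSeries.coeff (0 + 1)) e₂₄'
  have i2 := congrArg (PowerSeries.coeff (2 + 1)) e₂₄'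
  have i3 := congrArg (PowerSeries.coeff (0 + 1)) e₁₃'
  have i4 := congrArg (PowerSeries.coeff (3 + 1)) e₁₃'
  have i5 := congrArg (PowerSeries.coeff 0) e₁₄
  rw [map_add, map_sub, coeff_zero_eulerOp, coeff_zero_mul_ps, coeff_zero_mul_ps, a0, c0,
    map_zero] at i5
  simp only [map_add, map_sub, coeff_succ_eulerOp, coeff_succ_mul_C_mul_X,
    map_zero] at i1 i2 i3 i4
  rw [zero_add, coeff_one_mul_ps, p0', a0, b0] at i3
  rw [b0, c0] at i1
  rw [b2, c2] at i2
  rw [a3] at i4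
  push_cast at i1 i2 i3 i4
  refine ⟨x, y, PowerSeries.coeff 0 g₂₄, PowerSeries.coeff 2 g₁₂, h₃₄, h₂₃, ?_, ?_, ?_, ?_⟩
  · linear_combination i1
  · linear_combination i3 - p1 - 3 * i5
  · linear_combination i2
  · intro hg
    rw [hg, map_zero, zero_mul, zero_add] at e₁₂
    have h₁₂ := eq_monomial_of_eulerOp e₁₂
    refine ⟨h₁₂, ?_⟩
    have : PowerSeries.coeff (3 + 1) (g₁₂ * S₂) = PowerSeries.coeff 2 g₁₂ * γ := by
      conv_lhs => rw [h₁₂]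
      rw [mul_assoc, PowerSeries.coeff_C_mul, PowerSeries.coeff_X_pow_mul S₂ 2 2, b2]
    rw [this] at i4
    linear_combination i4

end Field

/-! ### Isomorphism and invariance of the themes `E(σ)`. -/

section Modules

theorem Isomorphic.symm {E F : ABModule} (h : Isomorphic E F) : Isomorphic F E := by
  obtain ⟨u, hu⟩ := h
  refine ⟨u.symm, fun v => ?_⟩
  apply u.injective
  rw [hu, u.apply_symm_apply, u.apply_symm_apply]

theorem Isomorphic.trans {E F G : ABModule} (h : Isomorphic E F) (h' : Isomorphic F G) :
    Isomorphic E G := by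
  obtain ⟨u, hu⟩ := h
  obtain ⟨w, hw⟩ := h'
  exact ⟨u.trans w, fun v => by simp [hu, hw]⟩

theorem isomorphic_ofMatrix {k : ℕ} {M N G : Matrix (Fin k) (Fin k) ℂ⟦X⟧}
    (h : Intertwines M N G) (hG : IsUnit G) :
    Isomorphic (ABModule.ofMatrix M) (ABModule.ofMatrix N) := by
  have hb : Function.Bijective G.mulVecLin :=
    ⟨Matrix.mulVec_injective_of_isUnit hG, Matrix.mulVec_surjective_iff_isUnit.2 hG⟩
  exact Isomorphic.symm
    ⟨LinearEquiv.ofBijective G.mulVecLin hb, fun v => (h.abAct_mulVec v).symm⟩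

theorem exists_intertwiner_of_linearMap {k : ℕ} {M N : Matrix (Fin k) (Fin k) ℂ⟦X⟧}
    (u : ABModule.ofMatrix N →ₗ[ℂ⟦X⟧] ABModule.ofMatrix M)
    (hu : ∀ v, u ((ABModule.ofMatrix N).a v) = (ABModule.ofMatrix M).a (u v)) :
    ∃ G, Intertwines M N G ∧ ∀ v, u v = G.mulVec v := by
  have key : ∀ v : Fin k → ℂ⟦X⟧,
      (LinearMap.toMatrix' (R := ℂ⟦X⟧) (m := Fin k) (n := Fin k) u).mulVec v = u v := fun v =>
    LinearMap.toMatrix'_mulVec (R := ℂ⟦X⟧) (m := Fin k) (n := Fin k) u v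
  refine ⟨LinearMap.toMatrix' (R := ℂ⟦X⟧) (m := Fin k) (n := Fin k) u,
    intertwines_iff.2 fun v => ?_, fun v => (key v).symm⟩
  rw [key, key]
  exact (hu v).symm

theorem exists_upperMatrix_of_isomorphic {l : ℂ} {S₁ S₂ S₃ T₁ T₂ T₃ : ℂ⟦X⟧}
    (hS₁ : PowerSeries.coeff 0 S₁ = 1) (hS₂ : PowerSeries.coeff 0 S₂ = 1)
    (hS₃ : PowerSeries.coeff 0 S₃ = 1)
    (hT₁ : PowerSeries.coeff 0 T₁ = 1) (hT₂ : PowerSeries.coeff 0 T₂ = 1)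
    (hT₃ : PowerSeries.coeff 0 T₃ = 1)
    (h : Isomorphic (ABModule.ofMatrix (themeMatrix l S₁ S₂ S₃))
      (ABModule.ofMatrix (themeMatrix l T₁ T₂ T₃))) :
    ∃ g g₁₂ g₁₃ g₁₄ g₂₃ g₂₄ g₃₄, g ≠ 0 ∧
      Intertwines (themeMatrix l S₁ S₂ S₃) (themeMatrix l T₁ T₂ T₃)
        (upperMatrix g g₁₂ g₁₃ g₁₄ g₂₃ g₂₄ g₃₄) := by
  -- A matrix with `Intertwines M N G` maps the module of `N` to that of `M`, hence the inverse
  -- isomorphism.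
  obtain ⟨u, hu⟩ := h.symm
  obtain ⟨G, hG, hGu⟩ := exists_intertwiner_of_linearMap u.toLinearMap hu
  obtain ⟨g, g₁₂, g₁₃, g₁₄, g₂₃, g₂₄, g₃₄, rfl⟩ := hG.eq_upperMatrix hS₁ hS₂ hS₃ hT₁ hT₂ hT₃
  refine ⟨g, g₁₂, g₁₃, g₁₄, g₂₃, g₂₄, g₃₄, ?_, hG⟩
  rintro rfl
  have h0 : (upperMatrix 0 g₁₂ g₁₃ g₁₄ g₂₃ g₂₄ g₃₄).mulVec (Pi.single 0 1) =
      (upperMatrix 0 g₁₂ g₁₃ g₁₄ g₂₃ g₂₄ g₃₄).mulVec 0 := by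
    rw [Matrix.mulVec_single_one]
    ext1 i
    fin_cases i <;> simp [upperMatrix]
  have h1 := congrFun (u.injective (((hGu _).trans h0).trans (hGu _).symm)) 0
  simp at h1

theorem canonicalTheme_eq (lam1 : ℚ) (σ : Fin 6 → ℂ) : canonicalTheme lam1 σ =
    ABModule.ofMatrix (themeMatrix (lam1 : ℂ) (cubicSeries (σ 3) (σ 4) (σ 5))
      (cubicSeries (σ 1) (σ 2) 0) (cubicSeries 0 (σ 0) 0)) := by
  rw [canonicalTheme, canonicalMatrix_eq]

/-- On the hyperplane `γ x = α y` becomes `3 x = 5 y`, and `3 x - 5 y` is, up to the nonzero factor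
`2 g`, the only possible change of `ε`. -/
theorem isomorphic_canonicalTheme {lam1 : ℚ} {σ τ : Fin 6 → ℂ}
    (h : Isomorphic (canonicalTheme lam1 σ) (canonicalTheme lam1 τ)) :
    (∀ i, i ≠ 4 → σ i = τ i) ∧ (σ 2 ≠ 0 → 3 * σ 0 = 5 * σ 2 → σ = τ) := by
  rw [canonicalTheme_eq, canonicalTheme_eq] at h
  obtain ⟨a0, a1, a2, a3⟩ := coeff_cubicSeries (σ 3) (σ 4) (σ 5)
  obtain ⟨b0, b1, b2, b3⟩ := coeff_cubicSeries (σ 1) (σ 2) 0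
  obtain ⟨c0, c1, c2, c3⟩ := coeff_cubicSeries 0 (σ 0) 0
  obtain ⟨a0', a1', a2', a3'⟩ := coeff_cubicSeries (τ 3) (τ 4) (τ 5)
  obtain ⟨b0', b1', b2', b3'⟩ := coeff_cubicSeries (τ 1) (τ 2) 0
  obtain ⟨c0', c1', c2', c3'⟩ := coeff_cubicSeries 0 (τ 0) 0
  obtain ⟨g, g₁₂, g₁₃, g₁₄, g₂₃, g₂₄, g₃₄, hg, hG⟩ :=
    exists_upperMatrix_of_isomorphic a0 b0 c0 a0' b0' c0' h
  obtain ⟨i₁, i₂, i₃, i₄, i₅⟩ := hG.invariants hg a0 b0 b0' c0'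
  rw [c2, c2'] at i₁
  rw [b2, b2'] at i₂
  rw [a3, a3'] at i₃
  rw [b1, b1', c1, c1', sub_zero, sub_zero] at i₄
  rw [a1, a1', c1, c1', mul_zero, sub_zero, sub_zero] at i₅
  have key : ∀ i, i ≠ 4 → σ i = τ i := by
    intro i hi
    fin_cases i
    · exact i₁
    · exact i₄
    · exact i₂
    · exact i₅
    · exact absurd rfl hi
    · exact i₃
  refine ⟨key, fun h2 h35 => ?_⟩
  rw [← i₁, ← i₂, ← i₃, ← i₄, ← i₅] at hG
  obtain ⟨x, y, k, w, -, -, r₁, r₂, r₃, -⟩ := hG.canonical_relations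
  have hx : 3 * x = 5 * y := by
    apply mul_left_cancel₀ h2
    linear_combination 3 * r₃ + y * h35
  have h4 : σ 4 = τ 4 := by
    apply mul_left_cancel₀ hg
    linear_combination -r₂ + 3 / 2 * r₁ - 1 / 2 * hx
  ext1 i
  by_cases hi : i = 4
  · rw [hi, h4]
  · exact key i hi

/-- Off the hyperplane every displacement of `ε` has the form `s (3α - 5γ)` with a suitable `s`. -/
theorem isomorphic_canonicalTheme_update {lam1 : ℚ} {σ : Fin 6 → ℂ} (hσ : σ ∈ paramSpace)
    (h : 3 * σ 0 ≠ 5 * σ 2) (ε : ℂ) :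
    Isomorphic (canonicalTheme lam1 (Function.update σ 4 ε)) (canonicalTheme lam1 σ) := by
  have h' : 3 * σ 0 - 5 * σ 2 ≠ 0 := sub_ne_zero.2 h
  simp only [paramSpace, Set.mem_ofPred_eq, mul_ne_zero_iff] at hσ
  obtain ⟨g₁₂, g₁₃, g₁₄, g₂₃, g₂₄, g₃₄, hG⟩ := exists_intertwiner_canonical_shift
    (lam1 : ℂ) (σ 0) (σ 1) (σ 2) (σ 3) (σ 4) (σ 5) ((ε - σ 4) / (3 * σ 0 - 5 * σ 2))
    (IsUnit.mk0 _ hσ.1.1) (IsUnit.mk0 _ hσ.1.2)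
  rw [div_mul_cancel₀ _ h', add_sub_cancel] at hG
  rw [canonicalTheme_eq, canonicalTheme_eq]
  have := isomorphic_ofMatrix hG (isUnit_upperMatrix isUnit_one _ _ _ _ _ _)
  simpa using this.symm

theorem finrank_ofMatrix {k : ℕ} (M : Matrix (Fin k) (Fin k) ℂ⟦X⟧) :
    Module.finrank ℂ⟦X⟧ (ABModule.ofMatrix M) = k :=
  Module.finrank_fin_fun (n := k) ℂ⟦X⟧

theorem isInvariant_ofMatrix_iff {k : ℕ} {M : Matrix (Fin k) (Fin k) ℂ⟦X⟧} :
    IsInvariant (ABModule.ofMatrix M) ↔ ∃ G, Intertwines M M G ∧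
      Module.finrank ℂ⟦X⟧ (LinearMap.range G.mulVecLin) + 1 = k := by
  constructor
  · rintro ⟨u, hu, hr⟩
    rw [finrank_ofMatrix] at hr
    obtain ⟨G, hG, hGu⟩ := exists_intertwiner_of_linearMap u hu
    refine ⟨G, hG, ?_⟩
    have : G.mulVecLin = u := LinearMap.ext fun v => (hGu v).symm
    rw [this]
    exact hr
  · rintro ⟨G, hG, hr⟩
    exact ⟨G.mulVecLin, fun v => (hG.abAct_mulVec v).symm,
      hr.trans (finrank_ofMatrix M).symm⟩

/-- An endomorphism with `g ≠ 0` is invertible. If `g = 0`, the relations have only the zero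
solution off the hyperplane, so the superdiagonal vanishes and the image lies in the span of the
first two basis vectors. Rank 3 never occurs. -/
theorem not_isInvariant_canonicalTheme {lam1 : ℚ} {σ : Fin 6 → ℂ} (hσ : σ ∈ paramSpace)
    (h : 3 * σ 0 ≠ 5 * σ 2) : ¬ IsInvariant (canonicalTheme lam1 σ) := by
  simp only [paramSpace, Set.mem_ofPred_eq, mul_ne_zero_iff] at hσ
  rw [canonicalTheme_eq, isInvariant_ofMatrix_iff]
  rintro ⟨G, hG, hr⟩
  obtain ⟨g, g₁₂, g₁₃, g₁₄, g₂₃, g₂₄, g₃₄, rfl⟩ := hG.eq_upperMatrix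
    (coeff_cubicSeries _ _ _).1 (coeff_cubicSeries _ _ _).1 (coeff_cubicSeries _ _ _).1
    (coeff_cubicSeries _ _ _).1 (coeff_cubicSeries _ _ _).1 (coeff_cubicSeries _ _ _).1
  by_cases hg : g = 0
  · obtain ⟨x, y, k, w, h₃₄, h₂₃, r₁, r₂, r₃, r₄⟩ := hG.canonical_relations
    obtain ⟨h₁₂, r₅⟩ := r₄ hg
    rw [sub_self, mul_zero, sub_zero] at r₂
    have hk : k = 0 := by
      have : (3 * σ 0 - 5 * σ 2) * k = 0 := by
        linear_combination -r₃ + σ 2 * r₁ + (σ 2 - σ 0) * r₂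
      exact (mul_eq_zero.1 this).resolve_left (sub_ne_zero.2 h)
    have hy : y = 0 := by rw [r₂, hk, mul_zero]
    have hx : x = 0 := by linear_combination r₁ + hy + 2 * hk
    have hw : w = 0 := by
      rw [hy, mul_zero] at r₅
      exact (mul_eq_zero.1 r₅.symm).resolve_left hσ.1.2
    have hrange : LinearMap.range (upperMatrix g g₁₂ g₁₃ g₁₄ g₂₃ g₂₄ g₃₄).mulVecLin ≤
        Submodule.span ℂ⟦X⟧ (Set.range ![(Pi.single 0 1 : Fin 4 → ℂ⟦X⟧), Pi.single 1 1]) := by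
      rintro _ ⟨v, rfl⟩
      rw [Matrix.mulVecLin_apply]
      refine (Submodule.mem_span_range_iff_exists_fun _).2
        ⟨![(Matrix.mulVec (upperMatrix g g₁₂ g₁₃ g₁₄ g₂₃ g₂₄ g₃₄) v) 0,
          (Matrix.mulVec (upperMatrix g g₁₂ g₁₃ g₁₄ g₂₃ g₂₄ g₃₄) v) 1], ?_⟩
      have hx0 : g₃₄ = 0 := by rw [h₃₄, hx]; simp
      ext1 i
      fin_cases i
      · simp
      · simp
      · simp [upperMatrix, Matrix.mulVec, dotProduct, Fin.sum_univ_four, hg, hx0]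
      · simp [upperMatrix, Matrix.mulVec, dotProduct, Fin.sum_univ_four, hg]
    have := Module.Finite.span_of_finite ℂ⟦X⟧
      (Set.finite_range ![(Pi.single 0 1 : Fin 4 → ℂ⟦X⟧), Pi.single 1 1])
    have h1 := Submodule.finrank_mono hrange
    have h2 := finrank_range_le_card (R := ℂ⟦X⟧)
      (b := ![(Pi.single 0 1 : Fin 4 → ℂ⟦X⟧), Pi.single 1 1])
    rw [Fintype.card_fin] at h2
    have h3 := h1.trans h2
    omega
  · have hinj : Function.Injective (upperMatrix g g₁₂ g₁₃ g₁₄ g₂₃ g₂₄ g₃₄).mulVecLin :=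
      Matrix.mulVec_injective_of_isUnit (isUnit_upperMatrix (IsUnit.mk0 g hg) ..)
    rw [LinearMap.finrank_range_of_inj hinj, Module.finrank_fin_fun] at hr
    omega

/-- On the hyperplane the relations with `g = 0` have a nonzero solution. It gives a strictly
triangular endomorphism with nonzero superdiagonal, whose kernel is the line of the first basis
vector. -/
theorem isInvariant_canonicalTheme {lam1 : ℚ} {σ : Fin 6 → ℂ} (hσ : σ ∈ paramSpace)
    (h : 3 * σ 0 = 5 * σ 2) : IsInvariant (canonicalTheme lam1 σ) := by
  simp only [paramSpace, Set.mem_ofPred_eq, mul_ne_zero_iff] at hσ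
  rw [canonicalTheme_eq, isInvariant_ofMatrix_iff]
  obtain ⟨a0, a1, a2, a3⟩ := coeff_cubicSeries (σ 3) (σ 4) (σ 5)
  obtain ⟨b0, b1, b2, b3⟩ := coeff_cubicSeries (σ 1) (σ 2) 0
  obtain ⟨c0, c1, c2, c3⟩ := coeff_cubicSeries 0 (σ 0) 0
  set S₁ := cubicSeries (σ 3) (σ 4) (σ 5) with hS₁
  set S₂ := cubicSeries (σ 1) (σ 2) 0 with hS₂
  set S₃ := cubicSeries 0 (σ 0) 0 with hS₃
  have expand : S₂ * (PowerSeries.C 5 * PowerSeries.X) -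
      (PowerSeries.C 3 * PowerSeries.X) * S₃ =
      S₂ * (PowerSeries.C 5 * PowerSeries.X) - S₃ * (PowerSeries.C 3 * PowerSeries.X) := by ring
  -- Here `x = 5`, `y = 3`, `h = 1`: they satisfy `x - y = 2 h` and `y = 3 h`, and `γ x = α y` is
  -- the equation of the hyperplane.
  obtain ⟨g₁₂, g₁₃, g₁₄, g₂₄, hG⟩ := exists_intertwiner (l := (lam1 : ℂ)) (g := 0)
    (h := 1) (g₂₃ := PowerSeries.C 3 * PowerSeries.X)
    (g₃₄ := PowerSeries.C 5 * PowerSeries.X) (S₃ := S₃)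
    a0 b0 a0 b0 c0 (by rw [b2]; exact IsUnit.mk0 _ hσ.1.2) (by rw [c2]; exact IsUnit.mk0 _ hσ.1.1)
    (by rw [eulerOp_one_C_mul_X, sub_self, mul_zero, add_zero])
    (by rw [eulerOp_one_C_mul_X, sub_self, mul_zero, add_zero])
    (by ring) (by simp) (by simp)
    (by
      rw [expand, map_sub, coeff_succ_mul_C_mul_X _ _ 2, coeff_succ_mul_C_mul_X _ _ 2, b2, c2]
      linear_combination -h)
    (by
      rw [expand, map_sub, coeff_succ_mul_C_mul_X _ _ 0, coeff_succ_mul_C_mul_X _ _ 0, b0, c0]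
      norm_num)
    (by simp)
  obtain ⟨x, y, k, w, h₃₄, h₂₃, r₁, r₂, r₃, r₄⟩ := hG.canonical_relations
  obtain ⟨h₁₂, r₅⟩ := r₄ rfl
  have hy : 3 = y := by simpa using congrArg (PowerSeries.coeff 1) h₂₃
  -- Because `γ w = θ y` with `θ` and `y` nonzero.
  have hw : w ≠ 0 := by
    rintro rfl
    rw [mul_zero, ← hy] at r₅
    exact hσ.2 (by linear_combination r₅ / 3)
  have hg₁₂ : g₁₂ ≠ 0 := by
    intro h0
    have := congrArg (PowerSeries.coeff 2) (h0.symm.trans h₁₂)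
    rw [PowerSeries.coeff_C_mul, PowerSeries.coeff_X_pow_self, map_zero, mul_one] at this
    exact hw this.symm
  have hX3 : (PowerSeries.C (3 : ℂ)) * PowerSeries.X ≠ 0 :=
    mul_ne_zero (by simp [map_eq_zero_iff _ PowerSeries.C_injective]) PowerSeries.X_ne_zero
  have hX5 : (PowerSeries.C (5 : ℂ)) * PowerSeries.X ≠ 0 :=
    mul_ne_zero (by simp [map_eq_zero_iff _ PowerSeries.C_injective]) PowerSeries.X_ne_zero
  set G := upperMatrix 0 g₁₂ g₁₃ g₁₄ (PowerSeries.C 3 * PowerSeries.X) g₂₄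
    (PowerSeries.C 5 * PowerSeries.X) with hGdef
  have hker : LinearMap.ker G.mulVecLin =
      LinearMap.range (LinearMap.single ℂ⟦X⟧ (fun _ : Fin 4 => ℂ⟦X⟧) 0) := by
    ext v
    rw [LinearMap.mem_ker, Matrix.mulVecLin_apply]
    constructor
    · intro hv
      have e0 := congrFun hv 0
      have e1 := congrFun hv 1
      have e2 := congrFun hv 2
      simp only [hGdef, upperMatrix, Matrix.mulVec, dotProduct, Fin.sum_univ_four, Pi.zero_apply,
        Matrix.of_apply, Matrix.cons_val, map_zero, zero_mul, zero_add] at e0 e1 e2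
      have v3 := (mul_eq_zero.1 e2).resolve_left hX5
      rw [v3, mul_zero, add_zero] at e1 e0
      have v2 := (mul_eq_zero.1 e1).resolve_left hX3
      rw [v2, mul_zero, add_zero] at e0
      have v1 := (mul_eq_zero.1 e0).resolve_left hg₁₂
      refine ⟨v 0, ?_⟩
      ext1 i
      fin_cases i <;> simp [v1, v2, v3]
    · rintro ⟨s, rfl⟩
      ext1 i
      fin_cases i <;>
        simp [hGdef, upperMatrix, Matrix.mulVec, dotProduct, Fin.sum_univ_four]
  have hs : Function.Injective (LinearMap.single ℂ⟦X⟧ (fun _ : Fin 4 => ℂ⟦X⟧) 0) :=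
    Pi.single_injective (M := fun _ : Fin 4 => ℂ⟦X⟧) 0
  have hrank := Submodule.finrank_quotient_add_finrank (LinearMap.ker G.mulVecLin)
  rw [G.mulVecLin.quotKerEquivRange.finrank_eq, hker,
    LinearMap.finrank_range_of_inj hs,
    Module.finrank_self, Module.finrank_fin_fun] at hrank
  exact ⟨G, hG, hrank⟩

end Modules

/-! ### Holomorphic functions on a complex space, and the algebra they form. -/

section Holomorphic

variable {Y : ReducedComplexSpace}

theorem LocalModel.continuousAt {X : Type} [TopologicalSpace X] (c : LocalModel X) {x : X}
    (hx : x ∈ c.dom) : ContinuousAt c.toFun x := by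
  have h : ContinuousOn c.toFun c.dom :=
    continuousOn_iff_continuous_domRestrict.2 c.isEmbedding.continuous
  exact h.continuousAt (c.isOpen_dom.mem_nhds hx)

theorem HolAt.exists_chart {f : Y → ℂ} {x : Y} (h : HolAt f x) {c : LocalModel Y}
    (hc : c ∈ Y.atlas) (hx : x ∈ c.dom) : ∃ F : (Fin c.dim → ℂ) → ℂ,
      AnalyticAt ℂ F (c.toFun x) ∧ ∀ᶠ y in 𝓝 x, f y = F (c.toFun y) := by
  obtain ⟨c₀, hc₀, hx₀, F, hF, hfF⟩ := h
  obtain ⟨T, hT, hcT⟩ := Y.compat c hc c₀ hc₀ x ⟨hx, hx₀⟩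
  refine ⟨F ∘ T, AnalyticAt.comp (by rwa [← hcT.self_of_nhds]) hT, ?_⟩
  filter_upwards [hfF, hcT] with y h1 h2
  rw [h1, h2, Function.comp_apply]

theorem HolAt.congr {f g : Y → ℂ} {x : Y} (h : HolAt f x) (hg : ∀ᶠ y in 𝓝 x, g y = f y) :
    HolAt g x := by
  obtain ⟨c, hc, hx, F, hF, hfF⟩ := h
  exact ⟨c, hc, hx, F, hF, by filter_upwards [hfF, hg] with y h1 h2; rw [h2, h1]⟩

theorem HolAt.comp_analyticAt {ι : Type} [Fintype ι] {f : ι → Y → ℂ} {x : Y}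
    (h : ∀ i, HolAt (f i) x) {G : (ι → ℂ) → ℂ} (hG : AnalyticAt ℂ G fun i => f i x) :
    HolAt (fun y => G fun i => f i y) x := by
  obtain ⟨c, hc, hx⟩ := Y.cover x
  choose F hF hfF using fun i => (h i).exists_chart hc hx
  have h0 : (fun i => f i x) = fun i => F i (c.toFun x) := funext fun i => (hfF i).self_of_nhds
  refine ⟨c, hc, hx, fun z => G fun i => F i z, ?_, ?_⟩
  · rw [h0] at hG
    exact AnalyticAt.comp (f := fun z i => F i z) hG (AnalyticAt.pi hF)
  · filter_upwards [Filter.eventually_all.2 hfF] with y hy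
    simp only [hy]

theorem HolAt.add {f g : Y → ℂ} {x : Y} (hf : HolAt f x) (hg : HolAt g x) :
    HolAt (fun y => f y + g y) x := by
  obtain ⟨c, hc, hx, F, hF, hfF⟩ := hf
  obtain ⟨G, hG, hgG⟩ := hg.exists_chart hc hx
  exact ⟨c, hc, hx, _, hF.add hG, by filter_upwards [hfF, hgG] with y h1 h2; simp [h1, h2]⟩

theorem HolAt.mul {f g : Y → ℂ} {x : Y} (hf : HolAt f x) (hg : HolAt g x) :
    HolAt (fun y => f y * g y) x := by
  obtain ⟨c, hc, hx, F, hF, hfF⟩ := hf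
  obtain ⟨G, hG, hgG⟩ := hg.exists_chart hc hx
  exact ⟨c, hc, hx, _, hF.mul hG, by filter_upwards [hfF, hgG] with y h1 h2; simp [h1, h2]⟩

theorem HolAt.inv {f : Y → ℂ} {x : Y} (hf : HolAt f x) (h0 : f x ≠ 0) :
    HolAt (fun y => (f y)⁻¹) x := by
  obtain ⟨c, hc, hx, F, hF, hfF⟩ := hf
  exact ⟨c, hc, hx, _, hF.inv (by rwa [← hfF.self_of_nhds]),
    by filter_upwards [hfF] with y h1; simp [h1]⟩

theorem HolAt.continuousAt {f : Y → ℂ} {x : Y} (hf : HolAt f x) : ContinuousAt f x := by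
  obtain ⟨c, hc, hx, F, hF, hfF⟩ := hf
  exact (hF.continuousAt.comp (c.continuousAt hx)).congr
    (by filter_upwards [hfF] with y h1; rw [h1, Function.comp_apply])

/-- The algebra of holomorphic functions on `U`. -/
def holRing (Y : ReducedComplexSpace) (U : Set Y) : Subalgebra ℂ (U → ℂ) where
  carrier := {f | ∃ F : Y → ℂ, HolOn F U ∧ ∀ u : U, f u = F u}
  mul_mem' := by
    rintro f g ⟨F, hF, hf⟩ ⟨G, hG, hg⟩
    exact ⟨fun y => F y * G y, fun x hx => (hF x hx).mul (hG x hx), fun u => by simp [hf, hg]⟩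
  add_mem' := by
    rintro f g ⟨F, hF, hf⟩ ⟨G, hG, hg⟩
    exact ⟨fun y => F y + G y, fun x hx => (hF x hx).add (hG x hx), fun u => by simp [hf, hg]⟩
  algebraMap_mem' := fun z => ⟨fun _ => z, fun x _ => holAt_const z x, fun _ => rfl⟩

namespace holRing

variable {U : Set Y}

/-- Evaluation at a point. -/
def ev (u : U) : holRing Y U →ₐ[ℂ] ℂ := (Pi.evalAlgHom ℂ (fun _ : U => ℂ) u).comp (holRing Y U).val

/-- The element of `holRing` given by a function which is holomorphic on `U`. -/
def mk (F : Y → ℂ) (hF : HolOn F U) : holRing Y U := ⟨fun u => F u, F, hF, fun _ => rfl⟩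

@[simp] theorem ev_mk (F : Y → ℂ) (hF : HolOn F U) (u : U) : ev u (mk F hF) = F u := rfl

theorem ext_ev {f g : holRing Y U} (h : ∀ u, ev u f = ev u g) : f = g := Subtype.ext (funext h)

theorem isUnit_iff {f : holRing Y U} : IsUnit f ↔ ∀ u, ev u f ≠ 0 := by
  refine ⟨fun h u => (h.map (ev u)).ne_zero, fun h => ?_⟩
  obtain ⟨F, hF, hf⟩ := f.2
  have h1 : ∀ u, ev u f = F u := hf
  have hF' : HolOn (fun y => (F y)⁻¹) U := fun x hx => (hF x hx).inv (by
    have := h ⟨x, hx⟩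
    rwa [h1] at this)
  refine IsUnit.of_mul_eq_one (mk _ hF') (ext_ev fun u => ?_)
  rw [map_mul, ev_mk, map_one, h1, mul_inv_cancel₀]
  rw [← h1]
  exact h u

/-- Evaluation at a point of a power series. -/
def evS (u : U) : (holRing Y U)⟦X⟧ →+* ℂ⟦X⟧ := PowerSeries.map (ev u : holRing Y U →+* ℂ)

theorem coeff_evS (u : U) (T : (holRing Y U)⟦X⟧) (n : ℕ) :
    PowerSeries.coeff n (evS u T) = ev u (PowerSeries.coeff n T) := by
  rw [evS, PowerSeries.coeff_map]; rfl

theorem evS_C (u : U) (f : holRing Y U) : evS u (PowerSeries.C f) = PowerSeries.C (ev u f) := by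
  rw [evS, PowerSeries.map_C]; rfl

theorem evS_X (u : U) : evS u PowerSeries.X = PowerSeries.X := PowerSeries.map_X _

theorem evS_derivative (u : U) (T : (holRing Y U)⟦X⟧) :
    evS u (PowerSeries.derivative _ T) = PowerSeries.derivative ℂ (evS u T) := by
  ext n; simp [PowerSeries.coeff_derivative, coeff_evS]

theorem ext_evS {S T : (holRing Y U)⟦X⟧} (h : ∀ u, evS u S = evS u T) : S = T := by
  ext1 n
  exact ext_ev fun u => by rw [← coeff_evS, h, coeff_evS]

theorem isUnit_iff_evS {T : (holRing Y U)⟦X⟧} : IsUnit T ↔ ∀ u, IsUnit (evS u T) := by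
  rw [PowerSeries.isUnit_iff_constantCoeff, isUnit_iff]
  refine forall_congr' fun u => ?_
  rw [PowerSeries.isUnit_iff_constantCoeff, isUnit_iff_ne_zero,
    ← PowerSeries.coeff_zero_eq_constantCoeff_apply,
    ← PowerSeries.coeff_zero_eq_constantCoeff_apply, coeff_evS]

/-- The power series with coefficients in `holRing` given by a section of `𝒪[[b]]`. -/
def mkS (S : Y → ℂ⟦X⟧) (hS : SeriesHolOn S U) : (holRing Y U)⟦X⟧ :=
  PowerSeries.mk fun n => mk _ (hS n)

@[simp] theorem evS_mkS (S : Y → ℂ⟦X⟧) (hS : SeriesHolOn S U) (u : U) :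
    evS u (mkS S hS) = S u := by
  ext n
  rw [coeff_evS, mkS, PowerSeries.coeff_mk, ev_mk]

open Classical in
/-- The section of `𝒪[[b]]` given by a power series with coefficients in `holRing`. -/
def toS (T : (holRing Y U)⟦X⟧) (y : Y) : ℂ⟦X⟧ := if h : y ∈ U then evS ⟨y, h⟩ T else 0

theorem toS_apply (T : (holRing Y U)⟦X⟧) {y : Y} (h : y ∈ U) : toS T y = evS ⟨y, h⟩ T := dif_pos h

theorem seriesHolOn_toS (hU : IsOpen U) (T : (holRing Y U)⟦X⟧) : SeriesHolOn (toS T) U := by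
  intro n x hx
  obtain ⟨F, hF, hf⟩ := (PowerSeries.coeff n T).2
  refine (hF x hx).congr ?_
  filter_upwards [hU.mem_nhds hx] with y hy
  rw [toS_apply T hy, coeff_evS]
  exact hf ⟨y, hy⟩

end holRing

open holRing

/-- This turns statements about sheaves into algebra over `(holRing Y V)⟦X⟧`, where the equations on
intertwiners can be solved once for all points. -/
theorem holCombOn_iff {M : Y → Type} [∀ y, AddCommGroup (M y)] [∀ y, Module ℂ⟦X⟧ (M y)] {k : ℕ}
    {V : Set Y} (hV : IsOpen V) {w : ∀ y, Fin k → M y} {s : ∀ y, M y} :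
    HolCombOn V w s ↔ ∃ T : Fin k → (holRing Y V)⟦X⟧,
      ∀ u : V, s u = ∑ i, evS u (T i) • w u i := by
  constructor
  · rintro ⟨S, hS, h⟩
    exact ⟨fun i => mkS (S i) (hS i), fun u => by simp [h u u.2]⟩
  · rintro ⟨T, h⟩
    exact ⟨fun i => toS (T i), fun i => seriesHolOn_toS hV _, fun y hy => by
      simp [toS_apply _ hy, h ⟨y, hy⟩]⟩

theorem HolCombOn.mono {M : Y → Type} [∀ y, AddCommGroup (M y)] [∀ y, Module ℂ⟦X⟧ (M y)] {k : ℕ}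
    {V V' : Set Y} {w : ∀ y, Fin k → M y} {s : ∀ y, M y} (h : HolCombOn V w s) (hV : V' ⊆ V) :
    HolCombOn V' w s := by
  obtain ⟨S, hS, h⟩ := h
  exact ⟨S, fun i n x hx => hS i n x (hV hx), fun y hy => h y (hV hy)⟩

theorem HolCombOn.trans {M : Y → Type} [∀ y, AddCommGroup (M y)] [∀ y, Module ℂ⟦X⟧ (M y)]
    {k k' : ℕ} {V : Set Y} (hV : IsOpen V) {w : ∀ y, Fin k → M y} {w' : ∀ y, Fin k' → M y}
    {s : ∀ y, M y} (h : HolCombOn V w s) (h' : ∀ i, HolCombOn V w' fun y => w y i) :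
    HolCombOn V w' s := by
  rw [holCombOn_iff hV] at h ⊢
  obtain ⟨T, hT⟩ := h
  choose T' hT' using fun i => (holCombOn_iff hV).1 (h' i)
  refine ⟨fun j => ∑ i, T i * T' i j, fun u => ?_⟩
  rw [hT]
  simp only [hT', Finset.smul_sum, map_sum, map_mul, Finset.sum_smul, mul_smul]
  exact Finset.sum_comm

/-- Two frames of the same sheaf: if one is holomorphic in terms of the other, then also
conversely. -/
theorem HolCombOn.symm {M : Y → Type} [∀ y, AddCommGroup (M y)] [∀ y, Module ℂ⟦X⟧ (M y)]
    {k k' : ℕ} {V : Set Y} (hV : IsOpen V) {w : ∀ y, Fin k → M y} {w' : ∀ y, Fin k' → M y}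
    (hw : ∀ y ∈ V, LinearIndependent ℂ⟦X⟧ (w y)) (hw' : ∀ y ∈ V, LinearIndependent ℂ⟦X⟧ (w' y))
    (hspan : ∀ y ∈ V, Submodule.span ℂ⟦X⟧ (Set.range (w y)) =
      Submodule.span ℂ⟦X⟧ (Set.range (w' y)))
    (h : ∀ j, HolCombOn V w fun y => w' y j) (j : Fin k) : HolCombOn V w' fun y => w y j := by
  rcases V.eq_empty_or_nonempty with rfl | ⟨y₀, hy₀⟩
  · exact ⟨fun _ _ => 0, fun _ _ _ hx => hx.elim, fun _ hx => hx.elim⟩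
  have hk : k = k' := by
    have h1 := finrank_span_eq_card (hw y₀ hy₀)
    rw [hspan y₀ hy₀, finrank_span_eq_card (hw' y₀ hy₀), Fintype.card_fin, Fintype.card_fin] at h1
    exact h1.symm
  subst hk
  choose T hT using fun i => (holCombOn_iff hV).1 (h i)
  set A : Matrix (Fin k) (Fin k) (holRing Y V)⟦X⟧ := Matrix.of fun i j => T j i with hA
  -- Units of `(holRing Y V)⟦X⟧` are detected pointwise. At a point, equality of the spans provides
  -- an inverse matrix `B`.
  have hdet : IsUnit A.det := by
    refine isUnit_iff_evS.2 fun u => ?_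
    rw [RingHom.map_det]
    have hmem : ∀ i, w u i ∈ Submodule.span ℂ⟦X⟧ (Set.range (w' u)) := fun i => by
      rw [← hspan u u.2]; exact Submodule.subset_span ⟨i, rfl⟩
    choose B hB using fun i => (Submodule.mem_span_range_iff_exists_fun _).1 (hmem i)
    refine Matrix.isUnit_det_of_right_inverse (B := Matrix.of fun i j => B j i) ?_
    ext1 i j
    have key : ∑ l, ((∑ m, evS u (T m l) * B j m) - (1 : Matrix (Fin k) (Fin k) ℂ⟦X⟧) l j) •
        w u l = 0 := by
      simp only [sub_smul, Finset.sum_sub_distrib, Finset.sum_smul, Matrix.one_apply, ite_smul,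
        one_smul, zero_smul, Finset.sum_ite_eq', Finset.mem_univ, if_true]
      rw [sub_eq_zero, Finset.sum_comm]
      conv_rhs => rw [← hB j]
      refine Finset.sum_congr rfl fun m _ => ?_
      rw [hT m u, Finset.smul_sum]
      exact Finset.sum_congr rfl fun l _ => by rw [smul_smul, mul_comm]
    have := Fintype.linearIndependent_iff.1 (hw u u.2) _ key i
    rw [sub_eq_zero] at this
    rw [← this]
    simp [Matrix.mul_apply, hA]
  refine (holCombOn_iff hV).2 ⟨fun i => A⁻¹ i j, fun u => ?_⟩
  have hinv := Matrix.mul_nonsing_inv A hdet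
  simp only [hT, Finset.smul_sum, smul_smul]
  rw [Finset.sum_comm]
  have : ∀ l, ∑ i, (evS u (A⁻¹ i j) * evS u (T i l)) • w u l =
      (1 : Matrix (Fin k) (Fin k) ℂ⟦X⟧) l j • w u l := fun l => by
    rw [← Finset.sum_smul]
    congr 1
    have h1 := congrArg (evS u) (congrFun (congrFun hinv l) j)
    rw [Matrix.mul_apply, map_sum] at h1
    rw [Finset.sum_congr rfl fun i _ => mul_comm (evS u (A⁻¹ i j)) (evS u (T i l))]
    simp only [map_mul, hA, Matrix.of_apply] at h1 ⊢
    rw [h1, Matrix.one_apply, Matrix.one_apply]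
    split_ifs <;> simp
  simp [this, Matrix.one_apply]

end Holomorphic

/-! ### Embedding themes in `Ξ`. -/

section Xi

variable {R : Type*} [CommRing R]

/-- The matrix of `a` in the basis `e_{μ,0}, …, e_{μ,3}` of `Ξ_μ^{(3)}`. -/
def xiMatrix (μ : R) : Matrix (Fin 4) (Fin 4) R⟦X⟧ :=
  Matrix.of fun i j => if i = j then PowerSeries.C μ * PowerSeries.X
    else if (i : ℕ) + 1 = j then PowerSeries.X else 0

theorem xiMatrix_map {A : Type*} [CommRing A] (f : R →+* A) (μ : R) :
    (xiMatrix μ).map (PowerSeries.map f) = xiMatrix (f μ) := by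
  ext1 i j
  simp only [xiMatrix, Matrix.map_apply, Matrix.of_apply]
  split_ifs <;> simp

/-- Subtracting `(μ + n) b` leaves `eulerOp n` on each coordinate, coupled to the next power of the
logarithm by a factor `b`. -/
theorem abAct_xiMatrix (μ : R) (v : Fin 4 → R⟦X⟧) (n : ℕ) :
    abAct (xiMatrix μ) v = (PowerSeries.C (μ + n) * PowerSeries.X) • v +
      ![PowerSeries.X * v 1 + eulerOp n (v 0), PowerSeries.X * v 2 + eulerOp n (v 1),
        PowerSeries.X * v 3 + eulerOp n (v 2), eulerOp n (v 3)] := by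
  ext1 i
  fin_cases i <;>
    simp [abAct, xiMatrix, Matrix.mulVec, dotProduct, Fin.sum_univ_four, eulerOp] <;> ring

theorem coeff_eq_zero_of_eulerOp_of_ne [Algebra ℂ R] {d n : ℕ} (hn : n ≠ d) {k : R⟦X⟧}
    (h : PowerSeries.coeff (n + 1) (eulerOp d k) = 0) : PowerSeries.coeff n k = 0 := by
  rw [coeff_succ_eulerOp] at h
  have hu : IsUnit ((n : R) - d) := by
    have : (n : R) - d = algebraMap ℂ R ((n : ℂ) - d) := by simp
    rw [this]
    exact (IsUnit.mk0 _ (sub_ne_zero.2 (by exact_mod_cast hn))).map _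
  exact hu.mul_right_eq_zero.1 h

theorem eq_monomial_of_eulerOp' [Algebra ℂ R] {d : ℕ} {k : R⟦X⟧} {c : R} (h : eulerOp d k = 0)
    (hc : PowerSeries.coeff d k = c) : k = PowerSeries.C c * PowerSeries.X ^ d := by
  ext n
  rw [PowerSeries.coeff_C_mul, PowerSeries.coeff_X_pow]
  split_ifs with hn
  · rw [hn, mul_one, hc]
  · rw [mul_zero]
    exact coeff_eq_zero_of_eulerOp_of_ne hn (by rw [h, map_zero])

/-- Solution of `(a - (μ + n) b) v = w` in `Ξ`. -/
theorem exists_xi_solution [Algebra ℂ R] (μ : R) {n N : ℕ} (hN : N ≤ n) (w : Fin 4 → R⟦X⟧)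
    (h3 : w 3 = 0) (hw : ∀ k, PowerSeries.X ^ (N + 1) ∣ w k) :
    ∃ v, abAct (xiMatrix μ) v = (PowerSeries.C (μ + n) * PowerSeries.X) • v + w ∧
      (∀ k, PowerSeries.X ^ N ∣ v k) ∧
      v 3 = PowerSeries.C (PowerSeries.coeff (n + 1) (w 2)) * PowerSeries.X ^ n ∧
      (w 2 = 0 → v 2 = PowerSeries.C (PowerSeries.coeff (n + 1) (w 1)) * PowerSeries.X ^ n) ∧
      (w 2 = 0 → w 1 = 0 →
        v 1 = PowerSeries.C (PowerSeries.coeff (n + 1) (w 0)) * PowerSeries.X ^ n) := by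
  have hw' : ∀ k j, j < N + 1 → PowerSeries.coeff j (w k) = 0 := fun k =>
    PowerSeries.X_pow_dvd_iff.1 (hw k)
  have hw0 : ∀ k, PowerSeries.coeff 0 (w k) = 0 := fun k => hw' k 0 (Nat.succ_pos N)
  -- The coordinates are found from the last one downwards. The coefficient of `b^n` in the
  -- coordinate already found cancels the obstruction in degree `n + 1` of the next equation; the
  -- new coordinate has its own coefficient `c` of `b^n` free for the same purpose.
  have step : ∀ (k : Fin 4) (u : R⟦X⟧) (c : R), PowerSeries.coeff n u =
      PowerSeries.coeff (n + 1) (w k) → ∃ v, PowerSeries.X * u + eulerOp n v = w k ∧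
        PowerSeries.coeff n v = c := by
    intro k u c hu
    obtain ⟨v, hv, hvc⟩ := exists_eulerOp_eq n (PowerSeries.X * u - w k) c
      (by rw [map_sub, hw0, sub_zero, PowerSeries.coeff_zero_X_mul])
      (by rw [map_sub, PowerSeries.coeff_succ_X_mul, hu, sub_self])
    exact ⟨v, by linear_combination hv, hvc⟩
  have dvd : ∀ (k : Fin 4) (u v : R⟦X⟧), PowerSeries.X * u + eulerOp n v = w k →
      PowerSeries.X ^ N ∣ u → PowerSeries.X ^ N ∣ v := by
    intro k u v h hu
    rw [PowerSeries.X_pow_dvd_iff] at hu ⊢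
    intro j hj
    refine coeff_eq_zero_of_eulerOp_of_ne (d := n) (by omega) ?_
    have := congrArg (PowerSeries.coeff (j + 1)) h
    rwa [map_add, PowerSeries.coeff_succ_X_mul, hu j hj, zero_add, hw' k _ (by omega)] at this
  set v₃ : R⟦X⟧ := PowerSeries.C (PowerSeries.coeff (n + 1) (w 2)) * PowerSeries.X ^ n with hv₃
  have e₃ : eulerOp n v₃ = 0 := eulerOp_monomial _ _
  obtain ⟨v₂, e₂, c₂⟩ := step 2 v₃ (PowerSeries.coeff (n + 1) (w 1)) (by simp [hv₃])
  obtain ⟨v₁, e₁, c₁⟩ := step 1 v₂ (PowerSeries.coeff (n + 1) (w 0)) c₂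
  obtain ⟨v₀, e₀, -⟩ := step 0 v₁ 0 c₁
  have d₃ : PowerSeries.X ^ N ∣ v₃ := dvd 3 0 v₃ (by rw [h3, e₃]; simp) (dvd_zero _)
  have d₂ := dvd 2 v₃ v₂ e₂ d₃
  have d₁ := dvd 1 v₂ v₁ e₁ d₂
  have d₀ := dvd 0 v₁ v₀ e₀ d₁
  have m₂ : w 2 = 0 → v₂ = PowerSeries.C (PowerSeries.coeff (n + 1) (w 1)) * PowerSeries.X ^ n := by
    intro h
    refine eq_monomial_of_eulerOp' ?_ c₂
    have hz : v₃ = 0 := by rw [hv₃, h]; simp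
    rw [hz, mul_zero, zero_add] at e₂
    exact e₂.trans h
  refine ⟨![v₀, v₁, v₂, v₃], ?_, ?_, rfl, m₂, fun h h' => ?_⟩
  · rw [abAct_xiMatrix μ _ n]
    congr 1
    ext1 i
    fin_cases i
    · exact e₀
    · exact e₁
    · exact e₂
    · exact e₃.trans h3.symm
  · intro k
    fin_cases k
    · exact d₀
    · exact d₁
    · exact d₂
    · exact d₃
  · refine eq_monomial_of_eulerOp' ?_ c₁
    have h2 := m₂ h
    rw [h', map_zero, map_zero, zero_mul] at h2
    rw [h2, h', mul_zero, zero_add] at e₁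
    exact e₁

/-- The embedding of a theme in `Ξ`, with an upper triangular matrix. -/
theorem exists_xi_embedding [Algebra ℂ R] (μ : R) (N : ℕ) (S₁ S₂ S₃ : R⟦X⟧) :
    ∃ P : Matrix (Fin 4) (Fin 4) R⟦X⟧,
      Intertwines (xiMatrix μ) (themeMatrix (μ + (N + 3 : ℕ)) S₁ S₂ S₃) P ∧
      P.det = PowerSeries.C (PowerSeries.coeff 3 S₁ ^ 3 * PowerSeries.coeff 2 S₂ ^ 2 *
        PowerSeries.coeff 2 S₃) * PowerSeries.X ^ (4 * N + 21) := by
  have coeff_mul : ∀ (S : R⟦X⟧) (c : R) (i j : ℕ),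
      PowerSeries.coeff (i + j) (S * (PowerSeries.C c * PowerSeries.X ^ j)) =
        c * PowerSeries.coeff i S := fun S c i j => by
    rw [mul_left_comm, PowerSeries.coeff_C_mul, PowerSeries.coeff_mul_X_pow]
  set p₁ : Fin 4 → R⟦X⟧ := ![PowerSeries.X ^ (N + 3), 0, 0, 0] with hp₁
  have a₁ : abAct (xiMatrix μ) p₁ =
      (PowerSeries.C (μ + (N + 3 : ℕ)) * PowerSeries.X) • p₁ := by
    have h0 : eulerOp (N + 3) (PowerSeries.X ^ (N + 3) : R⟦X⟧) = 0 := by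
      simpa using eulerOp_monomial (N + 3) (1 : R)
    rw [abAct_xiMatrix μ _ (N + 3)]
    ext1 i
    fin_cases i <;> simp [hp₁, h0] <;> simp [eulerOp]
  have d₁ : ∀ k, PowerSeries.X ^ (N + 3) ∣ p₁ k := by
    intro k
    fin_cases k <;> simp [hp₁]
  -- Each column solves `(a - (μ + n) b) p = S p'` with `p'` the preceding column. A step loses one
  -- power of `b`, from `N + 3` to `N`, and raises the logarithmic degree by one; the new leading
  -- coefficient carries a resonant coefficient of `S`, hence the product in the determinant.
  obtain ⟨p₂, a₂, d₂, r₂3, r₂2, r₂1⟩ := exists_xi_solution μ (n := N + 5) (N := N + 2) (by omega)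
    (S₁ • p₁) (by simp [hp₁]) (fun k => (d₁ k).mul_left _)
  have p₂3 : p₂ 3 = 0 := by rw [r₂3]; simp [hp₁]
  have p₂2 : p₂ 2 = 0 := by rw [r₂2 (by simp [hp₁])]; simp [hp₁]
  have p₂1 : p₂ 1 = PowerSeries.C (PowerSeries.coeff 3 S₁) * PowerSeries.X ^ (N + 5) := by
    rw [r₂1 (by simp [hp₁]) (by simp [hp₁])]
    have := coeff_mul S₁ 1 3 (N + 3)
    rw [map_one, one_mul, one_mul, show 3 + (N + 3) = N + 5 + 1 by ring] at this
    simp [hp₁, this]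
  obtain ⟨p₃, a₃, d₃, r₃3, r₃2, -⟩ := exists_xi_solution μ (n := N + 6) (N := N + 1) (by omega)
    (S₂ • p₂) (by simp [p₂3]) (fun k => (d₂ k).mul_left _)
  have p₃3 : p₃ 3 = 0 := by rw [r₃3]; simp [p₂2]
  have p₃2 : p₃ 2 = PowerSeries.C (PowerSeries.coeff 3 S₁ * PowerSeries.coeff 2 S₂) *
      PowerSeries.X ^ (N + 6) := by
    rw [r₃2 (by simp [p₂2]), Pi.smul_apply, p₂1, smul_eq_mul,
      show N + 6 + 1 = 2 + (N + 5) by ring, coeff_mul]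
  obtain ⟨p₄, a₄, -, r₄3, -, -⟩ := exists_xi_solution μ (n := N + 7) (N := N) (by omega)
    (S₃ • p₃) (by simp [p₃3]) (fun k => (d₃ k).mul_left _)
  have p₄3 : p₄ 3 = PowerSeries.C (PowerSeries.coeff 3 S₁ * PowerSeries.coeff 2 S₂ *
      PowerSeries.coeff 2 S₃) * PowerSeries.X ^ (N + 7) := by
    rw [r₄3, Pi.smul_apply, p₃2, smul_eq_mul, show N + 7 + 1 = 2 + (N + 6) by ring, coeff_mul]
  refine ⟨Matrix.of fun i j => ![p₁, p₂, p₃, p₄] j i, ?_, ?_⟩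
  · ext1 i j
    have b₁ := congrFun a₁ i
    have b₂ := congrFun a₂ i
    have b₃ := congrFun a₃ i
    have b₄ := congrFun a₄ i
    have key : ∀ v : Fin 4 → R⟦X⟧, abAct (xiMatrix μ) v i = ∑ k, xiMatrix μ i k * v k +
      PowerSeries.X ^ 2 * PowerSeries.derivative R (v i) := fun v => rfl
    rw [key] at b₁ b₂ b₃ b₄
    simp only [Pi.add_apply, Pi.smul_apply, smul_eq_mul] at b₁ b₂ b₃ b₄
    have c2 : μ + ((N + 5 : ℕ) : R) = μ + ((N + 3 : ℕ) : R) + 2 := by push_cast; ring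
    have c3 : μ + ((N + 6 : ℕ) : R) = μ + ((N + 3 : ℕ) : R) + 3 := by push_cast; ring
    have c4 : μ + ((N + 7 : ℕ) : R) = μ + ((N + 3 : ℕ) : R) + 4 := by push_cast; ring
    rw [c2] at b₂
    rw [c3] at b₃
    rw [c4] at b₄
    rw [Matrix.add_apply, Matrix.mul_apply, Matrix.mul_apply, Matrix.map_apply]
    fin_cases j
    · refine b₁.trans ?_
      simp [themeMatrix, Fin.sum_univ_four]
      ring
    · refine b₂.trans ?_
      simp [themeMatrix, Fin.sum_univ_four]
      ring
    · refine b₃.trans ?_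
      simp [themeMatrix, Fin.sum_univ_four]
      ring
    · refine b₄.trans ?_
      simp [themeMatrix, Fin.sum_univ_four]
      ring
  · rw [Matrix.det_of_isUpperTriangular]
    · simp only [Fin.prod_univ_four, Matrix.of_apply]
      change p₁ 0 * p₂ 1 * p₃ 2 * p₄ 3 = _
      rw [p₂1, p₃2, p₄3]
      simp only [hp₁, Matrix.cons_val_zero, map_mul, map_pow]
      ring
    · intro i j hij
      fin_cases i <;> fin_cases j <;>
        first
        | exact absurd hij (by decide)
        | exact p₂2
        | exact p₂3
        | exact p₃3
        | rfl

end Xi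

/-! ### Modules generated by the iterates of one vector. -/

section Generator

variable {A N : Type*} [CommRing A] [AddCommGroup N] [Module A N]

/-- A generator of a theme and a triangular basis: the first iterates of the generator span
the theme. -/
theorem span_iterates_eq (a : N →+ N) (D : A → A)
    (ha : ∀ (s : A) (v : N), a (s • v) = s • a v + D s • v)
    {e : Fin 4 → N} {φ : N} {l : Fin 4 → A} {u₁ u₂ u₃ u₄ : A} (h₁ : IsUnit u₁) (h₂ : IsUnit u₂)
    (h₃ : IsUnit u₃) (h₄ : IsUnit u₄) (eφ : φ = u₄ • e 3) (e₃ : a (e 3) = l 3 • e 3 + u₃ • e 2)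
    (e₂ : a (e 2) = l 2 • e 2 + u₂ • e 1) (e₁ : a (e 1) = l 1 • e 1 + u₁ • e 0)
    (e₀ : a (e 0) = l 0 • e 0) :
    Submodule.span A (Set.range fun i : Fin 4 => a^[i] φ) = Submodule.span A (Set.range e) ∧
      ∀ n, a^[n] φ ∈ Submodule.span A (Set.range e) := by
  -- `J n` is spanned by the first `n` iterates, and `a` maps it to `J (n + 1)`. As the `u` are
  -- units, each relation puts the next lower basis vector in the next `J`.
  set J : ℕ → Submodule A N := fun n => Submodule.span A ((fun i => a^[i] φ) '' Set.Iio n) with hJ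
  have hJmono : ∀ n, J n ≤ J (n + 1) := fun n =>
    Submodule.span_mono (Set.image_mono (Set.Iio_subset_Iio n.le_succ))
  have hJa : ∀ n v, v ∈ J n → a v ∈ J (n + 1) := by
    intro n v hv
    induction hv using Submodule.span_induction with
    | mem x hx =>
      obtain ⟨i, hi, rfl⟩ := hx
      exact Submodule.subset_span ⟨i + 1, Nat.succ_lt_succ hi, Function.iterate_succ_apply' _ _ _⟩
    | zero => rw [map_zero]; exact zero_mem _
    | add x y _ _ hx hy => rw [map_add]; exact add_mem hx hy
    | smul s x hx' hx =>
      rw [ha]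
      exact add_mem (Submodule.smul_mem _ _ hx) (Submodule.smul_mem _ _ (hJmono n hx'))
  have unit_mem : ∀ {u : A} {v : N} {n : ℕ}, IsUnit u → u • v ∈ J n → v ∈ J n :=
    fun hu h => (Submodule.smul_mem_iff_of_isUnit _ hu).1 h
  have m₃ : e 3 ∈ J 1 := unit_mem h₄ (by
    rw [← eφ]; exact Submodule.subset_span ⟨0, Nat.one_pos, rfl⟩)
  have step : ∀ {u s : A} {v w : N} {n : ℕ}, IsUnit u → a v = s • v + u • w → v ∈ J n →
      w ∈ J (n + 1) := fun {u s v w n} hu h hv => unit_mem hu (by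
    have : u • w = a v - s • v := by rw [h]; abel
    rw [this]
    exact sub_mem (hJa n v hv) (Submodule.smul_mem _ _ (hJmono n hv)))
  have m₂ : e 2 ∈ J 2 := step h₃ e₃ m₃
  have m₁ : e 1 ∈ J 3 := step h₂ e₂ m₂
  have m₀ : e 0 ∈ J 4 := step h₁ e₁ m₁
  have hJ4 : J 4 = Submodule.span A (Set.range fun i : Fin 4 => a^[i] φ) := by
    refine congrArg (Submodule.span A) (Set.ext fun v => ⟨?_, ?_⟩)
    · rintro ⟨i, hi, rfl⟩
      exact ⟨⟨i, hi⟩, rfl⟩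
    · rintro ⟨i, rfl⟩
      exact ⟨i, i.2, rfl⟩
  have hs : ∀ i, e i ∈ Submodule.span A (Set.range e) := fun i => Submodule.subset_span ⟨i, rfl⟩
  have hstab : ∀ v ∈ Submodule.span A (Set.range e), a v ∈ Submodule.span A (Set.range e) := by
    intro v hv
    induction hv using Submodule.span_induction with
    | mem x hx =>
      obtain ⟨i, rfl⟩ := hx
      fin_cases i
      · exact e₀ ▸ Submodule.smul_mem _ _ (hs 0)
      · exact e₁ ▸ add_mem (Submodule.smul_mem _ _ (hs 1)) (Submodule.smul_mem _ _ (hs 0))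
      · exact e₂ ▸ add_mem (Submodule.smul_mem _ _ (hs 2)) (Submodule.smul_mem _ _ (hs 1))
      · exact e₃ ▸ add_mem (Submodule.smul_mem _ _ (hs 3)) (Submodule.smul_mem _ _ (hs 2))
    | zero => rw [map_zero]; exact zero_mem _
    | add x y _ _ hx hy => rw [map_add]; exact add_mem hx hy
    | smul s x hx' hx =>
      rw [ha]
      exact add_mem (Submodule.smul_mem _ _ hx) (Submodule.smul_mem _ _ hx')
  have hit : ∀ n : ℕ, a^[n] φ ∈ Submodule.span A (Set.range e) := by
    intro n
    induction n with
    | zero => exact eφ ▸ Submodule.smul_mem _ _ (hs 3)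
    | succ n ih => rw [Function.iterate_succ_apply']; exact hstab _ ih
  refine ⟨le_antisymm (Submodule.span_le.2 ?_) (Submodule.span_le.2 ?_), hit⟩
  · rintro _ ⟨i, rfl⟩
    exact hit i
  · rw [← hJ4]
    rintro _ ⟨i, rfl⟩
    fin_cases i
    · exact m₀
    · exact hJmono _ m₁
    · exact hJmono _ (hJmono _ m₂)
    · exact hJmono _ (hJmono _ (hJmono _ m₃))

end Generator

/-! ### Thematic maps from a holomorphic triangular basis. -/

section Families

/-- `abAct` as an additive map. -/
def abHom {R : Type*} [CommRing R] {k : ℕ} (M : Matrix (Fin k) (Fin k) R⟦X⟧) :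
    (Fin k → R⟦X⟧) →+ (Fin k → R⟦X⟧) :=
  AddMonoidHom.mk' (abAct M) (abAct_add M)

theorem abHom_apply {R : Type*} [CommRing R] {k : ℕ} (M : Matrix (Fin k) (Fin k) R⟦X⟧)
    (v : Fin k → R⟦X⟧) : abHom M v = abAct M v := rfl

theorem span_iterates_abHom_eq {R : Type*} [CommRing R] {k : ℕ} {M : Matrix (Fin k) (Fin k) R⟦X⟧}
    {e : Fin 4 → Fin k → R⟦X⟧} {φ : Fin k → R⟦X⟧} {l : Fin 4 → R⟦X⟧} {u₁ u₂ u₃ u₄ : R⟦X⟧}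
    (h₁ : IsUnit u₁) (h₂ : IsUnit u₂) (h₃ : IsUnit u₃) (h₄ : IsUnit u₄) (eφ : φ = u₄ • e 3)
    (e₃ : abAct M (e 3) = l 3 • e 3 + u₃ • e 2) (e₂ : abAct M (e 2) = l 2 • e 2 + u₂ • e 1)
    (e₁ : abAct M (e 1) = l 1 • e 1 + u₁ • e 0) (e₀ : abAct M (e 0) = l 0 • e 0) :
    Submodule.span R⟦X⟧ (Set.range fun i : Fin 4 => (abHom M)^[i] φ) =
      Submodule.span R⟦X⟧ (Set.range e) ∧
      ∀ n, (abHom M)^[n] φ ∈ Submodule.span R⟦X⟧ (Set.range e) :=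
  span_iterates_eq (abHom M) (fun S => PowerSeries.X ^ 2 * PowerSeries.derivative R S)
    (abAct_smul M) h₁ h₂ h₃ h₄ eφ e₃ e₂ e₁ e₀

variable {Y : ReducedComplexSpace} {U : Set Y}

namespace holRing

/-- Evaluation at a point of a column vector. -/
def evV {k : ℕ} (u : U) (v : Fin k → (holRing Y U)⟦X⟧) : Fin k → ℂ⟦X⟧ := fun i => evS u (v i)

theorem evV_abAct {k : ℕ} (u : U) (M : Matrix (Fin k) (Fin k) (holRing Y U)⟦X⟧)
    (v : Fin k → (holRing Y U)⟦X⟧) : evV u (abAct M v) = abAct (M.map (evS u)) (evV u v) := by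
  ext1 i
  simp only [evV, abAct, Pi.add_apply, map_add, Matrix.mulVec, dotProduct, map_sum, map_mul,
    Matrix.map_apply, map_pow, evS_X, evS_derivative]

theorem evV_smul {k : ℕ} (u : U) (S : (holRing Y U)⟦X⟧) (v : Fin k → (holRing Y U)⟦X⟧) :
    evV u (S • v) = evS u S • evV u v := by
  ext1 i; simp [evV]

theorem evV_add {k : ℕ} (u : U) (v w : Fin k → (holRing Y U)⟦X⟧) :
    evV u (v + w) = evV u v + evV u w := by
  ext1 i; simp [evV]

theorem evV_sum {k n : ℕ} (u : U) (w : Fin n → Fin k → (holRing Y U)⟦X⟧) :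
    evV u (∑ i, w i) = ∑ i, evV u (w i) := by
  ext1 i; simp [evV]

theorem evV_iterate {k : ℕ} (u : U) (M : Matrix (Fin k) (Fin k) (holRing Y U)⟦X⟧)
    (v : Fin k → (holRing Y U)⟦X⟧) (n : ℕ) :
    evV u ((abHom M)^[n] v) = (abHom (M.map (evS u)))^[n] (evV u v) := by
  induction n with
  | zero => rfl
  | succ n ih =>
    rw [Function.iterate_succ_apply', Function.iterate_succ_apply', ← ih]
    exact evV_abAct u M _

theorem map_themeMatrix_evS (l : ℂ) (S₁ S₂ S₃ : (holRing Y U)⟦X⟧) (u : U) :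
    (themeMatrix (algebraMap ℂ (holRing Y U) l) S₁ S₂ S₃).map (evS u) =
      themeMatrix l (evS u S₁) (evS u S₂) (evS u S₃) := themeMatrix_map _ _ _ _ _

theorem map_xiMatrix_evS (μ : ℂ) (u : U) :
    (xiMatrix (algebraMap ℂ (holRing Y U) μ)).map (evS u) = xiMatrix μ := xiMatrix_map _ _

theorem evS_cubicSeries (δ ε θ : holRing Y U) (u : U) :
    evS u (cubicSeries δ ε θ) = cubicSeries (ev u δ) (ev u ε) (ev u θ) := cubicSeries_map _ _ _ _

end holRing

open holRing

theorem iterates_eq_evV {μ : ℚ} {φ : Y → Xi μ 3} {φR : Fin 4 → (holRing Y U)⟦X⟧} {u : U}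
    (hφ : φ u = evV u φR) (n : ℕ) :
    (Xi μ 3).a^[n] (φ u) =
      evV u ((abHom (xiMatrix (algebraMap ℂ (holRing Y U) μ)))^[n] φR) := by
  rw [evV_iterate, map_xiMatrix_evS, hφ]
  rfl

theorem holCombOn_iterates (hU : IsOpen U) {μ : ℚ} {φ : Y → Xi μ 3}
    {φR : Fin 4 → (holRing Y U)⟦X⟧} (hφ : ∀ u : U, φ u = evV u φR)
    {x : Fin 4 → (holRing Y U)⟦X⟧} (hx : x ∈ Submodule.span (holRing Y U)⟦X⟧
      (Set.range fun i : Fin 4 => (abHom (xiMatrix (algebraMap ℂ (holRing Y U) μ)))^[i] φR))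
    {s : ∀ _ : Y, Xi μ 3} (hs : ∀ u : U, s u = evV u x) :
    HolCombOn (M := fun _ => Xi μ 3) U (iterates (3 + 1) φ) s := by
  obtain ⟨T, hT⟩ := (Submodule.mem_span_range_iff_exists_fun _).1 hx
  refine (holCombOn_iff hU).2 ⟨T, fun u => ?_⟩
  rw [hs, ← hT, evV_sum]
  refine Finset.sum_congr rfl fun i _ => ?_
  rw [evV_smul, ← iterates_eq_evV (hφ u)]
  rfl

theorem hasInvariants_themeMatrix (lam1 : ℚ) (S₁ S₂ S₃ : ℂ⟦X⟧) :
    HasInvariants (r := 3) lam1 ![3, 2, 2]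
      (ABModule.ofMatrix (themeMatrix (lam1 : ℂ) S₁ S₂ S₃)) := by
  have h0 : exponent (r := 3) lam1 ![3, 2, 2] 0 = lam1 := by
    simp [exponent]
  have h1 : exponent (r := 3) lam1 ![3, 2, 2] 1 = lam1 + 2 := by
    simp [exponent]; norm_num
  have h2 : exponent (r := 3) lam1 ![3, 2, 2] 2 = lam1 + 3 := by
    simp [exponent, Fin.sum_univ_three]; norm_num
  have h3 : exponent (r := 3) lam1 ![3, 2, 2] 3 = lam1 + 4 := by
    simp [exponent, Fin.sum_univ_three]; norm_num
  set M := themeMatrix (lam1 : ℂ) S₁ S₂ S₃ with hM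
  let f : Fin 4 → ABModule.ofMatrix M := fun j => Pi.basisFun ℂ⟦X⟧ (Fin 4) j
  have key : ∀ (j : Fin 4) (q : ℚ) (v : Fin 4 → ℂ⟦X⟧), exponent (r := 3) lam1 ![3, 2, 2] j = q →
      v ∈ Submodule.span ℂ⟦X⟧ (Pi.basisFun ℂ⟦X⟧ (Fin 4) '' {i | i < j}) →
      (fun i => M i j) = (PowerSeries.C (q : ℂ) * PowerSeries.X) • Pi.basisFun ℂ⟦X⟧ (Fin 4) j + v →
      (ABModule.ofMatrix M).a (f j) -
        (PowerSeries.C (exponent (r := 3) lam1 ![3, 2, 2] j : ℂ) * PowerSeries.X) • f j ∈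
        Submodule.span ℂ⟦X⟧ (f '' {i | i < j}) := by
    rintro j q v rfl hv hq
    have hcol : (ABModule.ofMatrix M).a (f j) = fun i => M i j := by
      refine (ABModule.ofMatrix_a_basisFun M j).trans ?_
      change (∑ i, M i j • Pi.basisFun ℂ⟦X⟧ (Fin 4) i : Fin 4 → ℂ⟦X⟧) = _
      ext1 i
      simp [Finset.sum_apply, Pi.single_apply]
    rw [hcol]
    refine (congrArg (· ∈ Submodule.span ℂ⟦X⟧ (f '' {i | i < j})) ?_).mpr hv
    exact sub_eq_of_eq_add' hq
  refine ⟨Pi.basisFun ℂ⟦X⟧ (Fin 4), fun j => ?_⟩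
  have hmem : ∀ {i j : Fin 4} (S : ℂ⟦X⟧), i < j → S • Pi.basisFun ℂ⟦X⟧ (Fin 4) i ∈
      Submodule.span ℂ⟦X⟧ (Pi.basisFun ℂ⟦X⟧ (Fin 4) '' {i | i < j}) := fun S h =>
    Submodule.smul_mem _ _ (Submodule.subset_span ⟨_, h, rfl⟩)
  fin_cases j
  · refine key 0 _ 0 h0 (zero_mem _) ?_
    ext1 i
    fin_cases i <;> simp [hM, themeMatrix]
  · refine key 1 _ _ h1 (hmem (i := 0) S₁ (by decide)) ?_
    ext1 i
    fin_cases i <;> simp [hM, themeMatrix]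
  · refine key 2 _ _ h2 (hmem (i := 1) S₂ (by decide)) ?_
    ext1 i
    fin_cases i <;> simp [hM, themeMatrix]
  · refine key 3 _ _ h3 (hmem (i := 2) S₃ (by decide)) ?_
    ext1 i
    fin_cases i <;> simp [hM, themeMatrix]

/-- This uses `3 < lam1`: three powers of `b` are needed to build the last three columns in `Ξ` from
the first. -/
theorem exists_residue_add {lam1 : ℚ} (h : 3 < lam1) :
    ∃ N : ℕ, lam1 = residue lam1 + (N + 3 : ℕ) := by
  have h4 : 4 ≤ ⌈lam1⌉ := by
    have : (3 : ℤ) < ⌈lam1⌉ := Int.lt_ceil.2 (by exact_mod_cast h)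
    omega
  refine ⟨(⌈lam1⌉ - 4).toNat, ?_⟩
  have : (((⌈lam1⌉ - 4).toNat : ℤ) : ℚ) = ⌈lam1⌉ - 4 := by
    rw [Int.toNat_of_nonneg (by omega)]; push_cast; ring
  rw [Int.cast_natCast] at this
  push_cast
  rw [this, residue]
  ring

theorem linearIndependent_col {P : Matrix (Fin 4) (Fin 4) ℂ⟦X⟧} (h : P.det ≠ 0) :
    LinearIndependent ℂ⟦X⟧ (fun j i => P i j : Fin 4 → Fin 4 → ℂ⟦X⟧) :=
  Matrix.linearIndependent_cols_of_det_ne_zero h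

/-- A thematic map and a triangular basis of the corresponding (a,b)-modules. -/
theorem isThematicOn_of_basis (hU : IsOpen U) {μ : ℚ} {φ : Y → Xi μ 3}
    {φR : Fin 4 → (holRing Y U)⟦X⟧} (hφ : ∀ u : U, φ u = evV u φR)
    {e : Fin 4 → Fin 4 → (holRing Y U)⟦X⟧} {l : Fin 4 → (holRing Y U)⟦X⟧}
    {u₁ u₂ u₃ u₄ : (holRing Y U)⟦X⟧} (h₁ : IsUnit u₁) (h₂ : IsUnit u₂)
    (h₃ : IsUnit u₃) (h₄ : IsUnit u₄) (eφ : φR = u₄ • e 3)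
    (e₃ : abAct (xiMatrix (algebraMap ℂ (holRing Y U) μ)) (e 3) = l 3 • e 3 + u₃ • e 2)
    (e₂ : abAct (xiMatrix (algebraMap ℂ (holRing Y U) μ)) (e 2) = l 2 • e 2 + u₂ • e 1)
    (e₁ : abAct (xiMatrix (algebraMap ℂ (holRing Y U) μ)) (e 1) = l 1 • e 1 + u₁ • e 0)
    (e₀ : abAct (xiMatrix (algebraMap ℂ (holRing Y U) μ)) (e 0) = l 0 • e 0)
    (hli : ∀ u : U, LinearIndependent ℂ⟦X⟧ (fun j => evV u (e j))) :
    (∀ u : U, LinearIndependent ℂ⟦X⟧ (iterates (3 + 1) φ u)) ∧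
    HolCombOn (M := fun _ => Xi μ 3) U (iterates (3 + 1) φ)
      (fun y => (Xi μ 3).a^[3 + 1] (φ y)) ∧
    (∀ u : U, Submodule.span ℂ⟦X⟧ (Set.range (iterates (3 + 1) φ u)) =
      Submodule.span ℂ⟦X⟧ (Set.range fun j => (evV u (e j) : Xi μ 3))) ∧
    ∀ x ∈ Submodule.span (holRing Y U)⟦X⟧ (Set.range e), ∀ s : ∀ _ : Y, Xi μ 3,
      (∀ u : U, s u = evV u x) →
      HolCombOn (M := fun _ => Xi μ 3) U (iterates (3 + 1) φ) s := by
  obtain ⟨hR, hRn⟩ := span_iterates_abHom_eq h₁ h₂ h₃ h₄ eφ e₃ e₂ e₁ e₀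
  have hspan : ∀ u : U, Submodule.span ℂ⟦X⟧ (Set.range (iterates (3 + 1) φ u)) =
      Submodule.span ℂ⟦X⟧ (Set.range fun j => (evV u (e j) : Xi μ 3)) := by
    intro u
    have ev : ∀ {v w : Fin 4 → (holRing Y U)⟦X⟧},
        abAct (xiMatrix (algebraMap ℂ (holRing Y U) μ)) v = w →
        abAct (xiMatrix (μ : ℂ)) (evV u v) = evV u w := fun {v w} h => by
      rw [← h, evV_abAct, map_xiMatrix_evS]
    refine (span_iterates_eq (A := ℂ⟦X⟧) (N := Xi μ 3) (Xi μ 3).a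
      (fun S => PowerSeries.X ^ 2 * PowerSeries.derivative ℂ S) (Xi μ 3).a_smul
      (e := fun j => evV u (e j)) (l := fun j => evS u (l j))
      (h₁.map (evS u)) (h₂.map (evS u)) (h₃.map (evS u)) (h₄.map (evS u)) ?_ ?_ ?_ ?_ ?_).1
    · rw [hφ, eφ, evV_smul]; rfl
    · refine (ev e₃).trans ?_
      rw [evV_add, evV_smul, evV_smul]; rfl
    · refine (ev e₂).trans ?_
      rw [evV_add, evV_smul, evV_smul]; rfl
    · refine (ev e₁).trans ?_
      rw [evV_add, evV_smul, evV_smul]; rfl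
    · refine (ev e₀).trans ?_
      rw [evV_smul]; rfl
  refine ⟨fun u => ?_, ?_, hspan, fun x hx s hs => ?_⟩
  -- Four vectors spanning a module of rank four are independent.
  · rw [linearIndependent_iff_card_eq_finrank_span, Set.finrank, hspan u]
    exact (finrank_span_eq_card (hli u)).symm
  · exact holCombOn_iterates hU hφ (hR ▸ hRn 4) fun u => iterates_eq_evV (hφ u) 4
  · exact holCombOn_iterates hU hφ (hR ▸ hx) hs

end Families

/-! ### The themes `E(g(y))` form a holomorphic family. -/

section Families

open holRing

variable {Y : ReducedComplexSpace}

theorem isUnit_of_coeff_zero {R : Type*} [CommRing R] {S : R⟦X⟧} (h : PowerSeries.coeff 0 S = 1) :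
    IsUnit S := by
  rw [PowerSeries.isUnit_iff_constantCoeff, ← PowerSeries.coeff_zero_eq_constantCoeff_apply, h]
  exact isUnit_one

/-- The canonical matrix over `holRing` defined by a holomorphic map to the parameter space. -/
def canonicalMatrixR (lam1 : ℚ) {U : Set Y} (σ : Fin 6 → holRing Y U) :
    Matrix (Fin 4) (Fin 4) (holRing Y U)⟦X⟧ :=
  themeMatrix (algebraMap ℂ (holRing Y U) lam1) (cubicSeries (σ 3) (σ 4) (σ 5))
    (cubicSeries (σ 1) (σ 2) 0) (cubicSeries 0 (σ 0) 0)

theorem canonicalMatrixR_map (lam1 : ℚ) {U : Set Y} (σ : Fin 6 → holRing Y U) (u : U) :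
    (canonicalMatrixR lam1 σ).map (evS u) = canonicalMatrix lam1 fun i => ev u (σ i) := by
  rw [canonicalMatrixR, map_themeMatrix_evS, evS_cubicSeries, evS_cubicSeries, evS_cubicSeries,
    canonicalMatrix_eq, map_zero]

/-- The family of the `E(g(y))` for a holomorphic map `g` to the parameter space. -/
theorem isThemeFamily_ofMatrix {lam1 : ℚ} (hlam1 : 3 < lam1) {g : Y → Fin 6 → ℂ}
    (hg : ∀ i, HolOn (fun y => g y i) Set.univ) (hp : ∀ y, g y ∈ paramSpace)
    (hM : ∀ i j, SeriesHolOn (fun y => canonicalMatrix lam1 (g y) i j) Set.univ) :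
    IsThemeFamily (r := 3) lam1 ![3, 2, 2]
      (ABFamily.ofMatrix Y (fun y => canonicalMatrix lam1 (g y)) hM) := by
  constructor
  · intro y
    change HasInvariants (r := 3) lam1 ![3, 2, 2] (ABModule.ofMatrix (canonicalMatrix lam1 (g y)))
    rw [canonicalMatrix_eq]
    exact hasInvariants_themeMatrix lam1 _ _ _
  obtain ⟨N, hN⟩ := exists_residue_add hlam1
  set σ : Fin 6 → holRing Y Set.univ := fun i => mk _ (hg i) with hσ
  obtain ⟨P, hP, hdet⟩ := exists_xi_embedding (algebraMap ℂ (holRing Y Set.univ) (residue lam1 : ℂ))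
    N (cubicSeries (σ 3) (σ 4) (σ 5)) (cubicSeries (σ 1) (σ 2) 0) (cubicSeries 0 (σ 0) 0)
  have hl : algebraMap ℂ (holRing Y Set.univ) (residue lam1 : ℂ) +
      ((N + 3 : ℕ) : holRing Y Set.univ) =
      algebraMap ℂ (holRing Y Set.univ) (lam1 : ℂ) := by
    have h : (lam1 : ℂ) = (residue lam1 : ℂ) + (N + 3 : ℕ) := by
      exact_mod_cast congrArg (Rat.cast (K := ℂ)) hN
    rw [h, map_add, map_natCast]
  rw [hl] at hP
  have hP' : ∀ y, Intertwines (xiMatrix (residue lam1 : ℂ)) (canonicalMatrix lam1 (g y))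
      (P.map (evS ⟨y, Set.mem_univ y⟩)) := fun y => by
    have h1 := hP.map (ev (⟨y, Set.mem_univ y⟩ : (Set.univ : Set Y)) : holRing Y Set.univ →+* ℂ)
    have h2 := canonicalMatrixR_map lam1 σ ⟨y, Set.mem_univ y⟩
    have h3 := map_xiMatrix_evS (U := Set.univ) (residue lam1 : ℂ) ⟨y, Set.mem_univ y⟩
    rw [← show _ = canonicalMatrix lam1 (g y) from h2, ← h3]
    exact h1
  -- Up to a power of `b` the determinant is `θ³ γ² α`, so nonvanishing of `α γ θ` makes the map to
  -- `Ξ` injective in every fibre.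
  have hdet' : ∀ y, (P.map (evS ⟨y, Set.mem_univ y⟩)).det ≠ 0 := fun y => by
    have h1 := hp y
    simp only [paramSpace, Set.mem_ofPred_eq, mul_ne_zero_iff] at h1
    have h2 := RingHom.map_det (evS (⟨y, Set.mem_univ y⟩ : (Set.univ : Set Y))) P
    rw [hdet, map_mul, map_pow, evS_X, evS_C, (coeff_cubicSeries _ _ _).2.2.2,
      (coeff_cubicSeries _ _ _).2.2.1, (coeff_cubicSeries _ _ _).2.2.1] at h2
    rw [← RingHom.mapMatrix_apply, ← h2]
    refine mul_ne_zero ?_ (pow_ne_zero _ PowerSeries.X_ne_zero)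
    rw [map_ne_zero_iff _ PowerSeries.C_injective]
    simp only [hσ, map_mul, map_pow, ev_mk]
    exact mul_ne_zero (mul_ne_zero (pow_ne_zero _ h1.2) (pow_ne_zero _ h1.1.2)) h1.1.1
  have hcol : ∀ j, abAct (xiMatrix (algebraMap ℂ (holRing Y Set.univ) (residue lam1 : ℂ)))
      (fun i => P i j) = fun i => (P * canonicalMatrixR lam1 σ) i j := fun j => by
    ext1 i
    exact congrFun (congrFun hP i) j
  intro y₀
  -- The thematic map is the last column: the last basis vector generates the theme.
  refine ⟨Set.univ, isOpen_univ, Set.mem_univ _, fun y i => toS (P i 3) y, ?_⟩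
  have hφ : ∀ u : (Set.univ : Set Y), (fun i => toS (P i 3) u.1) =
      evV u fun i => P i 3 := fun u => by
    ext1 i
    rw [toS_apply _ u.2]; rfl
  obtain ⟨r₁, r₂, r₃, r₄⟩ := isThematicOn_of_basis (μ := residue lam1)
    (φ := fun y i => toS (P i 3) y) isOpen_univ hφ
    (e := fun j i => P i j) (l := fun j => canonicalMatrixR lam1 σ j j)
    (u₁ := cubicSeries (σ 3) (σ 4) (σ 5)) (u₂ := cubicSeries (σ 1) (σ 2) 0)
    (u₃ := cubicSeries 0 (σ 0) 0) (u₄ := 1) (isUnit_of_coeff_zero (coeff_cubicSeries _ _ _).1)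
    (isUnit_of_coeff_zero (coeff_cubicSeries _ _ _).1)
    (isUnit_of_coeff_zero (coeff_cubicSeries _ _ _).1) isUnit_one (one_smul _ _).symm
    ((hcol 3).trans (by
      ext1 i
      simp [canonicalMatrixR, themeMatrix, Matrix.mul_apply, Fin.sum_univ_four]
      ring))
    ((hcol 2).trans (by
      ext1 i
      simp [canonicalMatrixR, themeMatrix, Matrix.mul_apply, Fin.sum_univ_four]
      ring))
    ((hcol 1).trans (by
      ext1 i
      simp [canonicalMatrixR, themeMatrix, Matrix.mul_apply, Fin.sum_univ_four]
      ring))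
    ((hcol 0).trans (by
      ext1 i
      simp [canonicalMatrixR, themeMatrix, Matrix.mul_apply, Fin.sum_univ_four]
      ring))
    (fun u => linearIndependent_col (hdet' u))
  refine ⟨⟨fun j => seriesHolOn_toS isOpen_univ _, fun y _ => r₁ ⟨y, trivial⟩, r₂⟩,
    fun y => (P.map (evS ⟨y, Set.mem_univ y⟩)).mulVecLin, fun y _ => ⟨?_, ?_, ?_⟩, ?_⟩
  · exact Matrix.mulVec_injective_of_det_ne_zero (hdet' y)
  · exact fun v => ((hP' y).abAct_mulVec v).symm
  · exact (Matrix.range_mulVecLin _).trans (r₃ ⟨y, trivial⟩).symm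
  · rintro h rfl (j : Fin 4)
    refine HolCombOn.mono (r₄ (fun i => P i j) (Submodule.subset_span ⟨j, rfl⟩) _ fun u => ?_)
      Set.inter_subset_left
    exact (congrArg (P.map (evS u)).mulVec (Pi.basisFun_apply ℂ⟦X⟧ (Fin 4) j)).trans
      (Matrix.mulVec_single_one _ _)

end Families

/-! ### Triangular bases of a single theme inside `Ξ`. -/

section Pointwise

/-- The kernel element `u` is a multiple of `b^n`, so `b u` sits in the one degree that `eulerOp n`
cannot reach. -/
theorem eulerOp_chain {n : ℕ} {u v : ℂ⟦X⟧} (hu : eulerOp n u = 0)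
    (h : PowerSeries.X * u + eulerOp n v = 0) : u = 0 ∧ eulerOp n v = 0 := by
  have hu' := eq_monomial_of_eulerOp hu
  have := congrArg (PowerSeries.coeff (n + 1)) h
  rw [map_add, PowerSeries.coeff_succ_X_mul, coeff_succ_eulerOp, sub_self, zero_mul, add_zero,
    map_zero] at this
  have h0 : u = 0 := by rw [hu', this]; simp
  exact ⟨h0, by rwa [h0, mul_zero, zero_add] at h⟩

/-- A triangular solution in `Ξ`. -/
theorem xi_solution_triangular {μ : ℂ} {n : ℕ} {v w : Fin 4 → ℂ⟦X⟧} (j : Fin 4)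
    (h : abAct (xiMatrix μ) v = (PowerSeries.C (μ + n) * PowerSeries.X) • v + w)
    (hw : ∀ k, j ≤ k → w k = 0) :
    (∀ k, j < k → v k = 0) ∧ ∃ κ, v j = PowerSeries.C κ * PowerSeries.X ^ n := by
  rw [abAct_xiMatrix μ v n] at h
  have h' := add_left_cancel h
  have e0 := congrFun h' 0
  have e1 := congrFun h' 1
  have e2 := congrFun h' 2
  have e3 := congrFun h' 3
  simp only [Matrix.cons_val] at e0 e1 e2 e3
  rw [hw 3 (Fin.le_last j)] at e3
  have fin : ∀ i j : Fin 4, (∀ k, j < k → v k = 0) → eulerOp n (v j) = 0 →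
      (∀ k, j < k → v k = 0) ∧ ∃ κ, v j = PowerSeries.C κ * PowerSeries.X ^ n :=
    fun _ j h1 h2 => ⟨h1, _, eq_monomial_of_eulerOp h2⟩
  by_cases j3 : j = 3
  · subst j3
    exact fin 0 3 (fun k hk => absurd hk (not_lt.2 (Fin.le_last k))) e3
  have l2 : j ≤ 2 := by omega
  rw [hw 2 l2] at e2
  obtain ⟨z3, e2⟩ := eulerOp_chain e3 e2
  by_cases j2 : j = 2
  · subst j2
    refine fin 0 2 (fun k hk => ?_) e2
    obtain rfl : k = 3 := by omega
    exact z3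
  have l1 : j ≤ 1 := by omega
  rw [hw 1 l1] at e1
  obtain ⟨z2, e1⟩ := eulerOp_chain e2 e1
  by_cases j1 : j = 1
  · subst j1
    refine fin 0 1 (fun k hk => ?_) e1
    obtain rfl | rfl : k = 2 ∨ k = 3 := by omega
    · exact z2
    · exact z3
  obtain rfl : j = 0 := by omega
  rw [hw 0 le_rfl] at e0
  obtain ⟨z1, e0⟩ := eulerOp_chain e1 e0
  refine fin 0 0 (fun k hk => ?_) e0
  obtain rfl | rfl | rfl : k = 1 ∨ k = 2 ∨ k = 3 := by omega
  · exact z1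
  · exact z2
  · exact z3

/-- The columns of `P` are a triangular basis of a theme in `Ξ`, on which `a` acts by `T`. -/
structure IsTriangularBasis (μ : ℂ) (n : Fin 4 → ℕ) (P T : Matrix (Fin 4) (Fin 4) ℂ⟦X⟧) :
    Prop where
  intertwines : Intertwines (xiMatrix μ) T P
  lower : ∀ i j, j < i → P i j = 0
  diag : ∀ j, ∃ κ, κ ≠ 0 ∧ P j j = PowerSeries.C κ * PowerSeries.X ^ n j
  lower' : ∀ i j, j < i → T i j = 0
  diag' : ∀ j, T j j = PowerSeries.C (μ + n j) * PowerSeries.X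

/-- A filtration by exponents is automatically triangular for the logarithmic degree in `Ξ`: by
induction, the `j`-th vector solves an equation whose right-hand side has logarithmic degree less
than `j`, and resonance adds at most one. Independence makes the diagonal nonzero. -/
theorem exists_isTriangularBasis {μ : ℂ} {n : Fin 4 → ℕ} {v : Fin 4 → Fin 4 → ℂ⟦X⟧}
    (hv : LinearIndependent ℂ⟦X⟧ v)
    (h : ∀ j, abAct (xiMatrix μ) (v j) - (PowerSeries.C (μ + n j) * PowerSeries.X) • v j ∈
      Submodule.span ℂ⟦X⟧ (v '' {i | i < j})) :
    ∃ T, IsTriangularBasis μ n (Matrix.of fun i j => v j i) T := by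
  have hc : ∀ j, ∃ c : Fin 4 → ℂ⟦X⟧, (∀ i, j ≤ i → c i = 0) ∧ abAct (xiMatrix μ) (v j) =
      (PowerSeries.C (μ + n j) * PowerSeries.X) • v j + ∑ i, c i • v i := by
    intro j
    obtain ⟨l, hl, hl'⟩ := (Finsupp.mem_span_image_iff_linearCombination _).1 (h j)
    refine ⟨l, fun i hi => ?_, ?_⟩
    · by_contra h0
      exact absurd (hl (Finsupp.mem_support_iff.2 h0)) (not_lt.2 hi)
    · rw [Finsupp.linearCombination_apply,
        Finsupp.sum_fintype l (fun i a => a • v i) fun i => zero_smul _ _] at hl'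
      rw [hl']
      abel
  choose c hc0 hc using hc
  have tri : ∀ j, (∀ k, j < k → v j k = 0) ∧
      ∃ κ, v j j = PowerSeries.C κ * PowerSeries.X ^ n j := by
    intro j
    induction j using WellFoundedLT.induction with
    | _ j ih =>
      refine xi_solution_triangular j (hc j) fun k hk => ?_
      rw [Finset.sum_apply]
      refine Finset.sum_eq_zero fun i _ => ?_
      by_cases hi : i < j
      · simp [(ih i hi).1 k (hi.trans_le hk)]
      · simp [hc0 j i (not_lt.1 hi)]
  set P : Matrix (Fin 4) (Fin 4) ℂ⟦X⟧ := Matrix.of fun i j => v j i with hP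
  have hdet : P.det ≠ 0 := by
    intro h0
    obtain ⟨x, hx, hx'⟩ := Matrix.exists_mulVec_eq_zero_iff.2 h0
    refine hx (funext fun i => Fintype.linearIndependent_iff.1 hv x ?_ i)
    rw [← hx']
    ext1 i
    simp [Matrix.mulVec, dotProduct, hP, Finset.sum_apply, mul_comm]
  rw [Matrix.det_of_isUpperTriangular (M := P) (fun i j hij => (tri j).1 i hij)] at hdet
  refine ⟨Matrix.of fun i j => (if i = j then PowerSeries.C (μ + n j) * PowerSeries.X else 0) +
    c j i, ?_, fun i j hij => (tri j).1 i hij, fun j => ?_, fun i j hij => ?_, fun j => ?_⟩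
  · ext1 i j
    have := congrFun (hc j) i
    refine this.trans ?_
    simp [Matrix.mul_apply, hP, mul_add, Finset.sum_add_distrib, mul_comm]
  · obtain ⟨κ, hκ⟩ := (tri j).2
    refine ⟨κ, ?_, hκ⟩
    rintro rfl
    refine (Finset.prod_ne_zero_iff.1 hdet) j (Finset.mem_univ _) ?_
    rw [hP, Matrix.of_apply, hκ]
    simp
  · rw [Matrix.of_apply, if_neg hij.ne', hc0 j i hij.le, add_zero]
  · rw [Matrix.of_apply, if_pos rfl, hc0 j j le_rfl, add_zero]

theorem coeff_zero_abAct {k : ℕ} (T : Matrix (Fin k) (Fin k) ℂ⟦X⟧) (c : Fin k → ℂ⟦X⟧) (i : Fin k) :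
    PowerSeries.coeff 0 (abAct T c i) =
      ∑ j, PowerSeries.coeff 0 (T i j) * PowerSeries.coeff 0 (c j) := by
  simp [abAct, Matrix.mulVec, dotProduct]

theorem IsTriangularBasis.det_ne_zero {μ : ℂ} {n : Fin 4 → ℕ} {P T : Matrix (Fin 4) (Fin 4) ℂ⟦X⟧}
    (h : IsTriangularBasis μ n P T) : P.det ≠ 0 := by
  rw [Matrix.det_of_isUpperTriangular (M := P) (fun i j hij => h.lower i j hij)]
  refine Finset.prod_ne_zero_iff.2 fun j _ => ?_
  obtain ⟨κ, hκ, hP⟩ := h.diag j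
  rw [hP]
  exact mul_ne_zero ((map_ne_zero_iff _ PowerSeries.C_injective).2 hκ)
    (pow_ne_zero _ PowerSeries.X_ne_zero)

/-- If the theme is generated by `φ`, the entries of `T` above the diagonal are invertible. -/
theorem IsTriangularBasis.of_span {μ : ℂ} {n : Fin 4 → ℕ} {P T : Matrix (Fin 4) (Fin 4) ℂ⟦X⟧}
    (h : IsTriangularBasis μ n P T) {φ : Fin 4 → ℂ⟦X⟧}
    (hφ : Submodule.span ℂ⟦X⟧ (Set.range fun i : Fin 4 => (abHom (xiMatrix μ))^[i] φ) =
      Submodule.span ℂ⟦X⟧ (Set.range P.col)) :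
    ∃ c, φ = P.mulVec c ∧ PowerSeries.coeff 0 (T 0 1) ≠ 0 ∧ PowerSeries.coeff 0 (T 1 2) ≠ 0 ∧
      PowerSeries.coeff 0 (T 2 3) ≠ 0 ∧ PowerSeries.coeff 0 (c 3) ≠ 0 := by
  have hφ0 : φ ∈ Submodule.span ℂ⟦X⟧ (Set.range P.col) := by
    rw [← hφ]; exact Submodule.subset_span ⟨0, rfl⟩
  rw [← Matrix.range_mulVecLin] at hφ0 hφ
  obtain ⟨c, rfl⟩ := hφ0
  have hinj : Function.Injective P.mulVecLin := Matrix.mulVec_injective_of_det_ne_zero h.det_ne_zero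
  have hiter : ∀ m : ℕ, (abHom (xiMatrix μ))^[m] (P.mulVecLin c) =
      P.mulVecLin ((abHom T)^[m] c) := by
    intro m
    induction m with
    | zero => rfl
    | succ m ih =>
      rw [Function.iterate_succ_apply', Function.iterate_succ_apply', ih]
      exact h.intertwines.abAct_mulVec _
  -- The columns of `K` are the iterates in the coordinates of `P`. The iterates generate, so `K`
  -- has an inverse.
  set K : Matrix (Fin 4) (Fin 4) ℂ⟦X⟧ := Matrix.of fun i m => (abHom T)^[m] c i with hK
  have hB : ∀ j, ∃ B : Fin 4 → ℂ⟦X⟧, K.mulVec B = Pi.single j 1 := by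
    intro j
    have : P.mulVecLin (Pi.single j 1) ∈
        Submodule.span ℂ⟦X⟧ (Set.range fun i : Fin 4 =>
          (abHom (xiMatrix μ))^[i] (P.mulVecLin c)) := by
      rw [hφ]; exact ⟨_, rfl⟩
    obtain ⟨B, hB⟩ := (Submodule.mem_span_range_iff_exists_fun _).1 this
    refine ⟨B, hinj ?_⟩
    rw [← hB]
    simp only [hiter, ← map_smul, ← map_sum]
    congr 1
    ext1 i
    simp [hK, Matrix.mulVec, dotProduct, Finset.sum_apply, mul_comm]
  choose B hB using hB
  have hKB : K * (Matrix.of fun i j => B j i) = 1 := by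
    ext1 i j
    have := congrFun (hB j) i
    rw [Matrix.one_apply, ← Pi.single_apply j (1 : ℂ⟦X⟧) i, ← this]
    rfl
  have hBK : ((Matrix.of fun i j => B j i) * K) 3 3 = 1 := by
    rw [mul_eq_one_comm.1 hKB, Matrix.one_apply_eq]
  have hBK0 := congrArg (PowerSeries.coeff 0) hBK
  rw [Matrix.mul_apply, map_sum] at hBK0
  simp only [coeff_zero_mul_ps] at hBK0
  have hT : ∀ (x : Fin 4 → ℂ⟦X⟧) (i : Fin 4), PowerSeries.coeff 0 (abHom T x i) =
      ∑ j ∈ Finset.Ioi i, PowerSeries.coeff 0 (T i j) * PowerSeries.coeff 0 (x j) := by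
    intro x i
    rw [abHom_apply, coeff_zero_abAct]
    refine (Finset.sum_subset (Finset.subset_univ _) fun j _ hj => ?_).symm
    rw [Finset.mem_Ioi, not_lt] at hj
    rcases hj.eq_or_lt with rfl | hj
    · rw [h.diag']; simp
    · rw [h.lower' _ _ hj]; simp
  have i0 : Finset.Ioi (0 : Fin 4) = {1, 2, 3} := by decide
  have i1 : Finset.Ioi (1 : Fin 4) = {2, 3} := by decide
  have i2 : Finset.Ioi (2 : Fin 4) = {3} := by decide
  have i3 : Finset.Ioi (3 : Fin 4) = ∅ := by decide
  have hT3 := fun x => hT x 3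
  have hT2 := fun x => hT x 2
  have hT1 := fun x => hT x 1
  have hT0 := fun x => hT x 0
  simp only [i0, i1, i2, i3, Finset.sum_empty, Finset.sum_singleton] at hT3 hT2 hT1 hT0
  simp only [Finset.sum_insert (show (2 : Fin 4) ∉ ({3} : Finset (Fin 4)) by decide),
    Finset.sum_insert (show (1 : Fin 4) ∉ ({2, 3} : Finset (Fin 4)) by decide),
    Finset.sum_singleton] at hT1 hT0
  -- Modulo `b` the action is strictly triangular, so the third iterate keeps only its first
  -- coordinate, the product of the three superdiagonal entries of `T` and of `c 3`. If a factor
  -- vanished, the (4,4) entry of the identity `B K = 1` would fail.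
  have hK3 : ∀ i, K i 3 = (abHom T) ((abHom T) ((abHom T) c)) i := fun i => rfl
  simp only [Fin.sum_univ_four, hK3, hT0, hT1, hT2, hT3, mul_zero, add_zero] at hBK0
  refine ⟨c, rfl, ?_, ?_, ?_, ?_⟩ <;> intro h0 <;> rw [h0] at hBK0 <;> simp at hBK0

/-- `x` belongs to the submodule generated by the first columns of `P` up to the `j`-th, and it
generates it modulo the preceding ones. -/
def LeadsAt (P : Matrix (Fin 4) (Fin 4) ℂ⟦X⟧) (j : Fin 4) (x : Fin 4 → ℂ⟦X⟧) : Prop :=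
  ∃ c, x = P.mulVec c ∧ (∀ i, j < i → c i = 0) ∧ PowerSeries.coeff 0 (c j) ≠ 0

theorem LeadsAt.smul {P : Matrix (Fin 4) (Fin 4) ℂ⟦X⟧} {j : Fin 4} {x : Fin 4 → ℂ⟦X⟧}
    (h : LeadsAt P j x) {s : ℂ⟦X⟧} (hs : IsUnit s) : LeadsAt P j (s • x) := by
  obtain ⟨c, rfl, hc, hc0⟩ := h
  refine ⟨s • c, (Matrix.mulVec_smul _ _ _).symm, fun i hi => by simp [hc i hi], ?_⟩
  rw [Pi.smul_apply, smul_eq_mul, coeff_zero_mul_ps]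
  refine mul_ne_zero ?_ hc0
  rw [PowerSeries.isUnit_iff_constantCoeff, ← PowerSeries.coeff_zero_eq_constantCoeff_apply] at hs
  exact hs.ne_zero

theorem IsTriangularBasis.mulVec_apply {μ : ℂ} {n : Fin 4 → ℕ}
    {P T : Matrix (Fin 4) (Fin 4) ℂ⟦X⟧} (h : IsTriangularBasis μ n P T) {j : Fin 4}
    {c : Fin 4 → ℂ⟦X⟧} (hc : ∀ i, j < i → c i = 0) :
    (∀ k, j < k → P.mulVec c k = 0) ∧ P.mulVec c j = P j j * c j := by
  constructor
  · intro k hk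
    change ∑ i, P k i * c i = 0
    refine Finset.sum_eq_zero fun i _ => ?_
    by_cases hi : j < i
    · rw [hc i hi, mul_zero]
    · rw [h.lower k i (lt_of_le_of_lt (not_lt.1 hi) hk), zero_mul]
  · change ∑ i, P j i * c i = _
    refine Finset.sum_eq_single j (fun i _ hi => ?_) (by simp)
    rcases lt_or_gt_of_ne hi with hi | hi
    · rw [h.lower j i hi, zero_mul]
    · rw [hc i hi, mul_zero]

theorem IsTriangularBasis.leadsAt_apply {μ : ℂ} {n : Fin 4 → ℕ}
    {P T : Matrix (Fin 4) (Fin 4) ℂ⟦X⟧} (h : IsTriangularBasis μ n P T) {j : Fin 4}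
    {x : Fin 4 → ℂ⟦X⟧} (hx : LeadsAt P j x) :
    (∀ k, j < k → x k = 0) ∧ (∀ m < n j, PowerSeries.coeff m (x j) = 0) ∧
      PowerSeries.coeff (n j) (x j) ≠ 0 := by
  obtain ⟨c, rfl, hc, hc0⟩ := hx
  obtain ⟨h1, h2⟩ := h.mulVec_apply hc
  obtain ⟨κ, hκ, hP⟩ := h.diag j
  refine ⟨h1, ?_⟩
  have h3 : P.mulVec c j = PowerSeries.X ^ n j * (PowerSeries.C κ * c j) := by rw [h2, hP]; ring
  rw [h3]
  refine ⟨PowerSeries.X_pow_dvd_iff.1 (dvd_mul_right _ _), ?_⟩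
  have := PowerSeries.coeff_X_pow_mul (PowerSeries.C κ * c j) (n j) 0
  rw [zero_add] at this
  rw [this, PowerSeries.coeff_C_mul]
  exact mul_ne_zero hκ hc0

/-- If the leading coordinate of `x` is an exact monomial, the coefficient `c j` is constant and is
killed by `a - (μ + n j) b`. The result falls to the preceding step, with leading coefficient
multiplied by the invertible entry `T i j`. -/
theorem IsTriangularBasis.leadsAt_step {μ : ℂ} {n : Fin 4 → ℕ}
    {P T : Matrix (Fin 4) (Fin 4) ℂ⟦X⟧} (h : IsTriangularBasis μ n P T) {i j : Fin 4}
    (hij : (i : ℕ) + 1 = j) (hT : PowerSeries.coeff 0 (T i j) ≠ 0) {x : Fin 4 → ℂ⟦X⟧} {k : ℂ}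
    (hx : LeadsAt P j x) (hxj : x j = PowerSeries.C k * PowerSeries.X ^ n j) :
    LeadsAt P i (abAct (xiMatrix μ) x - (PowerSeries.C (μ + n j) * PowerSeries.X) • x) := by
  obtain ⟨c, rfl, hc, hc0⟩ := hx
  obtain ⟨κ, hκ, hP⟩ := h.diag j
  rw [(h.mulVec_apply hc).2, hP] at hxj
  have hcj : c j = PowerSeries.C (k / κ) := by
    have h1 : PowerSeries.C κ * PowerSeries.X ^ n j ≠ 0 :=
      mul_ne_zero ((map_ne_zero_iff _ PowerSeries.C_injective).2 hκ)
        (pow_ne_zero _ PowerSeries.X_ne_zero)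
    apply mul_left_cancel₀ h1
    rw [hxj, mul_right_comm, ← map_mul, mul_div_cancel₀ _ hκ]
  refine ⟨abAct T c - (PowerSeries.C (μ + n j) * PowerSeries.X) • c, ?_, fun m hm => ?_, ?_⟩
  · rw [h.intertwines.abAct_mulVec, Matrix.mulVec_sub, Matrix.mulVec_smul]
  · have hjm : j ≤ m := by rw [Fin.le_def, ← hij]; exact hm
    have hsum : T.mulVec c m = T m m * c m := by
      change ∑ q, T m q * c q = _
      refine Finset.sum_eq_single m (fun q _ hq => ?_) (by simp)
      rcases lt_or_gt_of_ne hq with hq | hq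
      · rw [h.lower' m q hq, zero_mul]
      · rw [hc q (hjm.trans_lt hq), mul_zero]
    simp only [Pi.sub_apply, Pi.smul_apply, abAct, Pi.add_apply, hsum, smul_eq_mul, h.diag']
    rcases hjm.eq_or_lt with rfl | hjm
    · rw [hcj]; simp
    · rw [hc m hjm]; simp
  · rw [Pi.sub_apply, Pi.smul_apply, map_sub, coeff_zero_abAct, smul_eq_mul, coeff_zero_mul_ps,
      coeff_zero_mul_ps]
    rw [Finset.sum_eq_single j]
    · simpa using ⟨by simpa using hT, by simpa using hc0⟩
    · intro q _ hq
      by_cases hqj : j < q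
      · rw [hc q hqj]; simp
      · have hqi : q ≤ i := by
          have : q < j := lt_of_le_of_ne (not_lt.1 hqj) hq
          rw [Fin.le_def]
          rw [Fin.lt_def] at this
          omega
        rcases hqi.eq_or_lt with rfl | hqi
        · rw [h.diag']; simp
        · rw [h.lower' i q hqi]; simp
    · simp

end Pointwise

/-! ### Making the triangular basis holomorphic. -/

section NormalForm

open holRing

variable {Y : ReducedComplexSpace} {U : Set Y}

/-- Normalization of a section which is pointwise a generator of a triangular step. -/
theorem exists_normalized {μ : ℂ} {n : Fin 4 → ℕ} {P T : U → Matrix (Fin 4) (Fin 4) ℂ⟦X⟧}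
    (hP : ∀ u, IsTriangularBasis μ n (P u) (T u)) {j : Fin 4} {x : Fin 4 → (holRing Y U)⟦X⟧}
    (hx : ∀ u, LeadsAt (P u) j (evV u x)) :
    ∃ (S : (holRing Y U)⟦X⟧) (w : Fin 4 → (holRing Y U)⟦X⟧) (k : holRing Y U),
      PowerSeries.coeff 0 S = 1 ∧ x = S • w ∧ (∀ u, LeadsAt (P u) j (evV u w)) ∧
      w j = PowerSeries.C k * PowerSeries.X ^ n j ∧ IsUnit k ∧ ∀ i, j < i → w i = 0 := by
  have hl := fun u => (hP u).leadsAt_apply (hx u)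
  -- The order of vanishing of the leading coordinate is `n j` at every point, so division by `b^(n
  -- j)` keeps coefficients holomorphic and leaves an invertible constant term.
  obtain ⟨s, hs⟩ : PowerSeries.X ^ n j ∣ x j := by
    rw [PowerSeries.X_pow_dvd_iff]
    intro m hm
    refine ext_ev fun u => ?_
    rw [map_zero, ← coeff_evS]
    exact (hl u).2.1 m hm
  have hk : IsUnit (PowerSeries.coeff 0 s) := by
    rw [isUnit_iff]
    intro u
    have h1 := (hl u).2.2
    rw [evV, coeff_evS, hs] at h1
    have h2 := PowerSeries.coeff_X_pow_mul s (n j) 0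
    rw [zero_add] at h2
    rwa [h2] at h1
  obtain ⟨k, hk⟩ := hk
  set S : (holRing Y U)⟦X⟧ := PowerSeries.C (↑k⁻¹ : holRing Y U) * s with hS
  have hS0 : PowerSeries.coeff 0 S = 1 := by
    rw [hS, PowerSeries.coeff_C_mul, ← hk, Units.inv_mul]
  have hsS : s = PowerSeries.C (k : holRing Y U) * S := by
    rw [hS, ← mul_assoc, ← map_mul, Units.mul_inv, map_one, one_mul]
  obtain ⟨v, hv⟩ := isUnit_of_coeff_zero hS0
  refine ⟨S, (↑v⁻¹ : (holRing Y U)⟦X⟧) • x, k, hS0, ?_, fun u => ?_, ?_, k.isUnit, fun i hi => ?_⟩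
  · rw [smul_smul, ← hv, Units.mul_inv, one_smul]
  · rw [evV_smul]
    exact (hx u).smul ((v⁻¹).isUnit.map (evS u))
  · have h1 : (↑v⁻¹ : (holRing Y U)⟦X⟧) * S = 1 := by rw [← hv, Units.inv_mul]
    rw [Pi.smul_apply, smul_eq_mul, hs, hsS]
    linear_combination (PowerSeries.X ^ n j * PowerSeries.C (k : holRing Y U)) * h1
  · have : x i = 0 := ext_evS fun u => by rw [map_zero]; exact (hl u).1 i hi
    rw [Pi.smul_apply, this, smul_zero]

theorem evV_step (μ : ℂ) (q : ℕ) (w : Fin 4 → (holRing Y U)⟦X⟧) (u : U) :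
    evV u (abAct (xiMatrix (algebraMap ℂ (holRing Y U) μ)) w -
      (PowerSeries.C (algebraMap ℂ (holRing Y U) μ + q) * PowerSeries.X) • w) =
    abAct (xiMatrix μ) (evV u w) - (PowerSeries.C (μ + q) * PowerSeries.X) • evV u w := by
  have h1 : evS u (PowerSeries.C (algebraMap ℂ (holRing Y U) μ + q) * PowerSeries.X) =
      PowerSeries.C (μ + q) * PowerSeries.X := by
    rw [map_mul, evS_C, evS_X, map_add, map_natCast, AlgHom.commutes]
    rfl
  have h2 : ∀ v w : Fin 4 → (holRing Y U)⟦X⟧, evV u (v - w) = evV u v - evV u w := fun v w => by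
    ext1 i; simp [evV]
  rw [h2, evV_smul, evV_abAct, map_xiMatrix_evS, h1]

/-- The holomorphic triangular basis of the theme generated by `φ`. -/
theorem exists_normal_basis {μ : ℂ} {n : Fin 4 → ℕ} {P T : U → Matrix (Fin 4) (Fin 4) ℂ⟦X⟧}
    (hP : ∀ u, IsTriangularBasis μ n (P u) (T u))
    (h01 : ∀ u, PowerSeries.coeff 0 (T u 0 1) ≠ 0) (h12 : ∀ u, PowerSeries.coeff 0 (T u 1 2) ≠ 0)
    (h23 : ∀ u, PowerSeries.coeff 0 (T u 2 3) ≠ 0) {φ : Fin 4 → (holRing Y U)⟦X⟧}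
    (hφ : ∀ u, LeadsAt (P u) 3 (evV u φ)) :
    ∃ (e : Fin 4 → Fin 4 → (holRing Y U)⟦X⟧) (S₁ S₂ S₃ S₄ : (holRing Y U)⟦X⟧),
      PowerSeries.coeff 0 S₁ = 1 ∧ PowerSeries.coeff 0 S₂ = 1 ∧ PowerSeries.coeff 0 S₃ = 1 ∧
      PowerSeries.coeff 0 S₄ = 1 ∧ φ = S₄ • e 3 ∧
      abAct (xiMatrix (algebraMap ℂ (holRing Y U) μ)) (e 3) =
        (PowerSeries.C (algebraMap ℂ (holRing Y U) μ + n 3) * PowerSeries.X) • e 3 + S₃ • e 2 ∧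
      abAct (xiMatrix (algebraMap ℂ (holRing Y U) μ)) (e 2) =
        (PowerSeries.C (algebraMap ℂ (holRing Y U) μ + n 2) * PowerSeries.X) • e 2 + S₂ • e 1 ∧
      abAct (xiMatrix (algebraMap ℂ (holRing Y U) μ)) (e 1) =
        (PowerSeries.C (algebraMap ℂ (holRing Y U) μ + n 1) * PowerSeries.X) • e 1 + S₁ • e 0 ∧
      abAct (xiMatrix (algebraMap ℂ (holRing Y U) μ)) (e 0) =
        (PowerSeries.C (algebraMap ℂ (holRing Y U) μ + n 0) * PowerSeries.X) • e 0 ∧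
      ∀ u, LinearIndependent ℂ⟦X⟧ (fun j => evV u (e j)) := by
  have step : ∀ {i j : Fin 4} (_ : (i : ℕ) + 1 = j) (_ : ∀ u, PowerSeries.coeff 0 (T u i j) ≠ 0)
      {w : Fin 4 → (holRing Y U)⟦X⟧} {k : holRing Y U} (_ : ∀ u, LeadsAt (P u) j (evV u w))
      (_ : w j = PowerSeries.C k * PowerSeries.X ^ n j) (u : U),
      LeadsAt (P u) i (evV u (abAct (xiMatrix (algebraMap ℂ (holRing Y U) μ)) w -
        (PowerSeries.C (algebraMap ℂ (holRing Y U) μ + n j) * PowerSeries.X) • w)) := by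
    intro i j hij hT w k hw hwj u
    rw [evV_step]
    refine (hP u).leadsAt_step hij (hT u) (hw u) (k := ev u k) ?_
    rw [evV, hwj, map_mul, map_pow, evS_C, evS_X]
  -- Starting from `φ`, normalization alternates with the descent by `a - (μ + n) b`. The bases `P
  -- u` were chosen separately at each point; they only control leading terms, while all new vectors
  -- are holomorphic.
  obtain ⟨S₄, w₃, k₃, s₄, x₃, l₃, m₃, v₃, z₃⟩ := exists_normalized hP hφ
  obtain ⟨S₃, w₂, k₂, s₃, x₂, l₂, m₂, v₂, z₂⟩ :=
    exists_normalized hP (step (i := 2) (j := 3) rfl h23 l₃ m₃)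
  obtain ⟨S₂, w₁, k₁, s₂, x₁, l₁, m₁, v₁, z₁⟩ :=
    exists_normalized hP (step (i := 1) (j := 2) rfl h12 l₂ m₂)
  obtain ⟨S₁, w₀, k₀, s₁, x₀, l₀, m₀, v₀, z₀⟩ :=
    exists_normalized hP (step (i := 0) (j := 1) rfl h01 l₁ m₁)
  refine ⟨![w₀, w₁, w₂, w₃], S₁, S₂, S₃, S₄, s₁, s₂, s₃, s₄, x₃, ?_, ?_, ?_, ?_, fun u => ?_⟩
  · exact (sub_eq_iff_eq_add'.1 x₂)
  · exact (sub_eq_iff_eq_add'.1 x₁)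
  · exact (sub_eq_iff_eq_add'.1 x₀)
  -- The last vector is a monomial in the first coordinate with all others zero, hence an
  -- eigenvector for `b`.
  · change abAct _ w₀ = _ • w₀
    rw [abAct_xiMatrix _ _ (n 0), add_eq_left]
    have h1 := z₀ 1 (by decide)
    have h2 := z₀ 2 (by decide)
    have h3 := z₀ 3 (by decide)
    have e0 : ∀ d, eulerOp d (0 : (holRing Y U)⟦X⟧) = 0 := fun d => by simp [eulerOp]
    ext1 i
    fin_cases i <;> simp [h1, h2, h3, e0, m₀, eulerOp_monomial]
  · refine linearIndependent_col
      (P := Matrix.of fun i j =>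
        evV u ((![w₀, w₁, w₂, w₃] : Fin 4 → Fin 4 → (holRing Y U)⟦X⟧) j) i) ?_
    have hne : ∀ {k : holRing Y U} (q : ℕ), IsUnit k →
        evS u (PowerSeries.C k * PowerSeries.X ^ q) ≠ 0 := fun q hk => by
      rw [map_mul, map_pow, evS_C, evS_X]
      exact mul_ne_zero ((map_ne_zero_iff _ PowerSeries.C_injective).2 (isUnit_iff.1 hk u))
        (pow_ne_zero _ PowerSeries.X_ne_zero)
    rw [Matrix.det_of_isUpperTriangular, Fin.prod_univ_four]
    · change evS u (w₀ 0) * evS u (w₁ 1) * evS u (w₂ 2) * evS u (w₃ 3) ≠ 0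
      rw [m₀, m₁, m₂, m₃]
      exact mul_ne_zero (mul_ne_zero (mul_ne_zero (hne _ v₀) (hne _ v₁)) (hne _ v₂)) (hne _ v₃)
    · intro i j hij
      have hz : (![w₀, w₁, w₂, w₃] : Fin 4 → Fin 4 → (holRing Y U)⟦X⟧) j i = 0 := by
        fin_cases j
        · exact z₀ i hij
        · exact z₁ i hij
        · exact z₂ i hij
        · exact z₃ i hij
      rw [Matrix.of_apply, evV, hz, map_zero]

end NormalForm

/-! ### Local triangular frames of a family of themes. -/

section FamilyNormalForm

open holRing

theorem exponent_eq (lam1 : ℚ) (j : Fin 4) :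
    exponent (r := 3) lam1 ![3, 2, 2] j = lam1 + (![0, 2, 3, 4] j : ℕ) := by
  fin_cases j <;> simp [exponent, Fin.sum_univ_three] <;> norm_num

/-- A theme in `Ξ` with fundamental invariants `λ₁, 3, 2, 2` has a triangular basis. -/
theorem exists_isTriangularBasis_of_hasInvariants {lam1 : ℚ} {N : ℕ}
    (hN : lam1 = residue lam1 + (N + 3 : ℕ)) {E : ABModule}
    (hE : HasInvariants (r := 3) lam1 ![3, 2, 2] E)
    {θ : E →ₗ[ℂ⟦X⟧] Xi (residue lam1) 3} (hθ : Function.Injective θ)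
    (hθa : ∀ v, θ (E.a v) = (Xi (residue lam1) 3).a (θ v)) :
    ∃ P T : Matrix (Fin 4) (Fin 4) ℂ⟦X⟧, IsTriangularBasis (residue lam1 : ℂ)
      (fun j => N + 3 + ![0, 2, 3, 4] j) P T ∧
      LinearMap.range θ = Submodule.span ℂ⟦X⟧ (Set.range P.col) := by
  obtain ⟨ε, hε⟩ := hE
  set v : Fin 4 → Fin 4 → ℂ⟦X⟧ := fun j => θ (ε j) with hv
  have hli : LinearIndependent ℂ⟦X⟧ v := ε.linearIndependent.map' θ (LinearMap.ker_eq_bot.2 hθ)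
  have hexp : ∀ j : Fin 4, ((exponent (r := 3) lam1 ![3, 2, 2] j : ℚ) : ℂ) =
      (residue lam1 : ℂ) + ((N + 3 + ![0, 2, 3, 4] j : ℕ) : ℂ) := fun j => by
    rw [exponent_eq]
    have := congrArg (Rat.cast (K := ℂ)) hN
    push_cast at this ⊢
    rw [this]
    ring
  obtain ⟨T, hT⟩ := exists_isTriangularBasis (μ := (residue lam1 : ℂ))
    (n := fun j => N + 3 + ![0, 2, 3, 4] j) hli (fun j => by
      have h1 := Submodule.mem_map_of_mem (f := θ) (hε j)
      rw [Submodule.map_span, ← Set.image_comp, map_sub, map_smul, hθa, hexp] at h1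
      exact h1)
  refine ⟨_, T, hT, ?_⟩
  rw [LinearMap.range_eq_map, ← ε.span_eq, Submodule.map_span, ← Set.range_comp]
  rfl

variable {Y : ReducedComplexSpace}

/-- Near each point, a holomorphic family of themes has a holomorphic triangular basis. -/
theorem IsThemeFamily.exists_normal_form {lam1 : ℚ} (hlam1 : 3 < lam1) {H : ABFamily Y}
    (hH : IsThemeFamily (r := 3) lam1 ![3, 2, 2] H) (y₀ : Y) :
    ∃ U : Set Y, IsOpen U ∧ y₀ ∈ U ∧ ∃ (S₁ S₂ S₃ : Y → ℂ⟦X⟧) (E : ∀ y, Fin 4 → H.fiber y),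
      SeriesHolOn S₁ U ∧ SeriesHolOn S₂ U ∧ SeriesHolOn S₃ U ∧
      (∀ y ∈ U, PowerSeries.coeff 0 (S₁ y) = 1 ∧ PowerSeries.coeff 0 (S₂ y) = 1 ∧
        PowerSeries.coeff 0 (S₃ y) = 1) ∧
      (∀ y ∈ U, LinearIndependent ℂ⟦X⟧ (E y) ∧ Submodule.span ℂ⟦X⟧ (Set.range (E y)) = ⊤ ∧
        ∀ j, (H.fiber y).a (E y j) =
          ∑ i, themeMatrix (lam1 : ℂ) (S₁ y) (S₂ y) (S₃ y) i j • E y i) ∧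
      ∀ h ∈ H.atlas, ∀ j,
        HolCombOn (M := fun y => H.fiber y) (U ∩ h.dom) h.vec (fun y => E y j) := by
  obtain ⟨N, hN⟩ := exists_residue_add hlam1
  obtain ⟨hinv, hloc⟩ := hH
  obtain ⟨U, hU, hy₀, φ, ⟨hφ₁, hφ₂, -⟩, θ, hθ, hθ'⟩ := hloc y₀
  set φR : Fin 4 → (holRing Y U)⟦X⟧ := fun i => mkS _ (hφ₁ i) with hφR
  have hφ : ∀ u : U, φ u = evV u φR := fun u => funext fun i => (evS_mkS _ (hφ₁ i) u).symm
  choose P T hP hPθ using fun u : U => exists_isTriangularBasis_of_hasInvariants hN (hinv u)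
    (hθ u u.2).1 (hθ u u.2).2.1
  have hsp := fun u : U => (hP u).of_span (φ := evV u φR) (by
    rw [← hφ, ← hPθ, (hθ u u.2).2.2]
    rfl)
  choose c hc h01 h12 h23 hc3 using hsp
  obtain ⟨e, S₁, S₂, S₃, S₄, s₁, s₂, s₃, s₄, eφ, e₃, e₂, e₁, e₀, hli⟩ :=
    exists_normal_basis hP h01 h12 h23 (φ := φR) fun u =>
      ⟨c u, hc u, fun i hi => absurd hi (not_lt.2 (Fin.le_last i)), hc3 u⟩
  obtain ⟨-, -, r₃, r₄⟩ := isThematicOn_of_basis (μ := residue lam1) (φ := φ) hU hφ (e := e)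
    (l := fun j => PowerSeries.C (algebraMap ℂ (holRing Y U) (residue lam1) +
      ((N + 3 + ![0, 2, 3, 4] j : ℕ) : holRing Y U)) * PowerSeries.X)
    (isUnit_of_coeff_zero s₁) (isUnit_of_coeff_zero s₂) (isUnit_of_coeff_zero s₃)
    (isUnit_of_coeff_zero s₄) eφ e₃ e₂ e₁ e₀ hli
  have hE : ∀ u : U, ∀ j, ∃ x : H.fiber u, θ u x = evV u (e j) := fun u j => by
    have h1 := (hθ u u.2).2.2.trans (r₃ u)
    have h2 := Submodule.subset_span (R := ℂ⟦X⟧)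
      (Set.mem_range_self (f := fun j => (show Xi (residue lam1) 3 from evV u (e j))) j)
    exact LinearMap.mem_range.1 (h1.symm ▸ h2)
  choose E' hE' using hE
  classical
  -- The value 0 outside `U` is irrelevant.
  set E : ∀ y, Fin 4 → H.fiber y := fun y j => if h : y ∈ U then E' ⟨y, h⟩ j else 0 with hEdef
  have hEU : ∀ (u : U) j, θ u (E u j) = evV u (e j) := fun u j => by
    rw [hEdef]
    simp only [u.2, dif_pos]
    exact hE' u j
  have hvan : ∀ (u : U) (a b : H.fiber u), θ u a = θ u b → a = b := fun u a b h => (hθ u u.2).1 h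
  refine ⟨U, hU, hy₀, toS S₁, toS S₂, toS S₃, E, seriesHolOn_toS hU _, seriesHolOn_toS hU _,
    seriesHolOn_toS hU _, fun y hy => ?_, fun y hy => ⟨?_, ?_, fun j => ?_⟩, fun h hh j => ?_⟩
  · rw [toS_apply _ hy, toS_apply _ hy, toS_apply _ hy, coeff_evS, coeff_evS, coeff_evS, s₁, s₂,
      s₃, map_one]
    exact ⟨rfl, rfl, rfl⟩
  · refine LinearIndependent.of_comp (θ y) ?_
    have : θ y ∘ E y = fun j => evV ⟨y, hy⟩ (e j) := funext fun j => hEU ⟨y, hy⟩ j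
    rw [this]
    exact hli ⟨y, hy⟩
  · refine Submodule.map_injective_of_injective (hθ y hy).1 ?_
    rw [Submodule.map_span, ← Set.range_comp, Submodule.map_top, (hθ y hy).2.2, r₃ ⟨y, hy⟩]
    congr 2
    exact funext fun j => hEU ⟨y, hy⟩ j
  · have ev : ∀ {v w : Fin 4 → (holRing Y U)⟦X⟧},
        abAct (xiMatrix (algebraMap ℂ (holRing Y U) (residue lam1))) v = w →
        abAct (xiMatrix (residue lam1 : ℂ)) (evV ⟨y, hy⟩ v) = evV ⟨y, hy⟩ w := fun {v w} h => by
      rw [← h, evV_abAct, map_xiMatrix_evS]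
    have hl : ∀ m : ℕ, evS (⟨y, hy⟩ : U) (PowerSeries.C (algebraMap ℂ (holRing Y U) (residue lam1) +
        ((N + 3 + m : ℕ) : holRing Y U)) * PowerSeries.X) =
        PowerSeries.C ((lam1 : ℂ) + m) * PowerSeries.X := fun m => by
      have h1 : (lam1 : ℂ) = (residue lam1 : ℂ) + (N + 3 : ℕ) := by
        exact_mod_cast congrArg (Rat.cast (K := ℂ)) hN
      rw [map_mul, evS_C, evS_X, map_add, map_natCast, AlgHom.commutes, h1]
      push_cast
      congr 2
      exact (add_assoc _ _ _).symm
    have hEy : ∀ j, θ y (E y j) = evV ⟨y, hy⟩ (e j) := fun j => hEU ⟨y, hy⟩ j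
    refine (hθ y hy).1 (((hθ y hy).2.1 _).trans ?_)
    rw [map_sum, Fin.sum_univ_four]
    simp only [map_smul]
    rw [hEy 0, hEy 1, hEy 2, hEy 3, hEy j, toS_apply _ hy, toS_apply _ hy, toS_apply _ hy]
    have key : ∀ j, abAct (xiMatrix (residue lam1 : ℂ)) (evV ⟨y, hy⟩ (e j)) =
        themeMatrix (lam1 : ℂ) (evS ⟨y, hy⟩ S₁) (evS ⟨y, hy⟩ S₂) (evS ⟨y, hy⟩ S₃) 0 j •
          evV ⟨y, hy⟩ (e 0) +
        themeMatrix (lam1 : ℂ) (evS ⟨y, hy⟩ S₁) (evS ⟨y, hy⟩ S₂) (evS ⟨y, hy⟩ S₃) 1 j •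
          evV ⟨y, hy⟩ (e 1) +
        themeMatrix (lam1 : ℂ) (evS ⟨y, hy⟩ S₁) (evS ⟨y, hy⟩ S₂) (evS ⟨y, hy⟩ S₃) 2 j •
          evV ⟨y, hy⟩ (e 2) +
        themeMatrix (lam1 : ℂ) (evS ⟨y, hy⟩ S₁) (evS ⟨y, hy⟩ S₂) (evS ⟨y, hy⟩ S₃) 3 j •
          evV ⟨y, hy⟩ (e 3) := by
      intro j
      fin_cases j
      · refine (ev e₀).trans ((evV_smul _ _ _).trans ?_)
        refine (congrArg (· • evV _ (e 0)) (hl 0)).trans ?_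
        simp [themeMatrix]
      · refine (ev e₁).trans ((evV_add _ _ _).trans ?_)
        rw [evV_smul, evV_smul]
        refine (congrArg (· • evV _ (e 1) + _) (hl 2)).trans ?_
        simp [themeMatrix, add_comm]
      · refine (ev e₂).trans ((evV_add _ _ _).trans ?_)
        rw [evV_smul, evV_smul]
        refine (congrArg (· • evV _ (e 2) + _) (hl 3)).trans ?_
        simp [themeMatrix, add_comm]
      · refine (ev e₃).trans ((evV_add _ _ _).trans ?_)
        rw [evV_smul, evV_smul]
        refine (congrArg (· • evV _ (e 3) + _) (hl 4)).trans ?_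
        simp [themeMatrix, add_comm]
    exact key j
  · have hV := hU.inter h.isOpen_dom
    -- The definition expresses the frames of `H` in the iterates of `φ`. Inverting this change of
    -- frame yields holomorphy of `E` in the frames of `H`.
    have hsym : ∀ i, HolCombOn (M := fun _ => Xi (residue lam1) 3) (U ∩ h.dom)
        (fun y i => θ y (h.vec y i)) (fun y => iterates (3 + 1) φ y i) :=
      HolCombOn.symm hV (fun y hy => hφ₂ y hy.1)
        (fun y hy => (h.linearIndependent y hy.2).map' (θ y)
          (LinearMap.ker_eq_bot.2 (hθ y hy.1).1))
        (fun y hy => by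
          rw [← (hθ y hy.1).2.2, LinearMap.range_eq_map, ← h.span_eq_top y hy.2, Submodule.map_span,
            ← Set.range_comp]
          rfl)
        (hθ' h hh)
    obtain ⟨S, hS, hSE⟩ := ((r₄ (e j) (Submodule.subset_span ⟨j, rfl⟩) (fun y => θ y (E y j))
      fun u => hEU u j).mono Set.inter_subset_left).trans hV hsym
    refine ⟨S, hS, fun y hy => (hθ y hy.1).1 ?_⟩
    rw [map_sum]
    simp only [map_smul]
    exact hSE y hy

end FamilyNormalForm

/-! ### The classifying map and universality off the hyperplane. -/

section Classifying

open holRing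

theorem linearCombination_abAct {k : ℕ} {M : Matrix (Fin k) (Fin k) ℂ⟦X⟧} {E : ABModule}
    {w : Fin k → E} (hw : ∀ j, E.a (w j) = ∑ i, M i j • w i) (v : Fin k → ℂ⟦X⟧) :
    Fintype.linearCombination ℂ⟦X⟧ w (abAct M v) = E.a (Fintype.linearCombination ℂ⟦X⟧ w v) := by
  simp only [Fintype.linearCombination_apply, map_sum, E.a_smul, hw, abAct, Pi.add_apply, add_smul,
    Finset.sum_add_distrib, Matrix.mulVec, dotProduct, Finset.sum_smul, Finset.smul_sum]
  congr 1
  rw [Finset.sum_comm]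
  refine Finset.sum_congr rfl fun i _ => Finset.sum_congr rfl fun j _ => ?_
  rw [smul_smul, mul_comm]

theorem bijective_linearCombination {k : ℕ} {E : ABModule} {w : Fin k → E}
    (hli : LinearIndependent ℂ⟦X⟧ w) (hsp : Submodule.span ℂ⟦X⟧ (Set.range w) = ⊤) :
    Function.Bijective (Fintype.linearCombination ℂ⟦X⟧ w) :=
  ⟨linearIndependent_iff_injective_fintypeLinearCombination.1 hli,
    LinearMap.range_eq_top.1 ((Fintype.range_linearCombination ℂ⟦X⟧ w).trans hsp)⟩

theorem isomorphic_ofMatrix_of_basis {k : ℕ} {M : Matrix (Fin k) (Fin k) ℂ⟦X⟧} {E : ABModule}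
    {w : Fin k → E} (hli : LinearIndependent ℂ⟦X⟧ w)
    (hsp : Submodule.span ℂ⟦X⟧ (Set.range w) = ⊤)
    (hw : ∀ j, E.a (w j) = ∑ i, M i j • w i) : Isomorphic (ABModule.ofMatrix M) E :=
  ⟨LinearEquiv.ofBijective (Fintype.linearCombination ℂ⟦X⟧ w) (bijective_linearCombination hli hsp),
    linearCombination_abAct hw⟩

variable {Y Z X : ReducedComplexSpace}

theorem HolAt.comp_map {f : Z → ℂ} {g : Y → Z} {V : Set Y} (hg : HolMapOn g V) {y : Y}
    (hy : y ∈ V) (hf : HolAt f (g y)) : HolAt (fun y' => f (g y')) y := by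
  obtain ⟨c, hc, hx, F, hF, hfF⟩ := hf
  obtain ⟨hcont, hcoord⟩ := hg y hy
  exact (HolAt.comp_analyticAt (f := fun i y' => c.toFun (g y') i) (hcoord c hc hx) hF).congr
    (hcont.eventually hfF)

theorem HolMapOn.comp {f : Z → X} {g : Y → Z} {U : Set Z} {V : Set Y} (hf : HolMapOn f U)
    (hg : HolMapOn g V) : HolMapOn (fun y => f (g y)) (V ∩ g ⁻¹' U) := fun y hy =>
  ⟨(hf (g y) hy.2).1.comp (hg y hy.1).1, fun c hc hx i =>
    HolAt.comp_map (f := fun z => c.toFun (f z) i) hg hy.1 ((hf (g y) hy.2).2 c hc hx i)⟩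

theorem holMapOn_ofSet {n : ℕ} {A : Set (Fin n → ℂ)} (hA : IsLocallyAnalytic A) {f : Y → A}
    {U : Set Y} (hf : ∀ i, HolOn (fun y => (f y).1 i) U) :
    HolMapOn (X := ReducedComplexSpace.ofSet A hA) f U := by
  intro y hy
  refine ⟨Topology.IsInducing.subtypeVal.continuousAt_iff.2
    (continuousAt_pi.2 fun i => (hf i y hy).continuousAt), ?_⟩
  rintro c rfl - i
  exact hf i y hy

/-- The pull-back of the canonical family is given by a holomorphic change of frame. -/
theorem pullbackIsoOn_canonicalFamily {lam1 : ℚ} {A : Set (Fin 6 → ℂ)} (hA : IsLocallyAnalytic A)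
    {H : ABFamily Y} {U : Set Y} (hU : IsOpen U) {f : Y → A}
    {M : Y → Matrix (Fin 4) (Fin 4) ℂ⟦X⟧} {E : ∀ y, Fin 4 → H.fiber y}
    (hE : ∀ y ∈ U, LinearIndependent ℂ⟦X⟧ (E y) ∧ Submodule.span ℂ⟦X⟧ (Set.range (E y)) = ⊤ ∧
        ∀ j, (H.fiber y).a (E y j) = ∑ i, M y i j • E y i)
    (hol : ∀ h ∈ H.atlas, ∀ j,
        HolCombOn (M := fun y => H.fiber y) (U ∩ h.dom) h.vec (fun y => E y j))
    {G : Matrix (Fin 4) (Fin 4) (holRing Y U)⟦X⟧} (hG : IsUnit G)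
    (h : ∀ u : U, Intertwines (M u) (canonicalMatrix lam1 (f u).1) (G.map (evS u))) :
    PullbackIsoOn (X := ReducedComplexSpace.ofSet A hA) f U (canonicalFamily lam1 A hA) H := by
  set G' : Y → Matrix (Fin 4) (Fin 4) ℂ⟦X⟧ := fun y => Matrix.of fun i j => toS (G i j) y with hG'
  have hG'e : ∀ u : U, G' u = G.map (evS u) := fun u => by
    ext1 i j
    exact toS_apply _ u.2
  have hunit : ∀ u : U, IsUnit (G' u) := fun u => by
    rw [hG'e]
    exact hG.map (evS u).mapMatrix
  refine ⟨fun y => (Fintype.linearCombination ℂ⟦X⟧ (E y)).comp (G' y).mulVecLin,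
    fun y hy => ⟨?_, fun v => ?_⟩, ?_⟩
  · refine (bijective_linearCombination (hE y hy).1 (hE y hy).2.1).comp
      (⟨Matrix.mulVec_injective_of_isUnit (hunit ⟨y, hy⟩),
        Matrix.mulVec_surjective_iff_isUnit.2 (hunit ⟨y, hy⟩)⟩ :
        Function.Bijective (G' y).mulVec)
  · have h1 : Intertwines (M y) (canonicalMatrix lam1 (f y).1) (G' y) := by
      have := h ⟨y, hy⟩
      rwa [← hG'e] at this
    exact (congrArg (Fintype.linearCombination ℂ⟦X⟧ (E y)) (h1.abAct_mulVec v)).symm.trans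
      (linearCombination_abAct (hE y hy).2.2 _)
  · rintro e rfl h' hh' (j : Fin 4)
    have hV : IsOpen (U ∩ h'.dom) := hU.inter h'.isOpen_dom
    refine HolCombOn.mono (V := U ∩ h'.dom) ?_ fun y hy => ⟨hy.1.1, hy.2⟩
    refine HolCombOn.trans hV (w := E) ⟨fun i => toS (G i j), fun i n x hx =>
      seriesHolOn_toS hU _ n x hx.1, fun y _ => ?_⟩ (hol h' hh')
    change Fintype.linearCombination ℂ⟦X⟧ (E y)
      ((G' y).mulVec (Pi.basisFun ℂ⟦X⟧ (Fin 4) j)) = _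
    rw [Pi.basisFun_apply, Matrix.mulVec_single_one, Fintype.linearCombination_apply]
    rfl

/-- The parameters of non-invariant themes. -/
def stableParams : Set (Fin 6 → ℂ) := {σ | σ ∈ paramSpace ∧ 3 * σ 0 ≠ 5 * σ 2}

theorem isOpen_stableParams : IsOpen stableParams :=
  isOpen_paramSpace.inter (isOpen_ne_fun (by fun_prop) (by fun_prop))

theorem eq_of_isomorphic_of_mem_slice {lam1 : ℚ} {W : Set (Fin 6 → ℂ)} {ε₀ : ℂ}
    {σ τ : Fin 6 → ℂ} (hσ : σ ∈ slice W ε₀) (hτ : τ ∈ slice W ε₀)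
    (h : Isomorphic (canonicalTheme lam1 σ) (canonicalTheme lam1 τ)) : σ = τ := by
  ext1 i
  by_cases hi : i = 4
  · rw [hi, hσ.2, hτ.2]
  · exact (isomorphic_canonicalTheme h).1 i hi

theorem isThemeFamily_canonicalFamily {lam1 : ℚ} (hlam1 : 3 < lam1) {A : Set (Fin 6 → ℂ)}
    (hA : IsLocallyAnalytic A) (hp : A ⊆ paramSpace) :
    IsThemeFamily (r := 3) lam1 ![3, 2, 2] (canonicalFamily lam1 A hA) :=
  isThemeFamily_ofMatrix (Y := ReducedComplexSpace.ofSet A hA) hlam1 (g := fun σ : A => σ.1)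
    (fun i x _ => holAt_ofSet hA (F := fun σ => σ i) (fun z =>
      (ContinuousLinearMap.proj (R := ℂ) (φ := fun _ : Fin 6 => ℂ) i).analyticAt z) x)
    (fun σ => hp σ.2) (seriesHolOn_canonicalMatrix lam1 A hA)

theorem PullbackIsoOn.isomorphic {f : Y → X} {U : Set Y} {E : ABFamily X} {H : ABFamily Y}
    (h : PullbackIsoOn f U E H) {y : Y} (hy : y ∈ U) : Isomorphic (E.fiber (f y)) (H.fiber y) := by
  obtain ⟨θ, hθ, -⟩ := h
  exact ⟨LinearEquiv.ofBijective (θ y) (hθ y hy).1, (hθ y hy).2⟩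

/-- Near each point, a holomorphic family of non-invariant themes is the pull-back of the canonical
family by a holomorphic map with values in a given slice. -/
theorem exists_classifies {lam1 : ℚ} (hlam1 : 3 < lam1) {ε₀ : ℂ} {H : ABFamily Y} {y₀ : Y}
    (hH : IsThemeFamily (r := 3) lam1 ![3, 2, 2] H) (τ : slice stableParams ε₀)
    (hτ : Isomorphic (H.fiber y₀) (canonicalTheme lam1 τ)) :
    ∃ f : Y → slice stableParams ε₀,
      Classifies (X := ReducedComplexSpace.ofSet _ (isLocallyAnalytic_slice isOpen_stableParams ε₀))
        (canonicalFamily lam1 _ (isLocallyAnalytic_slice isOpen_stableParams ε₀)) τ H y₀ f := by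
  obtain ⟨U, hU, hy₀, S₁, S₂, S₃, E, h₁, h₂, h₃, h0, hE, hol⟩ := hH.exists_normal_form hlam1 y₀
  set c : (ℕ → (Y → ℂ⟦X⟧) → Y → ℂ) := fun n S y => PowerSeries.coeff n (S y) with hc
  -- The canonical parameters in terms of a local normal form, as in `exists_intertwiner_canonical`,
  -- with `ε` set to `ε₀`.
  set σ : Y → Fin 6 → ℂ := fun y => ![c 2 S₃ y, c 1 S₂ y - c 1 S₃ y, c 2 S₂ y,
    c 1 S₁ y - 2 * c 1 S₃ y, ε₀, c 3 S₁ y] with hσ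
  have hσhol : ∀ i, HolOn (fun y => σ y i) U := by
    intro i y hy
    have sub : ∀ (z : ℂ) {a b : Y → ℂ}, HolAt a y → HolAt b y → HolAt (fun y => a y - z * b y) y :=
      fun z a b ha hb => (ha.add ((holAt_const (-z) y).mul hb)).congr
        (Filter.Eventually.of_forall fun y => by ring)
    fin_cases i
    · exact h₃ 2 y hy
    · exact (sub 1 (h₂ 1 y hy) (h₃ 1 y hy)).congr (Filter.Eventually.of_forall fun y => by
        simp [hσ, hc])
    · exact h₂ 2 y hy
    · exact sub 2 (h₁ 1 y hy) (h₃ 1 y hy)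
    · exact holAt_const _ _
    · exact h₁ 3 y hy
  -- The five computed coordinates are invariants of the fibre, and the sixth is `ε₀` on both sides.
  have hσ₀ : σ y₀ = τ.1 := by
    have hiso := (isomorphic_ofMatrix_of_basis (hE y₀ hy₀).1 (hE y₀ hy₀).2.1
      (hE y₀ hy₀).2.2).trans hτ
    rw [canonicalTheme_eq] at hiso
    obtain ⟨a0, a1, a2, a3⟩ := coeff_cubicSeries (τ.1 3) (τ.1 4) (τ.1 5)
    obtain ⟨b0, b1, b2, b3⟩ := coeff_cubicSeries (τ.1 1) (τ.1 2) 0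
    obtain ⟨c0, c1, c2, c3⟩ := coeff_cubicSeries 0 (τ.1 0) 0
    obtain ⟨g, g₁₂, g₁₃, g₁₄, g₂₃, g₂₄, g₃₄, hg, hG⟩ := exists_upperMatrix_of_isomorphic
      (h0 y₀ hy₀).1 (h0 y₀ hy₀).2.1 (h0 y₀ hy₀).2.2 a0 b0 c0 hiso
    obtain ⟨i₁, i₂, i₃, i₄, i₅⟩ := hG.invariants hg (h0 y₀ hy₀).1 (h0 y₀ hy₀).2.1 b0 c0
    rw [c2] at i₁
    rw [b2] at i₂
    rw [a3] at i₃
    rw [b1, c1, sub_zero] at i₄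
    rw [a1, c1, mul_zero, sub_zero] at i₅
    ext1 i
    fin_cases i
    · exact i₁
    · exact i₄
    · exact i₂
    · exact i₅
    · exact τ.2.2.symm
    · exact i₃
  have hcont : ContinuousOn σ U := fun y hy =>
    (continuousAt_pi.2 fun i => (hσhol i y hy).continuousAt).continuousWithinAt
  set U' := U ∩ σ ⁻¹' stableParams with hU'
  have hU'o : IsOpen U' := hcont.isOpen_inter_preimage hU isOpen_stableParams
  classical
  -- The default value `τ` is taken only outside the open set `U'`.
  set f : Y → slice stableParams ε₀ := fun y =>
    if h : σ y ∈ stableParams then ⟨σ y, h, rfl⟩ else τ with hf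
  have hfU : ∀ y ∈ U', (f y).1 = σ y := fun y hy => by
    rw [hf]
    simp only [dif_pos (show σ y ∈ stableParams from hy.2)]
  have hy₀' : y₀ ∈ U' := ⟨hy₀, by
    rw [Set.mem_preimage, hσ₀]
    exact τ.2.1⟩
  refine ⟨f, Subtype.ext ((hfU y₀ hy₀').trans hσ₀), U', hU'o, hy₀',
    holMapOn_ofSet _ fun i y hy => (hσhol i y hy.1).congr ?_, ?_⟩
  · filter_upwards [hU'o.mem_nhds hy] with y' hy'
    rw [hfU y' hy']
  have m₁ : SeriesHolOn S₁ U' := fun n y hy => h₁ n y hy.1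
  have m₂ : SeriesHolOn S₂ U' := fun n y hy => h₂ n y hy.1
  have m₃ : SeriesHolOn S₃ U' := fun n y hy => h₃ n y hy.1
  have ev_coeff : ∀ {S : Y → ℂ⟦X⟧} (hS : SeriesHolOn S U') (n : ℕ) (u : U'),
      ev u (PowerSeries.coeff n (mkS S hS)) = PowerSeries.coeff n (S u) := fun hS n u => by
    rw [← coeff_evS, evS_mkS]
  have hone : ∀ {S : Y → ℂ⟦X⟧} (hS : SeriesHolOn S U'), (∀ y ∈ U, PowerSeries.coeff 0 (S y) = 1) →
      PowerSeries.coeff 0 (mkS S hS) = 1 := fun hS h => ext_ev fun u => by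
    rw [ev_coeff, map_one, h u u.2.1]
  have hne : ∀ u : U', (σ u 0 ≠ 0 ∧ σ u 2 ≠ 0) ∧ 3 * σ u 0 - 5 * σ u 2 ≠ 0 := fun u => by
    have h1 := u.2.2
    simp only [Set.mem_preimage, stableParams, paramSpace, Set.mem_ofPred_eq, mul_ne_zero_iff] at h1
    exact ⟨h1.1.1, sub_ne_zero.2 h1.2⟩
  obtain ⟨g₁₂, g₁₃, g₁₄, g₂₃, g₂₄, g₃₄, hG⟩ := exists_intertwiner_canonical
    (algebraMap ℂ (holRing Y U') lam1) (algebraMap ℂ (holRing Y U') ε₀)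
    (hone m₁ fun y hy => (h0 y hy).1) (hone m₂ fun y hy => (h0 y hy).2.1)
    (hone m₃ fun y hy => (h0 y hy).2.2)
    (isUnit_iff.2 fun u => by rw [ev_coeff]; exact (hne u).1.2)
    (isUnit_iff.2 fun u => by rw [ev_coeff]; exact (hne u).1.1)
    (isUnit_iff.2 fun u => by
      rw [map_sub, map_mul, map_mul, map_ofNat, map_ofNat, ev_coeff, ev_coeff]; exact (hne u).2)
  refine pullbackIsoOn_canonicalFamily _ hU'o (fun y hy => hE y hy.1)
    (fun h hh j => (hol h hh j).mono fun y hy => ⟨hy.1.1, hy.2⟩)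
    (isUnit_upperMatrix isUnit_one g₁₂ g₁₃ g₁₄ g₂₃ g₂₄ g₃₄) fun u => ?_
  have h1 := hG.map (ev u : holRing Y U' →+* ℂ)
  have h2 : ∀ T₁ T₂ T₃ : (holRing Y U')⟦X⟧, (themeMatrix (algebraMap ℂ (holRing Y U') lam1)
      T₁ T₂ T₃).map (PowerSeries.map (ev u : holRing Y U' →+* ℂ)) =
      themeMatrix (lam1 : ℂ) (evS u T₁) (evS u T₂) (evS u T₃) := fun T₁ T₂ T₃ =>
    map_themeMatrix_evS _ _ _ _ u
  rw [h2, h2, evS_mkS, evS_mkS, evS_mkS, evS_cubicSeries, evS_cubicSeries, evS_cubicSeries] at h1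
  rw [hfU u u.2, canonicalMatrix_eq]
  simp only [map_sub, map_mul, map_ofNat, ev_coeff, map_zero, AlgHom.commutes] at h1
  exact h1

/-- The restriction of the canonical family to a slice is universal. -/
theorem isUniversalNear_slice {lam1 : ℚ} (hlam1 : 3 < lam1) (ε₀ : ℂ)
    (τ : slice stableParams ε₀) :
    IsUniversalNear (r := 3) (X := ReducedComplexSpace.ofSet _
      (isLocallyAnalytic_slice isOpen_stableParams ε₀)) lam1 ![3, 2, 2]
      (canonicalFamily lam1 _ (isLocallyAnalytic_slice isOpen_stableParams ε₀)) τ := by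
  refine ⟨isThemeFamily_canonicalFamily hlam1 _ fun σ hσ => hσ.1.1, fun Y H y₀ hH hiso =>
    ⟨exists_classifies hlam1 hH τ hiso, ?_⟩⟩
  -- Uniqueness is pointwise: `f y` and `f' y` have isomorphic fibres, so they are the same point of
  -- the slice.
  rintro f f' ⟨-, U, hU, hy₀, -, h⟩ ⟨-, U', hU', hy₀', -, h'⟩
  filter_upwards [hU.mem_nhds hy₀, hU'.mem_nhds hy₀'] with y hy hy'
  have := (h.isomorphic hy).trans (h'.isomorphic hy').symm
  exact Subtype.ext (eq_of_isomorphic_of_mem_slice (f y).2 (f' y).2 this)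

end Classifying

/-! ### No universal family at the invariant themes. -/

section NoUniversalFamily

open holRing

variable {X Y Z : ReducedComplexSpace}

/-- Pull-backs compose, when the intermediate family has a global frame. -/
theorem PullbackIsoOn.comp {k : ℕ} {M : Z → Matrix (Fin k) (Fin k) ℂ⟦X⟧}
    {hM : ∀ i j, SeriesHolOn (fun z => M z i j) Set.univ} {E : ABFamily X} {H : ABFamily Y}
    {f : Z → X} {U : Set Z} {g : Y → Z} {V : Set Y} (hU : IsOpen U) (hV : IsOpen V)
    (hf : HolMapOn f U) (hg : HolMapOn g V) (h : PullbackIsoOn f U E (ABFamily.ofMatrix Z M hM))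
    (h' : PullbackIsoOn g V (ABFamily.ofMatrix Z M hM) H) :
    PullbackIsoOn (fun y => f (g y)) (V ∩ g ⁻¹' U) E H := by
  obtain ⟨θ, hθ, hθh⟩ := h
  obtain ⟨η, hη, hηh⟩ := h'
  refine ⟨fun y => (η y).comp (θ (g y)), fun y hy =>
    ⟨(hη y hy.1).1.comp (hθ (g y) hy.2).1, fun v => ?_⟩, fun e he h hh j => ?_⟩
  · exact (congrArg (η y) ((hθ (g y) hy.2).2 v)).trans ((hη y hy.1).2 _)
  · have hgV : ContinuousOn g V := fun y hy => (hg y hy).1.continuousWithinAt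
    have hgU : IsOpen (V ∩ g ⁻¹' U) := hgV.isOpen_inter_preimage hV hU
    have hfg : ContinuousOn (fun y => f (g y)) (V ∩ g ⁻¹' U) := fun y hy =>
      (hf.comp hg y hy).1.continuousWithinAt
    have hW : IsOpen (V ∩ g ⁻¹' U ∩ (fun y => f (g y)) ⁻¹' e.dom ∩ h.dom) :=
      (hfg.isOpen_inter_preimage hgU e.isOpen_dom).inter h.isOpen_dom
    obtain ⟨S, hS, hSθ⟩ := hθh e he _ rfl j
    refine HolCombOn.trans hW (w := fun y (i : Fin k) => η y (Pi.basisFun ℂ⟦X⟧ (Fin k) i))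
      ⟨fun i y => S i (g y), fun i n y hy =>
        HolAt.comp_map hg hy.1.1.1 (hS i n (g y) ⟨⟨hy.1.1.2, hy.1.2⟩, trivial⟩), fun y hy => ?_⟩
      fun i => (hηh _ rfl h hh i).mono fun y hy => ⟨⟨hy.1.1.1, trivial⟩, hy.2⟩
    refine (congrArg (η y) (hSθ (g y) ⟨⟨hy.1.1.2, hy.1.2⟩, trivial⟩)).trans ?_
    rw [map_sum]
    simp only [map_smul]
    rfl

/-- A function on an open subset is extended by zero, so that analyticity in the ambient space and
the identity theorem apply. -/
theorem analyticAt_extend {n : ℕ} {A : Set (Fin n → ℂ)} (hA : IsOpen A) {h : A → ℂ} {x : A}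
    (hh : HolAt (X := ReducedComplexSpace.ofSet A (isLocallyAnalytic_of_isOpen hA)) h x) :
    AnalyticAt ℂ (Function.extend Subtype.val h 0) x.1 := by
  obtain ⟨c, rfl, -, F, hF, hfF⟩ := hh
  have key : (F : (Fin n → ℂ) → ℂ) =ᶠ[𝓝 x.1] Function.extend Subtype.val h 0 := by
    change ∀ᶠ z in 𝓝 x.1, _
    rw [← hA.isOpenEmbedding_subtypeVal.map_nhds_eq, Filter.eventually_map]
    filter_upwards [hfF] with y hy
    rw [Subtype.val_injective.extend_apply]
    exact hy.symm
  exact AnalyticAt.congr (f := (F : (Fin n → ℂ) → ℂ)) hF key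

theorem update_mem_paramSpace {σ : Fin 6 → ℂ} (hσ : σ ∈ paramSpace) (ε : ℂ) :
    Function.update σ 4 ε ∈ paramSpace := by
  simpa [paramSpace] using hσ

theorem analyticAt_update {n : ℕ} (σ : Fin n → ℂ) (i : Fin n) (z : ℂ) :
    AnalyticAt ℂ (fun ε => Function.update σ i ε) z := by
  refine analyticAt_pi_iff.2 fun j => ?_
  by_cases h : j = i
  · subst h
    simp only [Function.update_self]
    exact analyticAt_id
  · simpa [h] using analyticAt_const

/-- A holomorphic function which is constant on the curves
`s ↦ (…, ε₀ + s (3 α - 5 γ), …)` for `α` near `σ₀` does not depend on `ε` at `σ`. -/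
theorem eq_of_eventually_eq_shift {Ψ : ℂ → ℂ → ℂ} {α₀ ε₀ γ : ℂ} {r : ℝ} (hγ : 3 * α₀ = 5 * γ)
    (han : ∀ α ∈ Metric.ball α₀ r, AnalyticOnNhd ℂ (Ψ α) (Metric.ball ε₀ r))
    (hcont : ∀ ε ∈ Metric.ball ε₀ r, ContinuousAt (fun α => Ψ α ε) α₀)
    (h : ∀ᶠ α in 𝓝 α₀, ∀ᶠ s in 𝓝 (0 : ℂ), Ψ α ε₀ = Ψ α (ε₀ + s * (3 * α - 5 * γ)))
    {ε : ℂ} (hε : ε ∈ Metric.ball ε₀ r) : Ψ α₀ ε = Ψ α₀ ε₀ := by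
  have hr : 0 < r := dist_nonneg.trans_lt hε
  -- For `α ≠ α₀` the factor `3α - 5γ` is nonzero, so the shifts cover a neighbourhood of `ε₀` and
  -- the identity theorem applies on the ball. The value at `α₀` follows by continuity.
  have key : ∀ᶠ α in 𝓝[≠] α₀, Ψ α ε = Ψ α ε₀ := by
    filter_upwards [h.filter_mono nhdsWithin_le_nhds, self_mem_nhdsWithin,
      mem_nhdsWithin_of_mem_nhds (Metric.ball_mem_nhds α₀ hr)] with α hα hne hball
    have hd : 3 * α - 5 * γ ≠ 0 := fun h0 => hne (Set.mem_singleton_iff.2 (by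
      linear_combination (h0 - hγ) / 3))
    have ht : Filter.Tendsto (fun ε => (ε - ε₀) / (3 * α - 5 * γ)) (𝓝 ε₀) (𝓝 0) := by
      have : ContinuousAt (fun ε => (ε - ε₀) / (3 * α - 5 * γ)) ε₀ := by fun_prop
      simpa [ContinuousAt] using this
    refine AnalyticOnNhd.eqOn_of_preconnected_of_eventuallyEq (han α hball)
      (analyticOnNhd_const (v := Ψ α ε₀)) (convex_ball ε₀ r).isPreconnected
      (Metric.mem_ball_self hr) ?_ hε
    filter_upwards [ht.eventually hα] with ε' h'
    rw [h', div_mul_cancel₀ _ hd, add_sub_cancel]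
  exact tendsto_nhds_unique_of_eventuallyEq ((hcont ε hε).tendsto.mono_left nhdsWithin_le_nhds)
    ((hcont ε₀ (Metric.mem_ball_self hr)).tendsto.mono_left nhdsWithin_le_nhds) key

/-- The canonical family over the whole parameter space. -/
abbrev paramFamily (lam1 : ℚ) : ABFamily (ReducedComplexSpace.ofSet paramSpace
    (isLocallyAnalytic_of_isOpen isOpen_paramSpace)) :=
  canonicalFamily lam1 paramSpace (isLocallyAnalytic_of_isOpen isOpen_paramSpace)

/-- If `f` classifies the canonical family near `σ`, with values in a universal family, then
it is invariant under the transformations `(α, …, ε, …) ↦ (α, …, ε + s (3 α - 5 γ), …)`. -/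
theorem eventually_eq_shift {lam1 : ℚ} (hlam1 : 3 < lam1) {E : ABFamily X} {x₀ : X}
    (hE : IsUniversalNear (r := 3) lam1 ![3, 2, 2] E x₀) {σ : Fin 6 → ℂ} (hσ : σ ∈ paramSpace)
    (hiso : Isomorphic (E.fiber x₀) (canonicalTheme lam1 σ)) {f : paramSpace → X}
    (hf : Classifies E x₀ (paramFamily lam1) (⟨σ, hσ⟩ : paramSpace) f) :
    ∀ᶠ ρ in 𝓝 (Function.update σ 4 0), ∀ hρ : ρ ∈ paramSpace,
      f ⟨Function.update ρ 4 (σ 4), update_mem_paramSpace hρ _⟩ =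
        f ⟨Function.update ρ 4 (σ 4 + ρ 4 * (3 * ρ 0 - 5 * ρ 2)), update_mem_paramSpace hρ _⟩ := by
  set P := ReducedComplexSpace.ofSet paramSpace (isLocallyAnalytic_of_isOpen isOpen_paramSpace)
    with hP
  obtain ⟨hf₀, U, hU, hσU, hfU, hpull⟩ := hf
  -- The coordinate `ε` of the base is free, because the family `H` below has `ε` frozen at `σ 4`.
  -- It is reused as the parameter `s`, with base point at `s = 0`.
  set y₀ : paramSpace := ⟨Function.update σ 4 0, update_mem_paramSpace hσ _⟩ with hy₀
  set g : (paramSpace → ℂ) → paramSpace → paramSpace := fun z ρ =>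
    ⟨Function.update ρ.1 4 (z ρ), update_mem_paramSpace ρ.2 _⟩ with hg
  have hcoord : ∀ i, HolOn (X := P) (fun ρ : paramSpace => ρ.1 i) Set.univ := fun i x _ =>
    holAt_ofSet _ (F := fun σ => σ i) (fun z =>
      (ContinuousLinearMap.proj (R := ℂ) (φ := fun _ : Fin 6 => ℂ) i).analyticAt z) x
  have hghol : ∀ {z : paramSpace → ℂ}, HolOn (X := P) z Set.univ →
      ∀ i, HolOn (X := P) (fun ρ : paramSpace => (g z ρ).1 i) Set.univ := fun {z} hz i => by
    by_cases h : i = 4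
    · subst h
      simpa [hg] using hz
    · simpa [hg, h] using hcoord i
  have hmap : ∀ {z : paramSpace → ℂ}, HolOn (X := P) z Set.univ →
      HolMapOn (X := P) (Y := P) (g z) Set.univ := fun hz => holMapOn_ofSet _ (hghol hz)
  have hconst : HolOn (X := P) (fun _ : paramSpace => σ 4) Set.univ := fun x _ => holAt_const _ x
  set M : P → Matrix (Fin 4) (Fin 4) ℂ⟦X⟧ := fun ρ =>
    canonicalMatrix lam1 (g (fun _ => σ 4) ρ).1 with hMdef
  have hM : ∀ i j, SeriesHolOn (fun y => M y i j) Set.univ := fun i j n x hx =>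
    HolAt.comp_map (f := fun ρ : paramSpace => PowerSeries.coeff n (canonicalMatrix lam1 ρ.1 i j))
      (hmap hconst) hx (seriesHolOn_canonicalMatrix lam1 paramSpace _ i j n _ trivial)
  set H := ABFamily.ofMatrix P M hM with hH
  have hHtheme : IsThemeFamily (r := 3) lam1 ![3, 2, 2] H :=
    isThemeFamily_ofMatrix (Y := P) hlam1 (g := fun ρ => (g (fun _ => σ 4) ρ).1) (hghol hconst)
      (fun ρ => (g (fun _ => σ 4) ρ).2) hM
  -- For every holomorphic `s` vanishing at `y₀`, the shift of `ε` by `s (3α - 5γ)` pulls the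
  -- canonical family back to the same `H`, so composition with `f` classifies `H`.
  have hclass : ∀ s : paramSpace → ℂ, HolOn (X := P) s Set.univ → s y₀ = 0 →
      Classifies E x₀ H y₀ (fun ρ => f (g (fun ρ => σ 4 + s ρ * (3 * ρ.1 0 - 5 * ρ.1 2)) ρ)) := by
    intro s hs hs0
    set z : paramSpace → ℂ := fun ρ => σ 4 + s ρ * (3 * ρ.1 0 - 5 * ρ.1 2) with hz
    have hzhol : HolOn (X := P) z Set.univ := fun x hx => (hconst x hx).add ((hs x hx).mul
      ((((holAt_const 3 x).mul (hcoord 0 x hx)).add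
        ((holAt_const (-5) x).mul (hcoord 2 x hx))).congr
        (Filter.Eventually.of_forall fun y => by ring)))
    have hgy : g z y₀ = ⟨σ, hσ⟩ := by
      have hz0 : z y₀ = σ 4 := by
        rw [hz]
        simp only [hs0, zero_mul, add_zero]
      refine Subtype.ext ?_
      change Function.update y₀.1 4 (z y₀) = σ
      rw [hz0]
      simp [hy₀]
    set ρR : Fin 6 → holRing P Set.univ := fun i => mk _ (hghol hconst i) with hρR
    obtain ⟨g₁₂, g₁₃, g₁₄, g₂₃, g₂₄, g₃₄, hG⟩ := exists_intertwiner_canonical_shift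
      (algebraMap ℂ (holRing P Set.univ) lam1) (ρR 0) (ρR 1) (ρR 2) (ρR 3) (ρR 4) (ρR 5) (mk s hs)
      (isUnit_iff.2 fun u => by
        have := (g (fun _ => σ 4) u.1).2
        simp only [paramSpace, Set.mem_ofPred_eq, mul_ne_zero_iff] at this
        exact this.1.1)
      (isUnit_iff.2 fun u => by
        have := (g (fun _ => σ 4) u.1).2
        simp only [paramSpace, Set.mem_ofPred_eq, mul_ne_zero_iff] at this
        exact this.1.2)
    have hpb : PullbackIsoOn (X := P) (Y := P) (g z) Set.univ (paramFamily lam1) H := by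
      refine pullbackIsoOn_canonicalFamily _ isOpen_univ
        (E := fun _ j => Pi.basisFun ℂ⟦X⟧ (Fin 4) j) (M := M)
        (fun y _ => ⟨(Pi.basisFun ℂ⟦X⟧ (Fin 4)).linearIndependent,
          (Pi.basisFun ℂ⟦X⟧ (Fin 4)).span_eq, fun j => ABModule.ofMatrix_a_basisFun (M y) j⟩)
        (fun h hh j => ?_) (isUnit_upperMatrix isUnit_one g₁₂ g₁₃ g₁₄ g₂₃ g₂₄ g₃₄) fun u => ?_
      · rcases hh with rfl
        exact (H.compat _ rfl _ rfl j).mono fun y _ => ⟨trivial, trivial⟩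
      · have h1 := hG.map (ev u : holRing P Set.univ →+* ℂ)
        have h2 : ∀ T₁ T₂ T₃ : (holRing P Set.univ)⟦X⟧,
            (themeMatrix (algebraMap ℂ (holRing P Set.univ) lam1)
            T₁ T₂ T₃).map (PowerSeries.map (ev u : holRing P Set.univ →+* ℂ)) =
            themeMatrix (lam1 : ℂ) (evS u T₁) (evS u T₂) (evS u T₃) := fun T₁ T₂ T₃ =>
          map_themeMatrix_evS _ _ _ _ u
        rw [h2, h2, evS_cubicSeries, evS_cubicSeries, evS_cubicSeries, evS_cubicSeries] at h1
        have hne : ∀ i, i ≠ 4 → ev u (ρR i) = (g z u.1).1 i := fun i hi => by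
          change (Function.update _ _ _ : Fin 6 → ℂ) _ = (Function.update _ _ _ : Fin 6 → ℂ) _
          rw [Function.update_of_ne hi, Function.update_of_ne hi]
        have h4 : ev u (ρR 4 + mk s hs * (3 * ρR 0 - 5 * ρR 2)) = (g z u.1).1 4 := by
          rw [map_add, map_mul, map_sub, map_mul, map_mul, map_ofNat, map_ofNat]
          exact (Function.update_self 4 (z u.1) u.1.1).symm
        have hM' : M u.1 = themeMatrix (lam1 : ℂ)
          (cubicSeries (ev u (ρR 3)) (ev u (ρR 4)) (ev u (ρR 5)))
          (cubicSeries (ev u (ρR 1)) (ev u (ρR 2)) 0) (cubicSeries 0 (ev u (ρR 0)) 0) :=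
          canonicalMatrix_eq _ _
        rw [h4, map_zero] at h1
        rw [hM', canonicalMatrix_eq, ← hne 0 (by decide), ← hne 1 (by decide), ← hne 2 (by decide),
          ← hne 3 (by decide), ← hne 5 (by decide)]
        exact h1
    refine ⟨(congrArg f hgy).trans hf₀, Set.univ ∩ g z ⁻¹' U, ?_, ⟨trivial, ?_⟩,
      hfU.comp (hmap hzhol), PullbackIsoOn.comp hU isOpen_univ hfU (hmap hzhol) hpull hpb⟩
    · have hgc : ContinuousOn (g z) Set.univ := fun y hy => (hmap hzhol y hy).1.continuousWithinAt
      exact hgc.isOpen_inter_preimage isOpen_univ hU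
    · exact (congrArg (· ∈ U) hgy).mpr hσU
  have hHy : Isomorphic (H.fiber y₀) (E.fiber x₀) := by
    have : H.fiber y₀ = canonicalTheme lam1 σ := by
      change canonicalTheme lam1 (g (fun _ => σ 4) y₀).1 = _
      simp [hg, hy₀]
    rw [this]
    exact hiso.symm
  -- Uniqueness is applied to `s = 0` and to `s` the free coordinate.
  have heq := (hE.2 P H y₀ hHtheme hHy).2 _ _
    (hclass 0 (fun x _ => holAt_const 0 x) rfl)
    (hclass (fun ρ => ρ.1 4) (hcoord 4) (by simp [hy₀]))
  have hmapn := isOpen_paramSpace.isOpenEmbedding_subtypeVal.map_nhds_eq y₀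
  change ∀ᶠ ρ in 𝓝 y₀.1, _
  rw [← hmapn, Filter.eventually_map]
  filter_upwards [heq] with ρ hρ _
  have h1 : f (g (fun ρ => σ 4 + (0 : paramSpace → ℂ) ρ * (3 * ρ.1 0 - 5 * ρ.1 2)) ρ) =
    f (g (fun ρ => σ 4 + ρ.1 4 * (3 * ρ.1 0 - 5 * ρ.1 2)) ρ) := hρ
  simpa [hg] using h1

theorem LocalModel.injOn {X : Type} [TopologicalSpace X] (c : LocalModel X) :
    Set.InjOn c.toFun c.dom :=
  Set.injOn_iff_injective.2 c.isEmbedding.injective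

/-- There is no universal family near an invariant theme. -/
theorem not_isUniversalNear {lam1 : ℚ} (hlam1 : 3 < lam1) {E : ABFamily X} {x₀ : X}
    {σ : Fin 6 → ℂ} (hσ : σ ∈ paramSpace) (h35 : 3 * σ 0 = 5 * σ 2)
    (hiso : Isomorphic (E.fiber x₀) (canonicalTheme lam1 σ)) :
    ¬ IsUniversalNear (r := 3) lam1 ![3, 2, 2] E x₀ := by
  intro hE
  obtain ⟨⟨f, hf⟩, -⟩ := hE.2 _ (paramFamily lam1) (⟨σ, hσ⟩ : paramSpace)
    (isThemeFamily_canonicalFamily hlam1 _ fun _ h => h) hiso.symm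
  have hshift := eventually_eq_shift hlam1 hE hσ hiso hf
  obtain ⟨hf₀, U, hU, hσU, hfU, hpull⟩ := hf
  obtain ⟨c, hc, hx₀⟩ := X.cover x₀
  have hfc : ContinuousOn f U := fun y hy => (hfU y hy).1.continuousWithinAt
  have hV := hfc.isOpen_inter_preimage hU c.isOpen_dom
  have hσV : (⟨σ, hσ⟩ : paramSpace) ∈ U ∩ f ⁻¹' c.dom :=
    ⟨hσU, (congrArg (· ∈ c.dom) hf₀).mpr hx₀⟩
  -- On this ball `f` takes values in one chart of `X`, so its coordinates are analytic functions of
  -- the parameters.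
  obtain ⟨r, hr, hball⟩ := Metric.isOpen_iff.1
    (isOpen_paramSpace.isOpenEmbedding_subtypeVal.isOpenMap _ hV) σ ⟨_, hσV, rfl⟩
  have hmem : ∀ {α ε : ℂ}, α ∈ Metric.ball (σ 0) r → ε ∈ Metric.ball (σ 4) r →
      Function.update (Function.update σ 0 α) 4 ε ∈ Metric.ball σ r := fun {α ε} hα hε => by
    refine (dist_pi_lt_iff hr).2 fun i => ?_
    by_cases h4 : i = 4
    · subst h4
      simpa using hε
    · by_cases h0 : i = 0
      · subst h0
        simpa using hα
      · simpa [h4, h0] using hr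
  have han : ∀ i, ∀ ρ ∈ Metric.ball σ r, AnalyticAt ℂ
      (Function.extend Subtype.val (fun y : paramSpace => c.toFun (f y) i) 0) ρ := by
    intro i ρ hρ
    obtain ⟨y, hy, rfl⟩ := hball hρ
    exact analyticAt_extend isOpen_paramSpace ((hfU y hy.1).2 c hc hy.2 i)
  have hα4 : ∀ α ε z, Function.update (Function.update (Function.update σ 0 α) 4 ε) 4 z =
      Function.update (Function.update σ 0 α) 4 z := fun α ε z => Function.update_idem _ _ _
  have hcurve : Filter.Tendsto (fun p : ℂ × ℂ => Function.update (Function.update σ 0 p.1) 4 p.2)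
      (𝓝 (σ 0) ×ˢ 𝓝 0) (𝓝 (Function.update σ 4 0)) := by
    rw [← nhds_prod_eq]
    have : Continuous fun p : ℂ × ℂ => Function.update (Function.update σ 0 p.1) 4 p.2 := by
      fun_prop
    simpa using this.tendsto (σ 0, 0)
  have hconst : ∀ i, ∀ ε ∈ Metric.ball (σ 4) r,
      Function.extend Subtype.val (fun y : paramSpace => c.toFun (f y) i) 0
        (Function.update (Function.update σ 0 (σ 0)) 4 ε) =
      Function.extend Subtype.val (fun y : paramSpace => c.toFun (f y) i) 0
        (Function.update (Function.update σ 0 (σ 0)) 4 (σ 4)) := by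
    intro i ε hε
    refine eq_of_eventually_eq_shift (Ψ := fun α ε =>
      Function.extend Subtype.val (fun y : paramSpace => c.toFun (f y) i) 0
        (Function.update (Function.update σ 0 α) 4 ε)) (r := r) h35 (fun α hα ε hε => ?_)
      (fun ε hε => ?_) ?_ hε
    · exact (han i _ (hmem hα hε)).comp (analyticAt_update _ _ _)
    · have h1 := (han i _ (hmem (Metric.mem_ball_self hr) hε)).continuousAt
      have h2 : Continuous fun α : ℂ => Function.update (Function.update σ 0 α) 4 ε := by fun_prop
      exact h1.comp (f := fun α : ℂ => Function.update (Function.update σ 0 α) 4 ε) h2.continuousAt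
    · have hp : ∀ᶠ α in 𝓝 (σ 0), ∀ᶠ s in 𝓝 (0 : ℂ),
          Function.update (Function.update σ 0 α) 4 s ∈ paramSpace :=
        (hcurve.eventually (isOpen_paramSpace.mem_nhds (update_mem_paramSpace hσ 0))).curry
      filter_upwards [(hcurve.eventually hshift).curry, hp] with α h1 h2
      filter_upwards [h1, h2] with s h1 h2
      have h3 := h1 h2
      simp only [hα4] at h3
      have hext : ∀ {ρ} (hρ : ρ ∈ paramSpace), Function.extend Subtype.val
          (fun y : paramSpace => c.toFun (f y) i) 0 ρ = c.toFun (f ⟨ρ, hρ⟩) i := fun {ρ} hρ =>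
        Subtype.val_injective.extend_apply (fun y : paramSpace => c.toFun (f y) i) 0 ⟨ρ, hρ⟩
      have h4 : ∀ z, Function.update (Function.update σ 0 α) 4 z ∈ paramSpace := fun z => by
        rw [← hα4 α s z]
        exact update_mem_paramSpace h2 z
      rw [hext (h4 _), hext (h4 _)]
      refine congrArg (fun x => c.toFun x i) (h3.trans ?_)
      congr 2
  -- A second value of `ε` in the ball. Then `f` agrees at the two points, whose themes are
  -- therefore isomorphic, although `ε` is an invariant on the hyperplane.
  set ε₁ : ℂ := σ 4 + (r / 2 : ℝ) with hε₁
  have hε₁r : ε₁ ∈ Metric.ball (σ 4) r := by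
    rw [Metric.mem_ball, hε₁, dist_eq_norm, add_sub_cancel_left, Complex.norm_real,
      Real.norm_of_nonneg (by positivity)]
    linarith
  have hmem₁ := hball (hmem (Metric.mem_ball_self hr) hε₁r)
  simp only [Function.update_eq_self] at hconst hmem₁
  obtain ⟨y, hy, hyσ⟩ := hmem₁
  have hfy : f y = f ⟨σ, hσ⟩ := by
    refine c.injOn hy.2 hσV.2 (funext fun i => ?_)
    have h1 := hconst i ε₁ hε₁r
    rw [← hyσ, Subtype.val_injective.extend_apply] at h1
    exact h1.trans (Subtype.val_injective.extend_apply (fun y : paramSpace => c.toFun (f y) i) 0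
      ⟨σ, hσ⟩)
  have h1 : Isomorphic (E.fiber (f y)) (canonicalTheme lam1 y.1) := hpull.isomorphic hy.1
  have h2 : Isomorphic (E.fiber (f ⟨σ, hσ⟩)) (canonicalTheme lam1 σ) := hpull.isomorphic hσU
  rw [hfy] at h1
  have h3 := hσ
  simp only [paramSpace, Set.mem_ofPred_eq, mul_ne_zero_iff] at h3
  have h4 := (isomorphic_canonicalTheme (h2.symm.trans h1)).2 h3.1.2 h35
  have h5 : (r / 2 : ℝ) = (0 : ℂ) := by
    have := congrFun (h4.trans hyσ) 4
    rw [Function.update_self, hε₁] at this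
    simpa using this
  rw [Complex.ofReal_eq_zero] at h5
  linarith

end NoUniversalFamily

end Themes

end

theorem mainTheorem6 (lam1 : ℚ) (hlam1 : 3 < lam1) :
    -- the canonical family is a holomorphic family of themes with the given invariants
    Themes.IsThemeFamily lam1 ![3, 2, 2]
      (Themes.canonicalFamily lam1 Themes.paramSpace
        (Themes.isLocallyAnalytic_of_isOpen Themes.isOpen_paramSpace)) ∧
    -- off the hyperplane `3α = 5γ`: not invariant, and `ε` does not matter
    (∀ σ ∈ Themes.paramSpace, 3 * σ 0 ≠ 5 * σ 2 →
      ¬ Themes.IsInvariant (Themes.canonicalTheme lam1 σ) ∧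
      ∀ ε : ℂ, Themes.Isomorphic (Themes.canonicalTheme lam1 (Function.update σ 4 ε))
        (Themes.canonicalTheme lam1 σ)) ∧
    -- on the hyperplane: invariant, without local universal family
    (∀ σ ∈ Themes.paramSpace, 3 * σ 0 = 5 * σ 2 →
      Themes.IsInvariant (Themes.canonicalTheme lam1 σ) ∧
      ¬ ∃ (X : Themes.ReducedComplexSpace) (E : Themes.ABFamily X) (x₀ : X),
        Themes.Isomorphic (E.fiber x₀) (Themes.canonicalTheme lam1 σ) ∧
        Themes.IsUniversalNear lam1 ![3, 2, 2] E x₀) ∧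
    -- off the hyperplane: the restriction to a neighbourhood in the slice is universal
    (∀ σ ∈ Themes.paramSpace, 3 * σ 0 ≠ 5 * σ 2 →
      ∃ (W : Set (Fin 6 → ℂ)) (hW : IsOpen W), W ⊆ Themes.paramSpace ∧ σ ∈ W ∧
        (∀ τ : Themes.slice W (σ 4),
          Themes.IsUniversalNear lam1 ![3, 2, 2]
            (Themes.canonicalFamily lam1 (Themes.slice W (σ 4))
              (Themes.isLocallyAnalytic_slice hW (σ 4))) τ) ∧
        ∀ τ ∈ Themes.slice W (σ 4), ∀ τ' ∈ Themes.slice W (σ 4),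
          Themes.Isomorphic (Themes.canonicalTheme lam1 τ) (Themes.canonicalTheme lam1 τ') →
            τ = τ') := by
  refine ⟨Themes.isThemeFamily_canonicalFamily hlam1 _ fun _ h => h, fun σ hσ h =>
    ⟨Themes.not_isInvariant_canonicalTheme hσ h, Themes.isomorphic_canonicalTheme_update hσ h⟩,
    fun σ hσ h => ⟨Themes.isInvariant_canonicalTheme hσ h, ?_⟩, fun σ hσ h =>
    -- The neighbourhood can be taken independent of `σ`: it is the whole complement of the
    -- hyperplane in the parameter space.
    ⟨Themes.stableParams, Themes.isOpen_stableParams, fun _ h => h.1, ⟨hσ, h⟩,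
      Themes.isUniversalNear_slice hlam1 (σ 4), fun τ hτ τ' hτ' =>
        Themes.eq_of_isomorphic_of_mem_slice hτ hτ'⟩⟩
  rintro ⟨X, E, x₀, hiso, hE⟩
  exact Themes.not_isUniversalNear hlam1 hσ h hiso hE
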